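/- **Setting.** Fix integers $K,M\ge 1$, $d\ge 2$, reals $\lambda,\xi>0$, weights $w_k>0$ ($1\le k\le K$) and $v_m>0$ ($1\le m\le M$) with $\sum_k w_k=\sum_m v_m=1$, and service rates $u_m>0$, with $\lambda\xi<\sum_m u_mv_m$. For each $N\ge1$ let $G^N=(W^N,V^N,E^N)$ be a system with a finite set $W^N$ of $W(N)$ dispatchers, a set $V^N$ of $N$ servers and a compatibility relation $E^N\subseteq W^N\times V^N$; each dispatcher has one of $K$ types and each server one of $M$ types. $W^N_k$ and $V^N_m$ denote the sets of dispatchers of type $k$ and of servers of type $m$. Assume $W(N)/N\to\xi$, $|W^N_k|/W(N)\to w_k$ and $|V^N_m|/N\to v_m$. Let $\mathcal N^N(i)=\{j:(i,j)\in E^N\}$ and $\delta^N_i=|\mathcal N^N(i)|$. Tasks arrive at each dispatcher as independent Poisson processes of rate $\lambda$; servers of type $m$ serve their queues at exponential rate $u_m$. A task arriving at dispatcher $i$ with $\delta^N_i\ge d$ joins at once the shortest queue among $d$ distinct servers drawn uniformly at random from $\mathcal N^N(i)$, ties being broken uniformly at random; if $0<\delta^N_i<d$ it joins a uniformly chosen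 server of $\mathcal N^N(i)$ (and if $\delta_i^N=0$ it is lost). Let $X^N_j(t)$ be the queue length (including the task in service) of server $j$ at time $t$; $X^N=(X^N_j)_{j\in V^N}$ is a continuous-time Markov chain. Let $\mathbf q^N(t)=(q^N_{m,l}(t))_{m\le M,\,l\ge0}$ with $q^N_{m,l}(t)=|\{j\in V^N_m:X^N_j(t)\ge l\}|/|V^N_m|$. It takes values in $$\mathcal S=\Big\{\mathbf q\in[0,1]^{M\times\mathbb N_0}:\ q_{m,0}=1,\ q_{m,l}\ge q_{m,l+1},\ \sum_l q_{m,l}<\infty\ \text{ for all } m,l\Big\},$$ equipped with the $\ell_1$-topology. **Assumptions.** 1. For all $k,m$: the number of edges between $W^N_k$ and $V^N_m$ divided by $|W^N_k||V^N_m|$ converges to some $p_{k,m}\in[0,1]$; the quotient of the largest and the smallest number of neighbours in $V^N_m$ of a dispatcher in $W^N_k$ tends to $1$; and the quotient of the largest and the smallest number of neighbours in $W^N_k$ of a server in $V^N_m$ tends to $1$ (with $0/0=1$ in the last two). Moreover $\delta_k:=\sum_m p_{k,m}v_m>0$ for every $k$. 2. (Clustered proportional sparsity.) For every $\varepsilon>0$,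 $$\max_{k}\ \max_{U\subseteq V^N}\frac1{|W^N_k|}\Big|\Big\{i\in W^N_k:\Big|\frac{|\mathcal N^N(i)\cap U|}{|\mathcal N^N(i)|}-\frac{|E^N_k(U)|}{|E^N_k(V^N)|}\Big|\ge\varepsilon\Big\}\Big|\xrightarrow[N\to\infty]{}0,$$ where $E^N_k(U)=E^N\cap(W^N_k\times U)$. 3. (Subcritical regime.) $\rho^N\to\rho$ for some $\rho<1$, where, $m(j)$ denoting the type of server $j$, $$\rho^N=\max_{\emptyset\ne U\subseteq V^N}\Big(\sum_{j\in U}u_{m(j)}\Big)^{-1}\sum_{i\in W^N}\lambda\Big(\mathbf 1_{\{\delta^N_i\ge d\}}\frac{\binom{|U\cap\mathcal N^N(i)|}{d}}{\binom{\delta^N_i}{d}}+\mathbf 1_{\{0<\delta^N_i<d\}}\frac{|U\cap\mathcal N^N(i)|}{\delta^N_i}\Big).$$ **Theorem (Convergence of steady states).** Under these assumptions, for all large $N$ the process $X^N$ has exactly one stationary distribution, and, writing $\mathbf q^N(\infty)$ for the occupancy vector under this distribution, $\mathbf q^N(t)$ converges weakly to $\mathbf q^N(\infty)$ as $t\to\infty$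 for every initial law of $X^N$. The system of ODEs, for $m\le M$ and $l\ge1$, $$\frac{dq_{m,l}}{dt}=-u_m(q_{m,l}-q_{m,l+1})+\lambda\xi\,(q_{m,l-1}-q_{m,l})\sum_{k=1}^K\frac{p_{k,m}w_k}{\delta_k}\,\frac{\tilde q_{k,l-1}^{\,d}-\tilde q_{k,l}^{\,d}}{\tilde q_{k,l-1}-\tilde q_{k,l}},\qquad q_{m,0}=1,\qquad \tilde q_{k,l}=\sum_{m=1}^M\frac{v_mp_{k,m}}{\delta_k}q_{m,l}$$ (a summand of the first sum being read as $0$ when $\tilde q_{k,l-1}=\tilde q_{k,l}$, in which case $p_{k,m}(q_{m,l-1}-q_{m,l})=0$ anyway), has exactly one fixed point $\mathbf q^*$ in $\mathcal S$, i.e. exactly one point of $\mathcal S$ at which all right-hand sides vanish. As $N\to\infty$, $\mathbf q^N(\infty)$ converges weakly to $\mathbf q^*$ in $\mathcal S$ with the $\ell_1$-topology. -/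

import Mathlib

open Filter Topology MeasureTheory

namespace JSQ

/-- The system with `N` servers: `numDisp` dispatchers, a type in `{1,…,K}` for each dispatcher,
a type in `{1,…,M}` for each server, and the set of compatible (dispatcher, server) pairs. -/
structure System (K M N : ℕ) where
  numDisp : ℕ
  dispType : Fin numDisp → Fin K
  servType : Fin N → Fin M
  edges : Finset (Fin numDisp × Fin N)

namespace System

variable {K M N : ℕ} (G : System K M N)

/-- The dispatchers of type `k`. -/
def dispOf (k : Fin K) : Finset (Fin G.numDisp) := Finset.univ.filter (fun i => G.dispType i = k)

/-- The servers of type `m`. -/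
def servOf (m : Fin M) : Finset (Fin N) := Finset.univ.filter (fun j => G.servType j = m)

/-- The neighbourhood of dispatcher `i`. -/
def nbr (i : Fin G.numDisp) : Finset (Fin N) := Finset.univ.filter (fun j => (i, j) ∈ G.edges)

/-- The degree of dispatcher `i`. -/
def deg (i : Fin G.numDisp) : ℕ := (G.nbr i).card

/-- The number of servers of type `m` adjacent to dispatcher `i`. -/
def degW (i : Fin G.numDisp) (m : Fin M) : ℕ :=
  ((G.servOf m).filter (fun j => (i, j) ∈ G.edges)).card

/-- The number of dispatchers of type `k` adjacent to server `j`. -/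
def degV (k : Fin K) (j : Fin N) : ℕ :=
  ((G.dispOf k).filter (fun i => (i, j) ∈ G.edges)).card

/-- The edges between the dispatchers of type `k` and the set `U` of servers. -/
def edgesTo (k : Fin K) (U : Finset (Fin N)) : Finset (Fin G.numDisp × Fin N) :=
  (G.dispOf k ×ˢ U).filter (fun e => e ∈ G.edges)

/-- The servers of `S` whose queue is shortest within `S`. -/
def shortest (x : Fin N → ℕ) (S : Finset (Fin N)) : Finset (Fin N) :=
  S.filter (fun j => ∀ j' ∈ S, x j ≤ x j')

open Classical in
/-- The probability that a task arriving at dispatcher `i` in state `x` is assigned to server `j`.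
If the degree of `i` is at least `d`, a `d`-subset `S` of the neighbourhood is drawn uniformly at
random and the task joins a uniformly chosen shortest queue in `S`; otherwise the task joins a
uniformly chosen neighbour. (A task at a dispatcher without neighbours is lost.) -/
noncomputable def assignProb (d : ℕ) (x : Fin N → ℕ) (i : Fin G.numDisp) (j : Fin N) : ℝ :=
  if d ≤ G.deg i then
    ∑ S ∈ (G.nbr i).powersetCard d,
      if j ∈ shortest x S then
        ((G.deg i).choose d : ℝ)⁻¹ * ((shortest x S).card : ℝ)⁻¹
      else 0
  else if j ∈ G.nbr i then (G.deg i : ℝ)⁻¹ else 0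

/-- The total rate at which tasks join server `j` in state `x`. -/
noncomputable def arrivalRate (d : ℕ) (lam : ℝ) (x : Fin N → ℕ) (j : Fin N) : ℝ :=
  ∑ i : Fin G.numDisp, lam * G.assignProb d x i j

/-- The generator of the Markov process of queue lengths under the local JSQ(`d`) policy, with
arrival rate `lam` at each dispatcher and service rate `u m` at each server of type `m`. -/
noncomputable def generator (d : ℕ) (lam : ℝ) (u : Fin M → ℝ) (f : (Fin N → ℕ) → ℝ)
    (x : Fin N → ℕ) : ℝ :=
  ∑ j : Fin N,
    (G.arrivalRate d lam x j * (f (Function.update x j (x j + 1)) - f x) +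
      if 0 < x j then u (G.servType j) * (f (Function.update x j (x j - 1)) - f x) else 0)

/-- `μ t`, `t ≥ 0`, are the laws at time `t` of the queue length process for some initial law:
they solve the Kolmogorov forward equation (tested against all bounded functions). The
generator is bounded, so there is exactly one solution for each initial law. -/
def IsQueueLaw (d : ℕ) (lam : ℝ) (u : Fin M → ℝ) (μ : ℝ → ProbabilityMeasure (Fin N → ℕ)) :
    Prop :=
  ∀ f : (Fin N → ℕ) → ℝ, (∃ C : ℝ, ∀ x, |f x| ≤ C) → ∀ t : ℝ, 0 ≤ t →
    HasDerivWithinAt (fun s => ∫ x, f x ∂(μ s : Measure (Fin N → ℕ)))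
      (∫ x, G.generator d lam u f x ∂(μ t : Measure (Fin N → ℕ))) (Set.Ici 0) t

/-- `π` is a stationary law: the queue length process started from `π` has law `π` at all times. -/
def IsStationary (d : ℕ) (lam : ℝ) (u : Fin M → ℝ) (π : ProbabilityMeasure (Fin N → ℕ)) : Prop :=
  G.IsQueueLaw d lam u (fun _ => π)

/-- The load `ρ^N`: the maximum over nonempty sets `U` of servers of the total rate of tasks that
are necessarily assigned within `U`, divided by the total service rate of `U`. -/
noncomputable def load (d : ℕ) (lam : ℝ) (u : Fin M → ℝ) : ℝ :=
  ⨆ U : {U : Finset (Fin N) // U.Nonempty},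
    (∑ j ∈ U.1, u (G.servType j))⁻¹ *
      ∑ i : Fin G.numDisp,
        if d ≤ G.deg i then
          ∑ _S ∈ (U.1 ∩ G.nbr i).powersetCard d, lam / ((G.deg i).choose d : ℝ)
        else lam * ((U.1 ∩ G.nbr i).card : ℝ) / (G.deg i : ℝ)

end System

/-- The quotient of two degrees, equal degrees (in particular `0` and `0`) having quotient `1`.
If `b = 0 < a` its value is `0`, so that it is then not close to `1`. -/
noncomputable def degRatio (a b : ℕ) : ℝ := if a = b then 1 else (a : ℝ) / (b : ℝ)

/-- The condition on the edge densities and on the regularity of degrees, with compatibility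
matrix `p`. The suprema and infima are the maxima and minima of finite sets of degrees. -/
structure CompatibilityCondition {K M : ℕ} (G : ∀ N : ℕ, System K M N)
    (p : Fin K → Fin M → ℝ) : Prop where
  density : ∀ k m, Tendsto (fun N => (((G N).edgesTo k ((G N).servOf m)).card : ℝ) /
    (((G N).dispOf k).card * ((G N).servOf m).card)) atTop (𝓝 (p k m))
  disp_regular : ∀ k m, Tendsto (fun N => degRatio
    (sSup ((fun i => (G N).degW i m) '' {i | i ∈ (G N).dispOf k}))
    (sInf ((fun i => (G N).degW i m) '' {i | i ∈ (G N).dispOf k}))) atTop (𝓝 1)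
  serv_regular : ∀ k m, Tendsto (fun N => degRatio
    (sSup ((fun j => (G N).degV k j) '' {j | j ∈ (G N).servOf m}))
    (sInf ((fun j => (G N).degV k j) '' {j | j ∈ (G N).servOf m}))) atTop (𝓝 1)

open Classical in
/-- Clustered proportional sparsity. -/
def ClusteredProportionallySparse {K M : ℕ} (G : ∀ N : ℕ, System K M N) : Prop :=
  ∀ ε : ℝ, 0 < ε → Tendsto (fun N => ⨆ k : Fin K, ⨆ U : Finset (Fin N),
    ((((G N).dispOf k).filter (fun i =>
        ε ≤ |(((G N).nbr i ∩ U).card : ℝ) / (((G N).nbr i).card : ℝ) -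
          (((G N).edgesTo k U).card : ℝ) / (((G N).edgesTo k Finset.univ).card : ℝ)|)).card : ℝ) /
      (((G N).dispOf k).card : ℝ)) atTop (𝓝 0)

/-- The space of occupancy vectors `(q_{m,l})`: summable, `q_{m,0} = 1`, and nonincreasing in `l`
with nonnegative entries (hence entries in `[0,1]`). As a subtype of `ℓ¹` it carries the
`ℓ¹` topology. -/
abbrev OccSpace (M : ℕ) : Type :=
  {q : lp (fun _ : Fin M × ℕ => ℝ) 1 //
    ∀ m, q (m, 0) = 1 ∧ ∀ l, 0 ≤ q (m, l) ∧ q (m, l + 1) ≤ q (m, l)}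

noncomputable instance (M : ℕ) : MeasurableSpace (OccSpace M) := borel _

instance (M : ℕ) : BorelSpace (OccSpace M) := ⟨rfl⟩

/-- The fraction of servers of type `m` with at least `l` tasks in state `x` (at `l = 0` it is
set to be `1`, which is the value of the quotient as soon as there is a server of type `m`). -/
noncomputable def System.occ {K M N : ℕ} (G : System K M N) (x : Fin N → ℕ) (e : Fin M × ℕ) : ℝ :=
  if e.2 = 0 then 1
  else (((G.servOf e.1).filter (fun j => e.2 ≤ x j)).card : ℝ) / ((G.servOf e.1).card : ℝ)

theorem System.occ_memℓp {K M N : ℕ} (G : System K M N) (x : Fin N → ℕ) :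
    Memℓp (G.occ x) 1 := by
  apply memℓp_gen
  apply summable_of_hasFiniteSupport
  apply Set.Finite.subset
    (Finset.finite_toSet (Finset.univ ×ˢ Finset.range (∑ j, x j + 1) : Finset (Fin M × ℕ)))
  rintro ⟨m, l⟩ h
  simp only [Finset.coe_product, Finset.coe_univ, Set.mem_prod, Set.mem_univ, true_and,
    Finset.coe_range, Set.mem_Iio]
  by_contra hl
  push Not at hl
  apply h
  have h0 : l ≠ 0 := by omega
  have he : (G.servOf m).filter (fun j => l ≤ x j) = ∅ := by
    apply Finset.filter_eq_empty_iff.2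
    intro j _ hj
    have := Finset.single_le_sum (f := x) (fun i _ => Nat.zero_le _) (Finset.mem_univ j)
    omega
  simp [System.occ, h0, he]

theorem System.occ_spec {K M N : ℕ} (G : System K M N) (x : Fin N → ℕ) (m : Fin M) :
    G.occ x (m, 0) = 1 ∧ ∀ l, 0 ≤ G.occ x (m, l) ∧ G.occ x (m, l + 1) ≤ G.occ x (m, l) := by
  refine ⟨by simp [System.occ], fun l => ⟨?_, ?_⟩⟩
  · unfold System.occ
    split_ifs <;> positivity
  · by_cases h : l = 0
    · subst h
      simp only [System.occ]
      rw [if_neg (by simp), if_pos trivial]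
      apply div_le_one_of_le₀ _ (by positivity)
      exact_mod_cast Finset.card_filter_le _ _
    · simp only [System.occ, h, if_false, Nat.succ_ne_zero]
      gcongr
      omega

/-- The occupancy vector of state `x`. -/
noncomputable def System.occupancy {K M N : ℕ} (G : System K M N) (x : Fin N → ℕ) : OccSpace M :=
  ⟨⟨G.occ x, G.occ_memℓp x⟩, G.occ_spec x⟩

/-- The law of the occupancy vector when the queue lengths have law `π`. -/
noncomputable def System.occupancyLaw {K M N : ℕ} (G : System K M N)
    (π : ProbabilityMeasure (Fin N → ℕ)) : ProbabilityMeasure (OccSpace M) :=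
  π.map (f := G.occupancy) (measurable_of_countable _).aemeasurable

/-- `δ_k = ∑_m p_{k,m} v_m`. -/
noncomputable def limDeg {K M : ℕ} (p : Fin K → Fin M → ℝ) (v : Fin M → ℝ) (k : Fin K) : ℝ :=
  ∑ m, p k m * v m

/-- `q̃_{k,l} = ∑_m (v_m p_{k,m} / δ_k) q_{m,l}`. -/
noncomputable def qTilde {K M : ℕ} (p : Fin K → Fin M → ℝ) (v : Fin M → ℝ) (q : OccSpace M)
    (k : Fin K) (l : ℕ) : ℝ :=
  ∑ m, v m * p k m / limDeg p v k * q.1 (m, l)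

/-- The right-hand side of the limiting system of ODEs for `dq_{m,l}/dt`, `l ≥ 1`. When
`q̃_{k,l-1} = q̃_{k,l}` the last quotient reads `0 / 0 = 0`; its value is then immaterial, since
`p_{k,m} (q_{m,l-1} - q_{m,l}) = 0`. -/
noncomputable def odeDrift {K M : ℕ} (d : ℕ) (lam ξ : ℝ) (w : Fin K → ℝ) (v u : Fin M → ℝ)
    (p : Fin K → Fin M → ℝ) (q : OccSpace M) (m : Fin M) (l : ℕ) : ℝ :=
  -u m * (q.1 (m, l) - q.1 (m, l + 1)) +
    lam * ξ * (q.1 (m, l - 1) - q.1 (m, l)) *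
      ∑ k, p k m * w k / limDeg p v k *
        ((qTilde p v q k (l - 1) ^ d - qTilde p v q k l ^ d) /
          (qTilde p v q k (l - 1) - qTilde p v q k l))

/-- A fixed point, in the space of occupancy vectors, of the limiting system of ODEs. -/
def IsFixedPoint {K M : ℕ} (d : ℕ) (lam ξ : ℝ) (w : Fin K → ℝ) (v u : Fin M → ℝ)
    (p : Fin K → Fin M → ℝ) (q : OccSpace M) : Prop :=
  ∀ m l, 1 ≤ l → odeDrift d lam ξ w v u p q m l = 0

end JSQ

/-!
The stationary laws are studied through their generator only: `π` is stationary if and only if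
`∫ 𝓛 f dπ = 0` for all bounded `f`, and no limit theorem for the processes is needed.

**Ergodicity for fixed `N`.** Once all degrees are at least `d`, a task joins a server with at
least `l` tasks exactly when all sampled servers have at least `l` tasks, so the set of the servers
with at least `l` tasks receives tasks at a rate of at most `load` times its service rate
(`System.sum_arrivalRate_filter_le`). Summation over the layers `l` yields the drift of the
Lyapunov function `∑ j, x j ^ 3` (`System.generator_cube_le`). With it, a stationary law is a limit
of time averages (`JumpChain.Stable.exists_stationary`), and all laws converge to it, because the
only bounded subharmonic function of two independent copies of the uniformized chain that vanishes
at `(0, 0)` is zero (`JumpChain.Stable.subharmonic_eq_zero`). The passage from the uniformized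
chain to continuous time is an estimate for the system of ODEs `e_n' = Λ (e_{n+1} - e_n)`. The
same drift bounds the second moments of the stationary queue lengths uniformly in `N`
(`Regime.exists_integral_meanSq_le`).

**The generator on occupancies.** By clustered proportional sparsity and the regularity of the
degrees, most dispatchers of type `k` see, in any state, the occupancies in the limiting
proportions. Hence the generator on functions of finitely many coordinates of the occupancy
converges to the derivative along the limiting drift, uniformly in the state
(`Regime.eventually_generator`).

**Contraction.** In the limiting system arrivals are monotone and conserve mass. Therefore they
contract the weighted `ℓ¹` distance of two occupancies, while the departures decrease it at the rate
`∑ m, u m * v m * |q (m, 1) - q' (m, 1)|` (`LimitData.sum_mul_drift_sub_le`). At a fixed point the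
level `l + 2` is determined by the levels `l` and `l + 1`, so there is at most one fixed point
(`LimitData.fixedPoint_unique`).

**Convergence.** The same two arguments apply to two independent stationary systems with `N` and
`N'` servers: testing stationarity with a smoothed `ℓ¹` distance shows that their occupancies agree
asymptotically at level `1` (`Regime.tendsto_pairMean_one`), and testing it with products of
consecutive coordinates propagates this to all levels (`Regime.tendsto_pairMean_succ`). As the two
copies are independent, the occupancies concentrate around constants, which form a fixed point; this
also proves its existence. The second moments control the tails, so the concentration holds in `ℓ¹`
(`Regime.exists_tendsto_occupancyLaw`).
-/

/-! ### Uniformized jump chains with finitely many transitions -/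

/-- A continuous-time jump chain on `X`: transition `a` leads from `x` to `step a x` at rate
`rate a x`. The total rate is strictly smaller than `bound`, so that the uniformized chain has a
positive holding probability in every state. -/
structure JumpChain (X ι : Type*) [Fintype ι] where
  rate : ι → X → ℝ
  step : ι → X → X
  bound : ℝ
  rate_nonneg : ∀ a x, 0 ≤ rate a x
  bound_pos : 0 < bound
  sum_rate_lt : ∀ x, ∑ a, rate a x < bound

namespace JumpChain

variable {X ι : Type*} [Fintype ι] (Q : JumpChain X ι)

/-- The generator of the chain. -/
def gen (f : X → ℝ) (x : X) : ℝ := ∑ a, Q.rate a x * (f (Q.step a x) - f x)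

/-- The transition probabilities of the uniformized chain; `none` stands for holding. -/
noncomputable def wt (o : Option ι) (x : X) : ℝ :=
  o.elim (1 - ∑ a, Q.rate a x / Q.bound) (fun a => Q.rate a x / Q.bound)

/-- The state reached by a transition of the uniformized chain. -/
def tgt (o : Option ι) (x : X) : X := o.elim x (fun a => Q.step a x)

/-- The transition operator of the uniformized chain. -/
noncomputable def trans : Module.End ℝ (X → ℝ) where
  toFun f x := ∑ o, Q.wt o x * f (Q.tgt o x)
  map_add' f g := by
    ext x; simp only [Pi.add_apply, mul_add, Finset.sum_add_distrib]
  map_smul' c f := by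
    ext x
    simp only [Pi.smul_apply, smul_eq_mul, RingHom.id_apply, Finset.mul_sum]
    exact Finset.sum_congr rfl fun o _ => by ring

theorem trans_apply (f : X → ℝ) (x : X) : Q.trans f x = ∑ o, Q.wt o x * f (Q.tgt o x) := rfl

theorem wt_none_pos (x : X) : 0 < Q.wt none x := by
  have := Q.sum_rate_lt x
  simp only [wt, Option.elim, ← Finset.sum_div, sub_pos]
  exact (div_lt_one Q.bound_pos).2 this

theorem wt_nonneg (o : Option ι) (x : X) : 0 ≤ Q.wt o x := by
  cases o with
  | none => exact (Q.wt_none_pos x).le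
  | some a => exact div_nonneg (Q.rate_nonneg a x) Q.bound_pos.le

theorem sum_wt (x : X) : ∑ o, Q.wt o x = 1 := by
  simp [Fintype.sum_option, wt]

theorem trans_eq (f : X → ℝ) (x : X) : Q.trans f x = f x + Q.gen f x / Q.bound := by
  simp only [trans_apply, Fintype.sum_option, wt, tgt, Option.elim, gen, mul_sub,
    Finset.sum_sub_distrib, sub_mul, Finset.sum_mul, one_mul, sub_div, Finset.sum_div]
  have : ∀ a, Q.rate a x / Q.bound * f (Q.step a x) = Q.rate a x * f (Q.step a x) / Q.bound :=
    fun a => by ring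
  have h2 : ∀ a, Q.rate a x / Q.bound * f x = Q.rate a x * f x / Q.bound := fun a => by ring
  simp only [this, h2]; ring

theorem trans_mono {f g : X → ℝ} (h : ∀ x, f x ≤ g x) (x : X) : Q.trans f x ≤ Q.trans g x :=
  Finset.sum_le_sum fun o _ => mul_le_mul_of_nonneg_left (h _) (Q.wt_nonneg o x)

theorem trans_const (c : ℝ) : Q.trans (fun _ => c) = fun _ => c := by
  ext x; rw [trans_apply, ← Finset.sum_mul, Q.sum_wt, one_mul]

theorem trans_pow_mono {f g : X → ℝ} (h : ∀ x, f x ≤ g x) (n : ℕ) (x : X) :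
    (Q.trans ^ n) f x ≤ (Q.trans ^ n) g x := by
  induction n generalizing x with
  | zero => simpa using h x
  | succ n ih => simp only [pow_succ', Module.End.mul_apply]; exact Q.trans_mono ih x

theorem trans_pow_const (c : ℝ) (n : ℕ) : (Q.trans ^ n) (fun _ => c) = fun _ => c := by
  induction n with
  | zero => simp
  | succ n ih => simp only [pow_succ', Module.End.mul_apply, ih, trans_const]

theorem abs_trans_pow_le {f : X → ℝ} {B : ℝ} (h : ∀ x, |f x| ≤ B) (n : ℕ) (x : X) :
    |(Q.trans ^ n) f x| ≤ B := by
  rw [abs_le]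
  constructor
  · have := Q.trans_pow_mono (f := fun _ => -B) (g := f) (fun x => (abs_le.1 (h x)).1) n x
    rwa [trans_pow_const] at this
  · have := Q.trans_pow_mono (g := fun _ => B) (f := f) (fun x => (abs_le.1 (h x)).2) n x
    rwa [trans_pow_const] at this

/-- The transition operator of two independent copies of the uniformized chain. -/
noncomputable def pairAvg (g : X → X → ℝ) (x y : X) : ℝ :=
  ∑ o, ∑ o', Q.wt o x * Q.wt o' y * g (Q.tgt o x) (Q.tgt o' y)

theorem pairAvg_mono {g h : X → X → ℝ} (H : ∀ x y, g x y ≤ h x y) (x y : X) :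
    Q.pairAvg g x y ≤ Q.pairAvg h x y :=
  Finset.sum_le_sum fun o _ => Finset.sum_le_sum fun o' _ =>
    mul_le_mul_of_nonneg_left (H _ _) (mul_nonneg (Q.wt_nonneg o x) (Q.wt_nonneg o' y))

theorem pairAvg_add_fun (f g : X → ℝ) (x y : X) :
    Q.pairAvg (fun x y => f x + g y) x y = Q.trans f x + Q.trans g y := by
  simp only [pairAvg, trans_apply, mul_add, Finset.sum_add_distrib]
  congr 1
  · refine Finset.sum_congr rfl fun o _ => ?_
    simp only [mul_right_comm _ (Q.wt _ y)]
    rw [← Finset.mul_sum, Q.sum_wt, mul_one]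
  · rw [Finset.sum_comm]
    refine Finset.sum_congr rfl fun o _ => ?_
    simp only [mul_assoc]
    rw [← Finset.sum_mul, Q.sum_wt, one_mul]

theorem pairAvg_const (c : ℝ) (x y : X) : Q.pairAvg (fun _ _ => c) x y = c := by
  have := Q.pairAvg_add_fun (fun _ => c) (fun _ => 0) x y
  simpa [trans_const] using this

theorem abs_pairAvg_le (g : X → X → ℝ) (x y : X) :
    |Q.pairAvg g x y| ≤ Q.pairAvg (fun x y => |g x y|) x y := by
  refine (Finset.abs_sum_le_sum_abs _ _).trans (Finset.sum_le_sum fun o _ => ?_)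
  refine (Finset.abs_sum_le_sum_abs _ _).trans (Finset.sum_le_sum fun o' _ => ?_)
  rw [abs_mul, abs_of_nonneg (mul_nonneg (Q.wt_nonneg o x) (Q.wt_nonneg o' y))]

theorem pairAvg_sub (g h : X → X → ℝ) (x y : X) :
    Q.pairAvg (fun x y => g x y - h x y) x y = Q.pairAvg g x y - Q.pairAvg h x y := by
  simp only [pairAvg, mul_sub, Finset.sum_sub_distrib]

theorem pairAvg_const_mul (c : ℝ) (g : X → X → ℝ) (x y : X) :
    Q.pairAvg (fun x y => c * g x y) x y = c * Q.pairAvg g x y := by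
  simp only [pairAvg, Finset.mul_sum]
  exact Finset.sum_congr rfl fun o _ => Finset.sum_congr rfl fun o' _ => by ring

/-- `y` can be reached from `x` in one transition of positive rate. -/
def Leads (x y : X) : Prop := ∃ a, 0 < Q.rate a x ∧ y = Q.step a x

theorem Leads.exists_wt {x y : X} (h : Q.Leads x y) : ∃ o, 0 < Q.wt o x ∧ y = Q.tgt o x := by
  obtain ⟨a, ha, rfl⟩ := h
  exact ⟨some a, div_pos ha Q.bound_pos, rfl⟩

/-- Maximum principle: a subharmonic function of a pair of independent copies that attains its
supremum at `(x, y)` also attains it at every pair reached with positive probability. -/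
theorem eq_of_pairAvg_max {g : X → X → ℝ} {S : ℝ} (hg : ∀ x y, g x y ≤ Q.pairAvg g x y)
    (hS : ∀ x y, g x y ≤ S) {x y : X} (hxy : g x y = S) {o o' : Option ι}
    (ho : 0 < Q.wt o x) (ho' : 0 < Q.wt o' y) : g (Q.tgt o x) (Q.tgt o' y) = S := by
  refine le_antisymm (hS _ _) ?_
  by_contra hlt
  push Not at hlt
  have h1 : Q.pairAvg g x y < Q.pairAvg (fun _ _ => S) x y := by
    unfold pairAvg
    have hw : ∀ o o', 0 ≤ Q.wt o x * Q.wt o' y :=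
      fun o o' => mul_nonneg (Q.wt_nonneg o x) (Q.wt_nonneg o' y)
    refine Finset.sum_lt_sum (fun o _ => Finset.sum_le_sum fun o' _ =>
      mul_le_mul_of_nonneg_left (hS _ _) (hw _ _)) ⟨o, Finset.mem_univ _, ?_⟩
    refine Finset.sum_lt_sum (fun o' _ =>
      mul_le_mul_of_nonneg_left (hS _ _) (hw _ _)) ⟨o', Finset.mem_univ _, ?_⟩
    exact mul_lt_mul_of_pos_left hlt (mul_pos ho ho')
  rw [pairAvg_const] at h1
  exact absurd (hg x y) (by rw [hxy]; exact not_le.2 h1)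

/-- Foster–Lyapunov data: the drift of `V` is at most `c - H`, where `V` and `H` have finite
sublevel sets, and the state `o` can be reached from every state. -/
structure Stable (V H : X → ℝ) (c : ℝ) (o : X) : Prop where
  V_nonneg : ∀ x, 0 ≤ V x
  H_nonneg : ∀ x, 0 ≤ H x
  V_finite : ∀ R, {x | V x ≤ R}.Finite
  H_finite : ∀ R, {x | H x ≤ R}.Finite
  drift : ∀ x, Q.gen V x ≤ c - H x
  reach : ∀ x, Relation.ReflTransGen Q.Leads x o

variable {Q}

theorem Stable.pair_drift {V H : X → ℝ} {c : ℝ} {o : X} (hs : Q.Stable V H c o) :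
    {z : X × X | V z.1 + V z.2 ≤ Q.pairAvg (fun x y => V x + V y) z.1 z.2}.Finite := by
  refine ((hs.H_finite (2 * c)).prod (hs.H_finite (2 * c))).subset ?_
  rintro ⟨x, y⟩ h
  simp only [Set.mem_ofPred_eq, pairAvg_add_fun, trans_eq, Set.mem_prod] at h ⊢
  have h1 : 0 ≤ (Q.gen V x + Q.gen V y) / Q.bound := by rw [add_div]; linarith
  have h2 : 0 ≤ Q.gen V x + Q.gen V y := by
    by_contra hn
    exact absurd h1 (not_le.2 (div_neg_of_neg_of_pos (not_le.1 hn) Q.bound_pos))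
  have := hs.drift x
  have := hs.drift y
  have := hs.H_nonneg x
  have := hs.H_nonneg y
  constructor <;> linarith

/-- A bounded subharmonic function of two independent copies of a stable chain that vanishes at
`(o, o)` vanishes: up to a small multiple of the Lyapunov function it attains its maximum in a
finite set, and the maximum propagates along paths to `(o, o)`. -/
theorem Stable.subharmonic_eq_zero {V H : X → ℝ} {c : ℝ} {o : X} (hs : Q.Stable V H c o)
    {g : X → X → ℝ} {B : ℝ} (g0 : ∀ x y, 0 ≤ g x y) (gB : ∀ x y, g x y ≤ B)
    (hg : ∀ x y, g x y ≤ Q.pairAvg g x y) (hoo : g o o = 0) (x y : X) : g x y = 0 := by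
  set C := {z : X × X | V z.1 + V z.2 ≤ Q.pairAvg (fun x y => V x + V y) z.1 z.2} with hC
  have hCfin : C.Finite := hs.pair_drift
  -- a perturbation of `g` by the Lyapunov function attains its maximum, and only where the latter
  -- does not decrease on average, that is, in the finite set `C`
  have key : ∀ ε : ℝ, 0 < ε → ∃ z ∈ C, ∀ z' : X × X,
      g z'.1 z'.2 - ε * (V z'.1 + V z'.2) ≤ g z.1 z.2 - ε * (V z.1 + V z.2) := by
    intro ε hε
    set F : X × X → ℝ := fun z => g z.1 z.2 - ε * (V z.1 + V z.2) with hF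
    -- outside of this finite set the function is smaller than at `(o, o)`
    set A := {z : X × X | F (o, o) ≤ F z} with hA
    have hAfin : A.Finite := by
      refine ((hs.V_finite ((B - F (o, o)) / ε)).prod
        (hs.V_finite ((B - F (o, o)) / ε))).subset ?_
      rintro ⟨a, b⟩ hab
      simp only [hA, hF, Set.mem_ofPred_eq] at hab
      have := gB a b
      have h1 := hs.V_nonneg a
      have h2 := hs.V_nonneg b
      have h3 : 0 ≤ ε * V a := by positivity
      have h4 : 0 ≤ ε * V b := by positivity
      simp only [Set.mem_prod, Set.mem_ofPred_eq, le_div_iff₀ hε, hF]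
      constructor <;> nlinarith
    obtain ⟨z, hzA, hz⟩ := hAfin.exists_maximalFor F A ⟨(o, o), by simp [hA]⟩
    have hmax : ∀ z', F z' ≤ F z := by
      intro z'
      by_contra hlt
      push Not at hlt
      have hz'A : z' ∈ A := le_trans hzA hlt.le
      exact absurd (hz hz'A hlt.le) (not_le.2 hlt)
    refine ⟨z, ?_, hmax⟩
    have h1 : Q.pairAvg (fun x y => g x y - ε * (V x + V y)) z.1 z.2 ≤ F z := by
      have := Q.pairAvg_mono (g := fun x y => g x y - ε * (V x + V y)) (h := fun _ _ => F z)
        (fun x y => hmax (x, y)) z.1 z.2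
      rwa [pairAvg_const] at this
    rw [pairAvg_sub, pairAvg_const_mul] at h1
    have h2 := hg z.1 z.2
    simp only [hF] at h1
    simp only [hC, Set.mem_ofPred_eq]
    by_contra hlt
    push Not at hlt
    have := mul_lt_mul_of_pos_left hlt hε
    linarith
  have hCne : C.Nonempty := by obtain ⟨z, hz, _⟩ := key 1 one_pos; exact ⟨z, hz⟩
  obtain ⟨z, hzC, hz⟩ := hCfin.exists_maximalFor (fun z => g z.1 z.2) C hCne
  have hzmaxC : ∀ z' ∈ C, g z'.1 z'.2 ≤ g z.1 z.2 := by
    intro z' hz'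
    by_contra hlt
    push Not at hlt
    exact absurd (hz hz' hlt.le) (not_le.2 hlt)
  have hmax : ∀ x y, g x y ≤ g z.1 z.2 := by
    intro x y
    refine le_of_forall_pos_le_add fun η hη => ?_
    obtain ⟨z', hz'C, hz'⟩ := key (η / (V x + V y + 1))
      (div_pos hη (by have := hs.V_nonneg x; have := hs.V_nonneg y; linarith))
    have h1 := hz' (x, y)
    have h2 := hzmaxC z' hz'C
    have hx := hs.V_nonneg x
    have hy := hs.V_nonneg y
    have h3 : 0 ≤ η / (V x + V y + 1) * (V z'.1 + V z'.2) :=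
      mul_nonneg (by positivity) (add_nonneg (hs.V_nonneg _) (hs.V_nonneg _))
    have h4 : η / (V x + V y + 1) * (V x + V y) ≤ η := by
      rw [div_mul_eq_mul_div, div_le_iff₀ (by linarith)]
      nlinarith
    simp only at h1
    linarith
  -- as each copy holds with positive probability, the coordinates can be moved one at a time
  have hprop1 : ∀ a, Relation.ReflTransGen Q.Leads z.1 a → g a z.2 = g z.1 z.2 := by
    intro a ha
    induction ha with
    | refl => rfl
    | tail _ hbc ih =>
      obtain ⟨a, ha, rfl⟩ := hbc.exists_wt
      exact Q.eq_of_pairAvg_max hg hmax ih ha (Q.wt_none_pos _)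
  have hprop2 : ∀ b, Relation.ReflTransGen Q.Leads z.2 b → g o b = g z.1 z.2 := by
    intro a ha
    induction ha with
    | refl => exact hprop1 o (hs.reach z.1)
    | tail _ hbc ih =>
      obtain ⟨a, ha, rfl⟩ := hbc.exists_wt
      exact Q.eq_of_pairAvg_max hg hmax ih (Q.wt_none_pos _) ha
  have hzero : g z.1 z.2 = 0 := by rw [← hprop2 o (hs.reach z.2), hoo]
  exact le_antisymm (hzero ▸ hmax x y) (g0 x y)

/-- A stable chain forgets its initial state: for the transition operator `T`, the limsup of
`|T^n f x - T^n f y|` is subharmonic for two independent copies and vanishes on the diagonal. -/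
theorem Stable.tendsto_trans_sub {V H : X → ℝ} {c : ℝ} {o : X} (hs : Q.Stable V H c o)
    {f : X → ℝ} {B : ℝ} (hf : ∀ x, |f x| ≤ B) (x y : X) :
    Tendsto (fun n => (Q.trans ^ n) f x - (Q.trans ^ n) f y) atTop (𝓝 0) := by
  set u : ℕ → X → X → ℝ := fun n x y => |(Q.trans ^ n) f x - (Q.trans ^ n) f y| with hu
  have u0 : ∀ n x y, 0 ≤ u n x y := fun n x y => abs_nonneg _
  have uB : ∀ n x y, u n x y ≤ 2 * B := by
    intro n x y
    have h1 := Q.abs_trans_pow_le hf n x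
    have h2 := Q.abs_trans_pow_le hf n y
    have := abs_sub ((Q.trans ^ n) f x) ((Q.trans ^ n) f y)
    simp only [hu]; linarith
  have ustep : ∀ n x y, u (n + 1) x y ≤ Q.pairAvg (u n) x y := by
    intro n x y
    refine le_trans (le_of_eq ?_) (Q.abs_pairAvg_le _ x y)
    simp only [hu]
    congr 1
    have := Q.pairAvg_add_fun ((Q.trans ^ n) f) (fun z => -(Q.trans ^ n) f z) x y
    simp only [← sub_eq_add_neg] at this
    rw [this, pow_succ', Module.End.mul_apply]
    have h2 : (fun z => -(Q.trans ^ n) f z) = -((Q.trans ^ n) f) := rfl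
    rw [h2, map_neg, Pi.neg_apply, sub_eq_add_neg]
  set S : ℕ → X → X → ℝ := fun n x y => ⨆ k, u (n + k) x y with hS
  have hbdd : ∀ n x y, BddAbove (Set.range fun k => u (n + k) x y) := fun n x y =>
    ⟨2 * B, by rintro _ ⟨k, rfl⟩; exact uB _ _ _⟩
  have uS : ∀ n k x y, n ≤ k → u k x y ≤ S n x y := by
    intro n k x y h
    obtain ⟨j, rfl⟩ := Nat.exists_eq_add_of_le h
    exact le_ciSup (hbdd n x y) j
  have SB : ∀ n x y, S n x y ≤ 2 * B := fun n x y => ciSup_le fun k => uB _ _ _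
  have S0 : ∀ n x y, 0 ≤ S n x y := fun n x y => (u0 n x y).trans (uS n n x y le_rfl)
  have Santi : ∀ x y, Antitone fun n => S n x y := by
    intro x y n m hnm
    exact ciSup_le fun k => uS _ _ _ _ (by omega)
  have Sstep : ∀ n x y, S (n + 1) x y ≤ Q.pairAvg (S n) x y := by
    intro n x y
    refine ciSup_le fun k => ?_
    have : n + 1 + k = (n + k) + 1 := by ring
    rw [this]
    exact (ustep _ x y).trans (Q.pairAvg_mono (fun x y => uS _ _ _ _ (by omega)) x y)
  have Slim : ∀ x y, Tendsto (fun n => S n x y) atTop (𝓝 (⨅ n, S n x y)) := fun x y =>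
    tendsto_atTop_ciInf (Santi x y) ⟨0, by rintro _ ⟨k, rfl⟩; exact S0 _ _ _⟩
  have hzero : ∀ x y, (⨅ n, S n x y) = 0 := by
    refine hs.subharmonic_eq_zero (B := 2 * B) ?_ ?_ ?_ ?_
    · exact fun x y => le_ciInf fun n => S0 n x y
    · exact fun x y => (ciInf_le ⟨0, by rintro _ ⟨k, rfl⟩; exact S0 _ _ _⟩ 0).trans (SB 0 x y)
    · intro x y
      refine le_of_tendsto_of_tendsto ((Slim x y).comp (tendsto_add_atTop_nat 1)) ?_
        (Eventually.of_forall fun n => Sstep n x y)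
      exact tendsto_finsetSum _ fun o _ => tendsto_finsetSum _ fun o' _ =>
        (Slim _ _).const_mul _
    · simp [hS, hu]
  have h0 := Slim x y
  rw [hzero] at h0
  rw [tendsto_zero_iff_abs_tendsto_zero]
  exact squeeze_zero (fun n => u0 n x y) (fun n => uS n n x y le_rfl) h0

end JumpChain

namespace JumpChain
variable {X ι : Type*} [Fintype ι] {Q : JumpChain X ι}

/-! ### Time averages of jump chains -/

/-- The expected time average of `f` over the first `n` steps of the chain started at `o`. -/
noncomputable def cesaro (Q : JumpChain X ι) (o : X) (n : ℕ) : (X → ℝ) →ₗ[ℝ] ℝ :=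
  (n : ℝ)⁻¹ • ∑ k ∈ Finset.range n, (LinearMap.proj o : (X → ℝ) →ₗ[ℝ] ℝ) ∘ₗ (Q.trans ^ k)

theorem cesaro_apply (o : X) (n : ℕ) (f : X → ℝ) :
    Q.cesaro o n f = (n : ℝ)⁻¹ * ∑ k ∈ Finset.range n, (Q.trans ^ k) f o := by
  simp [cesaro, LinearMap.sum_apply]

theorem cesaro_mono {f g : X → ℝ} (h : ∀ x, f x ≤ g x) (o : X) (n : ℕ) :
    Q.cesaro o n f ≤ Q.cesaro o n g := by
  rw [cesaro_apply, cesaro_apply]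
  exact mul_le_mul_of_nonneg_left
    (Finset.sum_le_sum fun k _ => Q.trans_pow_mono h k o) (by positivity)

theorem cesaro_const (o : X) {n : ℕ} (hn : 1 ≤ n) (c : ℝ) : Q.cesaro o n (fun _ => c) = c := by
  have : (n : ℝ) ≠ 0 := by positivity
  rw [cesaro_apply]; simp only [trans_pow_const, Finset.sum_const, Finset.card_range, nsmul_eq_mul]
  field_simp

theorem abs_cesaro_le {f g : X → ℝ} (h : ∀ x, |f x| ≤ g x) (o : X) (n : ℕ) :
    |Q.cesaro o n f| ≤ Q.cesaro o n g := by
  rw [abs_le]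
  refine ⟨?_, cesaro_mono (fun x => (abs_le.1 (h x)).2) o n⟩
  have := cesaro_mono (Q := Q) (f := -g) (g := f) (fun x => (abs_le.1 (h x)).1) o n
  rwa [map_neg] at this

theorem abs_gen_le {f : X → ℝ} {B : ℝ} (hB : ∀ x, |f x| ≤ B) (x : X) :
    |Q.gen f x| ≤ Q.bound * (2 * B) := by
  have hB0 : 0 ≤ B := (abs_nonneg _).trans (hB x)
  refine (Finset.abs_sum_le_sum_abs _ _).trans ?_
  refine le_trans (b := ∑ a, Q.rate a x * (2 * B)) (Finset.sum_le_sum fun b _ => ?_) ?_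
  · rw [abs_mul, abs_of_nonneg (Q.rate_nonneg b x)]
    refine mul_le_mul_of_nonneg_left ?_ (Q.rate_nonneg b x)
    have := abs_sub (f (Q.step b x)) (f x)
    have := hB x
    have := hB (Q.step b x)
    linarith
  · rw [← Finset.sum_mul]
    exact mul_le_mul_of_nonneg_right (Q.sum_rate_lt x).le (by positivity)

/-- Time averages are asymptotically invariant. -/
theorem tendsto_cesaro_gen (o : X) {f : X → ℝ} {B : ℝ} (hf : ∀ x, |f x| ≤ B) :
    Tendsto (fun n => Q.cesaro o n (Q.gen f)) atTop (𝓝 0) := by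
  have hgen : Q.gen f = Q.bound • (Q.trans f - f) := by
    ext x
    simp only [Pi.smul_apply, Pi.sub_apply, trans_eq, smul_eq_mul]
    have := Q.bound_pos.ne'
    field_simp; ring
  have h1 : ∀ n, Q.cesaro o n (Q.gen f) = Q.bound * ((n : ℝ)⁻¹ * ((Q.trans ^ n) f o - f o)) := by
    intro n
    rw [hgen, map_smul, smul_eq_mul, cesaro_apply]
    congr 2
    have : ∀ k, (Q.trans ^ k) (Q.trans f - f) o = (Q.trans ^ (k + 1)) f o - (Q.trans ^ k) f o := by
      intro k; rw [map_sub, pow_succ]; rfl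
    simp only [this]
    rw [Finset.sum_range_sub (fun k => (Q.trans ^ k) f o)]
    simp
  simp only [h1]
  rw [← mul_zero Q.bound]
  refine Tendsto.const_mul _ ?_
  refine squeeze_zero_norm (a := fun n : ℕ => (n : ℝ)⁻¹ * (2 * B)) (fun n => ?_) ?_
  · rw [norm_mul, Real.norm_of_nonneg (by positivity), Real.norm_eq_abs]
    refine mul_le_mul_of_nonneg_left ?_ (by positivity)
    have h1 := Q.abs_trans_pow_le hf n o
    have h2 := hf o
    have := abs_sub ((Q.trans ^ n) f o) (f o)
    linarith
  · simpa using (tendsto_inv_atTop_nhds_zero_nat (𝕜 := ℝ)).mul_const (2 * B)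

theorem Stable.cesaro_le {V H : X → ℝ} {c : ℝ} {o : X} (hs : Q.Stable V H c o) {n : ℕ}
    (hn : 1 ≤ n) : Q.cesaro o n H ≤ c + Q.bound * V o := by
  have hstep : ∀ k, (Q.trans ^ k) H o ≤
      c + Q.bound * ((Q.trans ^ k) V o - (Q.trans ^ (k + 1)) V o) := by
    intro k
    have h1 : ∀ x, H x ≤ ((fun _ => c) + Q.bound • (V - Q.trans V) : X → ℝ) x := by
      intro x
      have := hs.drift x
      have h2 := Q.bound_pos.ne'
      simp only [Pi.add_apply, Pi.smul_apply, Pi.sub_apply, trans_eq, smul_eq_mul]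
      have : Q.bound * (V x - (V x + Q.gen V x / Q.bound)) = - Q.gen V x := by field_simp; ring
      linarith
    have := Q.trans_pow_mono h1 k o
    rw [map_add, map_smul, map_sub, trans_pow_const] at this
    rw [pow_succ]
    exact this
  have hVn : 0 ≤ (Q.trans ^ n) V o := by
    have := Q.trans_pow_mono hs.V_nonneg n o
    rwa [trans_pow_const] at this
  have hsum : ∑ k ∈ Finset.range n, (Q.trans ^ k) H o ≤ n * c + Q.bound * V o := by
    refine (Finset.sum_le_sum fun k _ => hstep k).trans ?_
    rw [Finset.sum_add_distrib, ← Finset.mul_sum,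
      Finset.sum_range_sub' (fun k => (Q.trans ^ k) V o)]
    have := mul_nonneg Q.bound_pos.le hVn
    simp [mul_sub, this]
  rw [cesaro_apply, inv_mul_le_iff₀ (by positivity)]
  have h1 : (1 : ℝ) ≤ n := by exact_mod_cast hn
  have h2 : 0 ≤ Q.bound * V o := mul_nonneg Q.bound_pos.le (hs.V_nonneg o)
  nlinarith

/-! ### Poisson systems of differential equations -/

/-- Comparison principle for `f' = Λ (b - f) + b'`. -/
theorem sub_le_exp_mul_of_deriv_le {Λ T : ℝ} (hT : 0 ≤ T) {f f' b b' : ℝ → ℝ}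
    (hf : ∀ t, T ≤ t → HasDerivWithinAt f (f' t) (Set.Ici 0) t)
    (hb : ∀ t, T ≤ t → HasDerivAt b (b' t) t)
    (h : ∀ t, T ≤ t → f' t ≤ Λ * (b t - f t) + b' t) {t : ℝ} (ht : T ≤ t) :
    f t - b t ≤ Real.exp (-(Λ * (t - T))) * (f T - b T) := by
  have hd : ∀ s, T ≤ s → HasDerivWithinAt (fun s => Real.exp (Λ * s) * (f s - b s))
      (Real.exp (Λ * s) * Λ * (f s - b s) + Real.exp (Λ * s) * (f' s - b' s)) (Set.Ici T) s := by
    intro s hs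
    have he : HasDerivAt (fun s => Real.exp (Λ * s)) (Real.exp (Λ * s) * Λ) s := by
      simpa using ((hasDerivAt_id s).const_mul Λ).exp
    exact he.hasDerivWithinAt.mul
      (((hf s hs).mono (Set.Ici_subset_Ici.2 hT)).sub (hb s hs).hasDerivWithinAt)
  have hanti : AntitoneOn (fun s => Real.exp (Λ * s) * (f s - b s)) (Set.Ici T) := by
    refine antitoneOn_of_hasDerivWithinAt_nonpos (convex_Ici T)
      (fun s hs => (hd s hs).continuousWithinAt)
      (fun s hs => (hd s (interior_subset hs)).mono interior_subset) fun s hs => ?_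
    have := h s (interior_subset hs)
    have he := Real.exp_pos (Λ * s)
    nlinarith
  have h1 := hanti (Set.mem_Ici.2 le_rfl) (Set.mem_Ici.2 ht) ht
  simp only at h1
  have h2 : Real.exp (-(Λ * (t - T))) = Real.exp (-(Λ * t)) * Real.exp (Λ * T) := by
    rw [← Real.exp_add]; ring_nf
  have h3 : f t - b t = Real.exp (-(Λ * t)) * (Real.exp (Λ * t) * (f t - b t)) := by
    rw [← mul_assoc, ← Real.exp_add]; simp
  rw [h2, h3, mul_assoc]
  exact mul_le_mul_of_nonneg_left h1 (Real.exp_pos _).le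

/-- Bounded solutions of `e_n' = Λ (e_{n+1} - e_n)` inherit an initial bound that holds from some
index on: iterating the comparison principle `j` times bounds the excess by
`|B| * (Λ t) ^ j / j!`. -/
theorem le_of_poisson_system {Λ B δ : ℝ} (hΛ : 0 < Λ) (hδ : 0 ≤ δ) {e : ℕ → ℝ → ℝ} {n : ℕ}
    (hB : ∀ k t, 0 ≤ t → e k t ≤ B)
    (hd : ∀ k t, 0 ≤ t → HasDerivWithinAt (e k) (Λ * (e (k + 1) t - e k t)) (Set.Ici 0) t)
    (h0 : ∀ k, n ≤ k → e k 0 ≤ δ) {k : ℕ} (hk : n ≤ k) {t : ℝ} (ht : 0 ≤ t) : e k t ≤ δ := by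
  have key : ∀ j k, n ≤ k → ∀ t, 0 ≤ t → e k t ≤ δ + |B| * ((Λ * t) ^ j / j.factorial) := by
    intro j
    induction j with
    | zero =>
      intro k _ t ht
      have := hB k t ht
      have := le_abs_self B
      simp; linarith
    | succ j ih =>
      intro k hk t ht
      have hb : ∀ s : ℝ, HasDerivAt (fun s => δ + |B| * ((Λ * s) ^ (j + 1) / (j + 1).factorial))
          (|B| * (Λ * ((Λ * s) ^ j / j.factorial))) s := by
        intro s
        have h1 : HasDerivAt (fun s : ℝ => (Λ * s) ^ (j + 1)) (((j + 1 : ℕ) : ℝ) * (Λ * s) ^ j * Λ)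
            s := by
          simpa using ((hasDerivAt_id s).const_mul Λ).fun_pow (j + 1)
        refine (((h1.div_const ((j + 1).factorial : ℝ)).const_mul |B|).const_add δ).congr_deriv ?_
        rw [Nat.factorial_succ]
        push_cast
        have : (j.factorial : ℝ) ≠ 0 := by positivity
        field_simp
      have h1 := sub_le_exp_mul_of_deriv_le (Λ := Λ) le_rfl (fun s hs => hd k s hs)
        (fun s _ => hb s) (fun s hs => ?_) ht
      · have h2 : e k 0 - (δ + |B| * ((Λ * 0) ^ (j + 1) / (j + 1).factorial)) ≤ 0 := by
          have := h0 k hk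
          simp; linarith
        have := mul_nonpos_of_nonneg_of_nonpos (Real.exp_pos (-(Λ * (t - 0)))).le h2
        linarith
      · have h2 := ih (k + 1) (by omega) s hs
        have h3 : 0 ≤ |B| * ((Λ * s) ^ (j + 1) / (j + 1).factorial) := by positivity
        have h4 := mul_nonneg hΛ.le h3
        have h5 := mul_le_mul_of_nonneg_left h2 hΛ.le
        nlinarith
  refine le_of_forall_pos_le_add fun η hη => ?_
  have h1 : Tendsto (fun j : ℕ => δ + |B| * ((Λ * t) ^ j / j.factorial)) atTop
      (𝓝 (δ + |B| * 0)) :=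
    ((FloorSemiring.tendsto_pow_div_factorial_atTop (Λ * t)).const_mul _).const_add _
  have h2 := ge_of_tendsto' h1 fun j => key j k hk t ht
  linarith

/-- Bounded solutions of `e_n' = Λ (e_{n+1} - e_n)` vanish for large times when the initial
values vanish at infinity: the bound by `δ / 2` holds for large indices at all times, and it is
propagated to smaller indices, at the cost of waiting. -/
theorem tendsto_poisson_system {Λ B : ℝ} (hΛ : 0 < Λ) {e : ℕ → ℝ → ℝ}
    (hB : ∀ k t, 0 ≤ t → |e k t| ≤ B)
    (hd : ∀ k t, 0 ≤ t → HasDerivWithinAt (e k) (Λ * (e (k + 1) t - e k t)) (Set.Ici 0) t)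
    (h0 : Tendsto (fun k => e k 0) atTop (𝓝 0)) : Tendsto (e 0) atTop (𝓝 0) := by
  have upper : ∀ e : ℕ → ℝ → ℝ, (∀ k t, 0 ≤ t → |e k t| ≤ B) →
      (∀ k t, 0 ≤ t → HasDerivWithinAt (e k) (Λ * (e (k + 1) t - e k t)) (Set.Ici 0) t) →
      Tendsto (fun k => e k 0) atTop (𝓝 0) → ∀ δ, 0 < δ → ∀ᶠ t in atTop, e 0 t < δ := by
    intro e hB hd h0 δ hδ
    obtain ⟨n, hn⟩ := eventually_atTop.1 (h0.eventually_lt_const (half_pos hδ))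
    have hlarge : ∀ t, 0 ≤ t → e n t ≤ δ / 2 := fun t ht =>
      le_of_poisson_system hΛ (half_pos hδ).le (fun k t ht => (abs_le.1 (hB k t ht)).2) hd
        (fun k hk => (hn k hk).le) le_rfl ht
    have hback : ∀ j, j ≤ n → ∀ δ', δ / 2 < δ' → ∀ᶠ t in atTop, e (n - j) t < δ' := by
      intro j
      induction j with
      | zero =>
        intro _ δ' hδ'
        filter_upwards [eventually_ge_atTop 0] with t ht
        exact (hlarge t ht).trans_lt hδ'
      | succ j ih =>
        intro hj δ' hδ'
        obtain ⟨η, hη1, hη2⟩ := exists_between hδ'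
        obtain ⟨T, hT⟩ := eventually_atTop.1 (ih (by omega) η hη1)
        set T' := max T 0
        have hs : n - j = n - (j + 1) + 1 := by omega
        have hcmp : ∀ t, T' ≤ t → e (n - (j + 1)) t - η ≤
            Real.exp (-(Λ * (t - T'))) * (e (n - (j + 1)) T' - η) := by
          intro t ht
          refine sub_le_exp_mul_of_deriv_le (b := fun _ => η) (b' := fun _ => 0)
            (le_max_right T 0) (fun s hs => hd _ s ((le_max_right T 0).trans hs))
            (fun s _ => hasDerivAt_const s η) (fun s hs' => ?_) ht
          have := (hT s ((le_max_left T 0).trans hs')).le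
          rw [hs] at this
          have := mul_le_mul_of_nonneg_left this hΛ.le
          simp only [mul_sub, add_zero]; linarith
        have hlim : Tendsto (fun t => Real.exp (-(Λ * (t - T'))) * (e (n - (j + 1)) T' - η)) atTop
            (𝓝 (0 * (e (n - (j + 1)) T' - η))) := by
          refine Tendsto.mul_const _ (Real.tendsto_exp_neg_atTop_nhds_zero.comp ?_)
          exact Tendsto.const_mul_atTop hΛ (tendsto_atTop_add_const_right _ _ tendsto_id)
        rw [zero_mul] at hlim
        filter_upwards [hlim.eventually_lt_const (sub_pos.2 hη2), eventually_ge_atTop T']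
          with t h1 h2
        have := hcmp t h2
        linarith
    have := hback n le_rfl δ (by linarith)
    simpa using this
  rw [Metric.tendsto_nhds]
  intro δ hδ
  have hneg := upper (fun k t => -e k t) (fun k t ht => by simpa using hB k t ht)
    (fun k t ht => (hd k t ht).fun_neg.congr_deriv (by ring)) (by simpa using h0.neg) δ hδ
  filter_upwards [upper e hB hd h0 δ hδ, hneg] with t h1 h2
  rw [Real.dist_eq, sub_zero, abs_lt]
  constructor <;> linarith

variable [Countable X] [MeasurableSpace X] [MeasurableSingletonClass X]

/-! ### Stationary laws of stable jump chains -/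

/-- A stationary law of a stable chain is obtained as a limit of time averages along an
ultrafilter; the Lyapunov function prevents mass from escaping. -/
theorem Stable.exists_stationary {V H : X → ℝ} {c : ℝ} {o : X} (hs : Q.Stable V H c o) :
    ∃ π : ProbabilityMeasure X, ∀ f : X → ℝ, (∃ B, ∀ x, |f x| ≤ B) →
      ∫ x, Q.gen f x ∂(π : Measure X) = 0 := by
  classical
  have hle : (hyperfilter ℕ : Filter ℕ) ≤ atTop := by
    rw [← Nat.cofinite_eq_atTop]; exact hyperfilter_le_cofinite
  have hev : ∀ᶠ n in (hyperfilter ℕ : Filter ℕ), 1 ≤ n := hle (eventually_ge_atTop 1)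
  have hlim : ∀ f : X → ℝ, ∃ L : ℝ, (∃ B, ∀ x, |f x| ≤ B) →
      Tendsto (fun n => Q.cesaro o n f) (hyperfilter ℕ) (𝓝 L) := by
    intro f
    by_cases hf : ∃ B, ∀ x, |f x| ≤ B
    · obtain ⟨B, hB⟩ := hf
      have hmem : ∀ᶠ n in (hyperfilter ℕ : Filter ℕ), Q.cesaro o n f ∈ Set.Icc (-B) B := by
        filter_upwards [hev] with n hn
        have := abs_cesaro_le (Q := Q) (g := fun _ => B) hB o n
        rw [cesaro_const o hn] at this
        exact abs_le.1 this
      obtain ⟨L, _, hL⟩ := (isCompact_Icc (a := -B) (b := B)).ultrafilter_le_nhds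
        ((hyperfilter ℕ).map fun n => Q.cesaro o n f) (le_principal_iff.2 hmem)
      exact ⟨L, fun _ => hL⟩
    · exact ⟨0, fun h => absurd h hf⟩
  choose ℓ hℓ using hlim
  have hbs : ∀ x : X, ∃ B, ∀ y, |(Pi.single x (1 : ℝ) : X → ℝ) y| ≤ B := by
    intro x
    refine ⟨1, fun y => ?_⟩
    by_cases h : y = x
    · subst h; simp
    · simp [h]
  set a : X → ℝ := fun x => ℓ (Pi.single x 1) with ha
  have ha0 : ∀ x, 0 ≤ a x := by
    intro x
    refine ge_of_tendsto' (hℓ _ (hbs x)) fun n => ?_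
    have := cesaro_mono (Q := Q) (f := 0) (g := Pi.single x 1) (fun y => ?_) o n
    · rwa [map_zero] at this
    · by_cases h : y = x
      · subst h; simp
      · simp [h]
  set K := c + Q.bound * V o with hK
  have hK0 : 0 ≤ K := le_trans
    (by have := cesaro_mono (Q := Q) (f := 0) (g := H) hs.H_nonneg o 1; rwa [map_zero] at this)
    (hs.cesaro_le le_rfl)
  -- outside of a finite set `s` that contains `{H ≤ R}` the time averages have mass at most `K / R`
  have happrox : ∀ (f : X → ℝ) (B : ℝ), 0 ≤ B → (∀ x, |f x| ≤ B) → ∀ R : ℝ, 0 < R →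
      ∀ s : Finset X, (∀ x, H x ≤ R → x ∈ s) → |ℓ f - ∑ x ∈ s, a x * f x| ≤ B / R * K := by
    intro f B hB0 hB R hR s hsR
    have ht : Tendsto (fun n => |Q.cesaro o n f - ∑ x ∈ s, Q.cesaro o n (Pi.single x 1) * f x|)
        (hyperfilter ℕ) (𝓝 |ℓ f - ∑ x ∈ s, a x * f x|) :=
      ((hℓ f ⟨B, hB⟩).sub (tendsto_finsetSum _ fun x _ => (hℓ _ (hbs x)).mul_const _)).abs
    refine le_of_tendsto ht ?_
    filter_upwards [hev] with n hn
    have h1 : Q.cesaro o n f - ∑ x ∈ s, Q.cesaro o n (Pi.single x 1) * f x =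
        Q.cesaro o n (f - ∑ x ∈ s, f x • Pi.single x (1 : ℝ)) := by
      rw [map_sub, map_sum]
      simp only [map_smul, smul_eq_mul, mul_comm]
    rw [h1]
    refine (abs_cesaro_le (g := (B / R) • H) (fun y => ?_) o n).trans ?_
    · have h2 : (∑ x ∈ s, f x • Pi.single x (1 : ℝ) : X → ℝ) y = if y ∈ s then f y else 0 := by
        simp [Finset.sum_apply, Pi.single_apply]
      rw [Pi.sub_apply, h2, Pi.smul_apply, smul_eq_mul]
      split_ifs with hy
      · simpa using mul_nonneg (div_nonneg hB0 hR.le) (hs.H_nonneg y)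
      · have h3 : R < H y := by
          by_contra h; exact hy (hsR y (not_lt.1 h))
        rw [sub_zero, div_mul_eq_mul_div]
        refine (hB y).trans ?_
        rw [le_div_iff₀ hR]
        nlinarith
    · rw [map_smul, smul_eq_mul]
      exact mul_le_mul_of_nonneg_left (hs.cesaro_le hn) (div_nonneg hB0 hR.le)
  have hsum : ∀ f : X → ℝ, (∃ B, ∀ x, |f x| ≤ B) → HasSum (fun x => a x * f x) (ℓ f) := by
    rintro f ⟨B, hB⟩
    have hB0 : 0 ≤ B := (abs_nonneg _).trans (hB o)
    rw [HasSum, SummationFilter.unconditional_filter, Metric.tendsto_atTop]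
    intro ε hε
    set R := 2 * (B + 1) * (K + 1) / ε with hR
    have hR0 : 0 < R := by positivity
    refine ⟨(hs.H_finite R).toFinset, fun s hsub => ?_⟩
    rw [dist_comm, Real.dist_eq]
    refine (happrox f B hB0 hB R hR0 s fun x hx => hsub (by simpa using hx)).trans_lt ?_
    rw [div_mul_eq_mul_div, div_lt_iff₀ hR0, hR]
    field_simp
    nlinarith
  have hone : ℓ (fun _ => 1) = 1 := by
    refine tendsto_nhds_unique (hℓ (fun _ => 1) ⟨1, by simp⟩) ?_
    refine tendsto_const_nhds.congr' ?_
    filter_upwards [hev] with n hn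
    rw [cesaro_const o hn]
  have hpmf : HasSum (fun x => ENNReal.ofReal (a x)) 1 := by
    have h1 := hsum (fun _ => 1) ⟨1, by simp⟩
    simp only [mul_one, hone] at h1
    rw [← ENNReal.ofReal_one, ← h1.tsum_eq, ENNReal.ofReal_tsum_of_nonneg ha0 h1.summable]
    exact ENNReal.summable.hasSum
  set P : PMF X := ⟨fun x => ENNReal.ofReal (a x), hpmf⟩ with hP
  refine ⟨⟨P.toMeasure, inferInstance⟩, fun f hf => ?_⟩
  obtain ⟨B, hB⟩ := hf
  have hgb : ∃ B', ∀ x, |Q.gen f x| ≤ B' := ⟨_, abs_gen_le hB⟩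
  have hint : Integrable (Q.gen f) P.toMeasure := by
    obtain ⟨B', hB'⟩ := hgb
    exact Integrable.of_bound (measurable_of_countable _).aestronglyMeasurable B'
      (Eventually.of_forall hB')
  change ∫ x, Q.gen f x ∂P.toMeasure = 0
  rw [PMF.integral_eq_tsum _ _ hint]
  have h1 : ∀ x, (P x).toReal • Q.gen f x = a x * Q.gen f x := by
    intro x
    rw [smul_eq_mul]
    congr 1
    exact ENNReal.toReal_ofReal (ha0 x)
  simp only [h1]
  rw [(hsum _ hgb).tsum_eq]
  exact tendsto_nhds_unique (hℓ _ hgb) ((tendsto_cesaro_gen o hB).mono_left hle)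

theorem integrable_of_abs_le {X : Type*} [Countable X] [MeasurableSpace X]
    [MeasurableSingletonClass X] {μ : Measure X} [IsFiniteMeasure μ] {f : X → ℝ} {B : ℝ}
    (hB : ∀ x, |f x| ≤ B) : Integrable f μ :=
  Integrable.of_bound (measurable_of_countable _).aestronglyMeasurable B (Eventually.of_forall hB)

/-- The laws of a stable chain converge to its stationary law, in the sense of integrals of
bounded functions. By the forward equation the integrals of `T ^ n f` under the law at time `t`
form a Poisson system. -/
theorem Stable.tendsto_integral {V H : X → ℝ} {c : ℝ} {o : X} (hs : Q.Stable V H c o)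
    {μ : ℝ → ProbabilityMeasure X} (hμ : ∀ f : X → ℝ, (∃ B, ∀ x, |f x| ≤ B) → ∀ t, 0 ≤ t →
      HasDerivWithinAt (fun s => ∫ x, f x ∂(μ s : Measure X))
        (∫ x, Q.gen f x ∂(μ t : Measure X)) (Set.Ici 0) t)
    {π : ProbabilityMeasure X} (hπ : ∀ f : X → ℝ, (∃ B, ∀ x, |f x| ≤ B) →
      ∫ x, Q.gen f x ∂(π : Measure X) = 0) {f : X → ℝ} {B : ℝ} (hf : ∀ x, |f x| ≤ B) :
    Tendsto (fun t => ∫ x, f x ∂(μ t : Measure X)) atTop (𝓝 (∫ x, f x ∂(π : Measure X))) := by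
  have hpow : ∀ n x, |(Q.trans ^ n) f x| ≤ B := fun n x => Q.abs_trans_pow_le hf n x
  have hint : ∀ (ν : ProbabilityMeasure X) n, Integrable ((Q.trans ^ n) f) (ν : Measure X) :=
    fun ν n => integrable_of_abs_le (hpow n)
  have hgen : ∀ n x, Q.gen ((Q.trans ^ n) f) x =
      Q.bound * ((Q.trans ^ (n + 1)) f x - (Q.trans ^ n) f x) := by
    intro n x
    rw [pow_succ', Module.End.mul_apply, trans_eq]
    have := Q.bound_pos.ne'
    field_simp; ring
  have hgenint : ∀ (ν : ProbabilityMeasure X) n, ∫ x, Q.gen ((Q.trans ^ n) f) x ∂(ν : Measure X) =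
      Q.bound * (∫ x, (Q.trans ^ (n + 1)) f x ∂(ν : Measure X) -
        ∫ x, (Q.trans ^ n) f x ∂(ν : Measure X)) := by
    intro ν n
    simp only [hgen]
    rw [integral_const_mul, integral_sub (hint ν _) (hint ν _)]
  have hπn : ∀ n, ∫ x, (Q.trans ^ n) f x ∂(π : Measure X) = ∫ x, f x ∂(π : Measure X) := by
    intro n
    induction n with
    | zero => simp
    | succ n ih =>
      have h1 := hπ _ ⟨B, hpow n⟩
      rw [hgenint, mul_eq_zero, or_iff_right Q.bound_pos.ne'] at h1
      linarith
  have hlim : ∀ ν : ProbabilityMeasure X,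
      Tendsto (fun n => ∫ x, ((Q.trans ^ n) f x - (Q.trans ^ n) f o) ∂(ν : Measure X)) atTop
        (𝓝 (∫ _, 0 ∂(ν : Measure X))) := by
    intro ν
    refine tendsto_integral_of_dominated_convergence (fun _ => 2 * B)
      (fun n => (measurable_of_countable _).aestronglyMeasurable) (integrable_const _)
      (fun n => Eventually.of_forall fun x => ?_)
      (Eventually.of_forall fun x => hs.tendsto_trans_sub hf x o)
    have := abs_sub ((Q.trans ^ n) f x) ((Q.trans ^ n) f o)
    have := hpow n x
    have := hpow n o
    rw [Real.norm_eq_abs]; linarith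
  have hcent : ∀ (ν : ProbabilityMeasure X) n,
      ∫ x, ((Q.trans ^ n) f x - (Q.trans ^ n) f o) ∂(ν : Measure X) =
        ∫ x, (Q.trans ^ n) f x ∂(ν : Measure X) - (Q.trans ^ n) f o := by
    intro ν n
    rw [integral_sub (hint ν n) (integrable_const _)]; simp
  have hmain := tendsto_poisson_system (B := 2 * B) Q.bound_pos
    (e := fun k t => ∫ x, (Q.trans ^ k) f x ∂(μ t : Measure X) - ∫ x, f x ∂(π : Measure X))
    (fun k t _ => ?_) (fun k t ht => ?_) ?_
  · have := hmain.add_const (∫ x, f x ∂(π : Measure X))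
    simpa using this
  · have hb : ∀ (ν : ProbabilityMeasure X) (g : X → ℝ), (∀ x, |g x| ≤ B) →
        |∫ x, g x ∂(ν : Measure X)| ≤ B := by
      intro ν g hg
      have := norm_integral_le_of_norm_le_const (μ := (ν : Measure X)) (f := g) (C := B)
        (Eventually.of_forall hg)
      simpa using this
    have h1 := hb (μ t) _ (hpow k)
    have h2 := hb π f hf
    have := abs_sub (∫ x, (Q.trans ^ k) f x ∂(μ t : Measure X)) (∫ x, f x ∂(π : Measure X))
    linarith
  · have h1 := (hμ ((Q.trans ^ k) f) ⟨B, hpow k⟩ t ht).sub_const (∫ x, f x ∂(π : Measure X))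
    rw [hgenint] at h1
    simpa using h1
  · have h1 := (hlim (μ 0)).sub (hlim π)
    simp only [hcent, hπn, integral_zero, sub_zero] at h1
    refine h1.congr fun n => ?_
    ring

end JumpChain

namespace JSQ
namespace System

/-! ### The assignment probabilities -/

variable {K M N : ℕ} (G : System K M N)

theorem assignProb_nonneg (d : ℕ) (x : Fin N → ℕ) (i : Fin G.numDisp) (j : Fin N) :
    0 ≤ G.assignProb d x i j := by
  unfold assignProb
  split_ifs
  · exact Finset.sum_nonneg fun S _ => by split_ifs <;> positivity
  · positivity
  · exact le_rfl

theorem shortest_nonempty {x : Fin N → ℕ} {S : Finset (Fin N)} (hS : S.Nonempty) :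
    (shortest x S).Nonempty := by
  obtain ⟨j, hj, h⟩ := S.exists_min_image x hS
  exact ⟨j, Finset.mem_filter.2 ⟨hj, h⟩⟩

/-- A task joins a server with at least `l` tasks exactly when all the sampled servers have at
least `l` tasks. -/
theorem sum_assignProb_filter_le {d : ℕ} (hd : 1 ≤ d) (x : Fin N → ℕ) {i : Fin G.numDisp}
    (hi : d ≤ G.deg i) (l : ℕ) :
    ∑ j with l ≤ x j, G.assignProb d x i j =
      (((G.nbr i).filter (fun j => l ≤ x j)).card.choose d : ℝ) / ((G.deg i).choose d : ℝ) := by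
  classical
  have h1 : ∀ S ∈ (G.nbr i).powersetCard d,
      (∑ j with l ≤ x j, if j ∈ shortest x S then
        ((G.deg i).choose d : ℝ)⁻¹ * ((shortest x S).card : ℝ)⁻¹ else 0) =
      if S ⊆ (G.nbr i).filter (fun j => l ≤ x j) then ((G.deg i).choose d : ℝ)⁻¹ else 0 := by
    intro S hS
    rw [Finset.mem_powersetCard] at hS
    have hne : S.Nonempty := Finset.card_pos.1 (by omega)
    rw [← Finset.sum_filter, Finset.filter_filter]
    split_ifs with hsub
    · have : Finset.filter (fun j => l ≤ x j ∧ j ∈ shortest x S) Finset.univ = shortest x S := by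
        ext j
        simp only [Finset.mem_filter, Finset.mem_univ, true_and, and_iff_right_iff_imp]
        intro hj
        exact (Finset.mem_filter.1 (hsub (Finset.mem_filter.1 hj).1)).2
      rw [this, Finset.sum_const, nsmul_eq_mul]
      have hc : ((shortest x S).card : ℝ) ≠ 0 := by
        exact_mod_cast (Finset.card_pos.2 (shortest_nonempty hne)).ne'
      field_simp
    · have : Finset.filter (fun j => l ≤ x j ∧ j ∈ shortest x S) Finset.univ = ∅ := by
        rw [Finset.filter_eq_empty_iff]
        rintro j - ⟨hlj, hj⟩
        refine hsub fun j' hj' => Finset.mem_filter.2 ⟨hS.1 hj', hlj.trans ?_⟩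
        exact (Finset.mem_filter.1 hj).2 j' hj'
      rw [this, Finset.sum_empty]
  simp only [assignProb, if_pos hi]
  rw [Finset.sum_comm, Finset.sum_congr rfl h1, ← Finset.sum_filter, Finset.sum_const,
    nsmul_eq_mul, div_eq_mul_inv]
  congr 2
  rw [← Finset.card_powersetCard]
  congr 1
  ext S
  simp only [Finset.mem_filter, Finset.mem_powersetCard]
  constructor
  · rintro ⟨⟨_, h2⟩, h3⟩; exact ⟨h3, h2⟩
  · rintro ⟨h3, h2⟩; exact ⟨⟨h3.trans (Finset.filter_subset _ _), h2⟩, h3⟩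

theorem sum_assignProb {d : ℕ} (hd : 1 ≤ d) (x : Fin N → ℕ) {i : Fin G.numDisp}
    (hi : d ≤ G.deg i) : ∑ j, G.assignProb d x i j = 1 := by
  have h := G.sum_assignProb_filter_le hd x hi 0
  simp only [Nat.zero_le, Finset.filter_true] at h
  rw [h]
  exact div_self (by exact_mod_cast (Nat.choose_pos hi).ne')

theorem sum_assignProb_filter_eq {d : ℕ} (hd : 1 ≤ d) (x : Fin N → ℕ) {i : Fin G.numDisp}
    (hi : d ≤ G.deg i) (l : ℕ) :
    ∑ j with x j = l, G.assignProb d x i j =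
      ((((G.nbr i).filter (fun j => l ≤ x j)).card.choose d : ℝ) -
        (((G.nbr i).filter (fun j => l + 1 ≤ x j)).card.choose d : ℝ)) /
        ((G.deg i).choose d : ℝ) := by
  rw [sub_div, ← G.sum_assignProb_filter_le hd x hi, ← G.sum_assignProb_filter_le hd x hi,
    eq_sub_iff_add_eq, ← Finset.sum_union]
  · congr 1
    ext j
    simp only [Finset.mem_union, Finset.mem_filter, Finset.mem_univ, true_and]
    omega
  · rw [Finset.disjoint_filter]
    intro j _ h
    omega

theorem assignProb_of_notMem {d : ℕ} (x : Fin N → ℕ) {i : Fin G.numDisp} {j : Fin N}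
    (hj : j ∉ G.nbr i) : G.assignProb d x i j = 0 := by
  unfold assignProb
  rw [if_neg hj]
  split_ifs
  · refine Finset.sum_eq_zero fun S hS => if_neg fun h => hj ?_
    exact (Finset.mem_powersetCard.1 hS).1 (Finset.mem_filter.1 h).1
  · rfl

/-- Neighbours with equally many tasks are equally likely to be joined: the transposition of the two
preserves the sampling and the queue lengths. -/
theorem assignProb_eq_of_eq {d : ℕ} {x : Fin N → ℕ} {i : Fin G.numDisp} (hi : d ≤ G.deg i)
    {j j' : Fin N} (hj : j ∈ G.nbr i) (hj' : j' ∈ G.nbr i) (hx : x j = x j') :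
    G.assignProb d x i j = G.assignProb d x i j' := by
  classical
  simp only [assignProb, if_pos hi]
  set σ := Equiv.swap j j'
  have hxσ : ∀ a, x (σ a) = x a := by
    intro a
    by_cases h1 : a = j
    · subst h1; simp [σ, hx]
    · by_cases h2 : a = j'
      · subst h2; simp [σ, hx]
      · simp [σ, Equiv.swap_apply_of_ne_of_ne h1 h2]
  have hnbr : ∀ a ∈ G.nbr i, σ a ∈ G.nbr i := by
    intro a ha
    by_cases h1 : a = j
    · subst h1; simpa [σ] using hj'
    · by_cases h2 : a = j'
      · subst h2; simpa [σ] using hj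
      · simpa [σ, Equiv.swap_apply_of_ne_of_ne h1 h2] using ha
  have hσσ : ∀ a, σ (σ a) = a := Equiv.swap_apply_self j j'
  have hshort : ∀ S : Finset (Fin N), shortest x (S.map σ.toEmbedding) =
      (shortest x S).map σ.toEmbedding := by
    intro S
    ext a
    simp only [shortest, Finset.mem_filter, Finset.mem_map,
      Equiv.coe_toEmbedding, forall_exists_index, and_imp, forall_apply_eq_imp_iff₂, hxσ]
    constructor
    · rintro ⟨⟨b, hb, rfl⟩, h⟩
      exact ⟨b, ⟨hb, fun c hc => by simpa [hxσ] using h c hc⟩, rfl⟩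
    · rintro ⟨b, ⟨hb, h⟩, rfl⟩
      exact ⟨⟨b, hb, rfl⟩, fun c hc => by simpa [hxσ] using h c hc⟩
  refine Finset.sum_bij' (fun S _ => S.map σ.toEmbedding) (fun S _ => S.map σ.toEmbedding)
    ?_ ?_ ?_ ?_ ?_
  · intro S hS
    rw [Finset.mem_powersetCard] at hS ⊢
    refine ⟨fun a ha => ?_, by simpa using hS.2⟩
    obtain ⟨b, hb, rfl⟩ := Finset.mem_map.1 ha
    exact hnbr b (hS.1 hb)
  · intro S hS
    rw [Finset.mem_powersetCard] at hS ⊢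
    refine ⟨fun a ha => ?_, by simpa using hS.2⟩
    obtain ⟨b, hb, rfl⟩ := Finset.mem_map.1 ha
    exact hnbr b (hS.1 hb)
  · intro S _
    rw [Finset.map_map]
    convert Finset.map_refl
    ext a
    simp [hσσ]
  · intro S _
    rw [Finset.map_map]
    convert Finset.map_refl
    ext a
    simp [hσσ]
  · intro S _
    have : j' ∈ shortest x (S.map σ.toEmbedding) ↔ j ∈ shortest x S := by
      rw [hshort, Finset.mem_map_equiv]
      simp [σ]
    rw [if_congr this rfl rfl, hshort, Finset.card_map]

/-- Among the servers with `l` tasks the task is shared in proportion to the numbers of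
neighbours. -/
theorem sum_assignProb_mul_card {d : ℕ} {x : Fin N → ℕ} {i : Fin G.numDisp}
    (hi : d ≤ G.deg i) (l : ℕ) {T : Finset (Fin N)} (hT : ∀ j ∈ T, x j = l) :
    (∑ j ∈ T, G.assignProb d x i j) * ((G.nbr i).filter (fun j => x j = l)).card =
      (T ∩ G.nbr i).card * ∑ j with x j = l, G.assignProb d x i j := by
  classical
  have hred : ∀ T : Finset (Fin N), ∑ j ∈ T, G.assignProb d x i j =
      ∑ j ∈ T ∩ G.nbr i, G.assignProb d x i j := by
    intro T
    refine (Finset.sum_subset Finset.inter_subset_left fun j hj hn => ?_).symm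
    refine G.assignProb_of_notMem x fun h => hn (Finset.mem_inter.2 ⟨hj, h⟩)
  rcases ((G.nbr i).filter (fun j => x j = l)).eq_empty_or_nonempty with he | ⟨j₀, hj₀⟩
  · have : T ∩ G.nbr i = ∅ := by
      rw [Finset.eq_empty_iff_forall_notMem]
      intro j hj
      rw [Finset.mem_inter] at hj
      have : j ∈ (G.nbr i).filter (fun j => x j = l) := Finset.mem_filter.2 ⟨hj.2, hT j hj.1⟩
      rw [he] at this
      exact absurd this (Finset.notMem_empty _)
    simp [this, he]
  · rw [Finset.mem_filter] at hj₀
    have hc : ∀ j ∈ G.nbr i, x j = l → G.assignProb d x i j = G.assignProb d x i j₀ :=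
      fun j hj hjl => G.assignProb_eq_of_eq hi hj hj₀.1 (by rw [hjl, hj₀.2])
    have hset : (Finset.univ.filter fun j => x j = l) ∩ G.nbr i =
        (G.nbr i).filter (fun j => x j = l) := by
      ext j; simp [and_comm]
    rw [hred T, hred (Finset.univ.filter fun j => x j = l), hset,
      Finset.sum_congr rfl fun j hj => hc j (Finset.mem_inter.1 hj).2
        (hT j (Finset.mem_inter.1 hj).1),
      Finset.sum_congr rfl fun j hj => hc j (Finset.mem_filter.1 hj).1 (Finset.mem_filter.1 hj).2]
    simp only [Finset.sum_const, nsmul_eq_mul]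
    ring

theorem arrivalRate_nonneg (d : ℕ) {lam : ℝ} (hlam : 0 ≤ lam) (x : Fin N → ℕ) (j : Fin N) :
    0 ≤ G.arrivalRate d lam x j :=
  Finset.sum_nonneg fun i _ => mul_nonneg hlam (G.assignProb_nonneg d x i j)

theorem sum_arrivalRate {d : ℕ} (hd : 1 ≤ d) (lam : ℝ) (x : Fin N → ℕ)
    (hdeg : ∀ i, d ≤ G.deg i) : ∑ j, G.arrivalRate d lam x j = lam * G.numDisp := by
  simp only [arrivalRate]
  rw [Finset.sum_comm]
  simp only [← Finset.mul_sum, G.sum_assignProb hd x (hdeg _)]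
  simp

/-- The servers with at least `l` tasks receive at most the fraction `load` of their total
service rate. -/
theorem sum_arrivalRate_filter_le {d : ℕ} (hd : 1 ≤ d) {lam : ℝ} {u : Fin M → ℝ}
    (hu : ∀ m, 0 < u m) (hdeg : ∀ i, d ≤ G.deg i) (x : Fin N → ℕ) (l : ℕ) :
    ∑ j with l ≤ x j, G.arrivalRate d lam x j ≤
      G.load d lam u * ∑ j with l ≤ x j, u (G.servType j) := by
  classical
  set U : Finset (Fin N) := Finset.univ.filter fun j => l ≤ x j with hU
  rcases U.eq_empty_or_nonempty with he | hne
  · simp [he]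
  have hpos : 0 < ∑ j ∈ U, u (G.servType j) := Finset.sum_pos (fun j _ => hu _) hne
  have h1 : (∑ j ∈ U, u (G.servType j))⁻¹ * (∑ j ∈ U, G.arrivalRate d lam x j) ≤
      G.load d lam u := by
    refine le_trans (le_of_eq ?_) (le_ciSup (Set.finite_range _).bddAbove ⟨U, hne⟩)
    congr 1
    simp only [arrivalRate]
    rw [Finset.sum_comm]
    refine Finset.sum_congr rfl fun i _ => ?_
    rw [if_pos (hdeg i), ← Finset.mul_sum, G.sum_assignProb_filter_le hd x (hdeg i) l,
      Finset.sum_const, nsmul_eq_mul, Finset.card_powersetCard]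
    have : U ∩ G.nbr i = (G.nbr i).filter (fun j => l ≤ x j) := by
      ext j; simp [hU, and_comm]
    rw [this]; ring
  rwa [inv_mul_le_iff₀ hpos, mul_comm] at h1

/-- Summation by layers of the previous bound. -/
theorem sum_arrivalRate_mul_le {d : ℕ} (hd : 1 ≤ d) {lam : ℝ} {u : Fin M → ℝ}
    (hu : ∀ m, 0 < u m) (hdeg : ∀ i, d ≤ G.deg i) (x : Fin N → ℕ) {g : ℕ → ℝ} (hg : Monotone g)
    (hg0 : g 0 = 0) :
    ∑ j, G.arrivalRate d lam x j * g (x j) ≤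
      G.load d lam u * ∑ j, u (G.servType j) * g (x j) := by
  set L := ∑ j, x j
  have hL : ∀ j, x j ≤ L := fun j => Finset.single_le_sum (fun _ _ => Nat.zero_le _)
    (Finset.mem_univ j)
  have hlayer : ∀ n, n ≤ L → g n = ∑ l ∈ Finset.range L, if l + 1 ≤ n then g (l + 1) - g l else 0 := by
    intro n hn
    rw [← Finset.sum_filter]
    have : (Finset.range L).filter (fun l => l + 1 ≤ n) = Finset.range n := by
      ext l; simp only [Finset.mem_filter, Finset.mem_range]; omega
    rw [this, Finset.sum_range_sub, hg0, sub_zero]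
  have hsum : ∀ a : Fin N → ℝ, ∑ j, a j * g (x j) =
      ∑ l ∈ Finset.range L, (g (l + 1) - g l) * ∑ j with l + 1 ≤ x j, a j := by
    intro a
    simp only [hlayer _ (hL _), Finset.mul_sum, Finset.sum_filter]
    rw [Finset.sum_comm]
    refine Finset.sum_congr rfl fun l _ => Finset.sum_congr rfl fun j _ => ?_
    split_ifs <;> ring
  rw [hsum, hsum, Finset.mul_sum]
  refine Finset.sum_le_sum fun l _ => ?_
  have h1 := G.sum_arrivalRate_filter_le (lam := lam) hd hu hdeg x (l + 1)
  have h2 : 0 ≤ g (l + 1) - g l := sub_nonneg.2 (hg (Nat.le_succ l))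
  calc _ ≤ (g (l + 1) - g l) * (G.load d lam u * ∑ j with l + 1 ≤ x j, u (G.servType j)) :=
        mul_le_mul_of_nonneg_left h1 h2
    _ = _ := by ring

end System
end JSQ

/-! ### Moments under a stationary law -/

namespace JumpChain
variable {X ι : Type*} [Fintype ι] {Q : JumpChain X ι}

/-- Under a stationary law the Foster–Lyapunov bound `Q V ≤ c - H` controls the mean of `H`; since
`V` is unbounded, the stationarity is applied to the truncations of `V`. -/
theorem integral_le_of_drift [Countable X] [MeasurableSpace X] [MeasurableSingletonClass X]
    {V H : X → ℝ} {c : ℝ} (hc : 0 ≤ c) (hV : ∀ x, 0 ≤ V x) (hH : ∀ x, 0 ≤ H x)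
    (hdrift : ∀ x, Q.gen V x ≤ c - H x) {π : ProbabilityMeasure X}
    (hπ : ∀ f : X → ℝ, (∃ B, ∀ x, |f x| ≤ B) → ∫ x, Q.gen f x ∂(π : Measure X) = 0) :
    Integrable H (π : Measure X) ∧ ∫ x, H x ∂(π : Measure X) ≤ c := by
  classical
  set F : ℕ → X → ℝ := fun n x => if V x < n then H x else 0 with hF
  have hmin : ∀ n : ℕ, ∀ x, |min (V x) (n : ℝ)| ≤ n := fun n x => by
    rw [abs_of_nonneg (le_min (hV x) (Nat.cast_nonneg n))]; exact min_le_right _ _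
  have hle : ∀ n x, F n x ≤ c - Q.gen (fun x => min (V x) (n : ℝ)) x := by
    intro n x
    simp only [hF]
    split_ifs with h
    · have h1 : Q.gen (fun x => min (V x) (n : ℝ)) x ≤ Q.gen V x := by
        refine Finset.sum_le_sum fun a _ => mul_le_mul_of_nonneg_left ?_ (Q.rate_nonneg a x)
        have := min_le_left (V (Q.step a x)) (n : ℝ)
        dsimp only
        rw [min_eq_left h.le]; linarith
      linarith [hdrift x]
    · have h1 : Q.gen (fun x => min (V x) (n : ℝ)) x ≤ 0 := by
        refine Finset.sum_nonpos fun a _ => mul_nonpos_of_nonneg_of_nonpos (Q.rate_nonneg a x) ?_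
        have := min_le_right (V (Q.step a x)) (n : ℝ)
        dsimp only
        rw [min_eq_right (not_lt.1 h)]; linarith
      linarith
  have hF0 : ∀ n x, 0 ≤ F n x := fun n x => by simp only [hF]; split_ifs <;> [exact hH x; rfl]
  have hFint : ∀ n, ∫⁻ x, ENNReal.ofReal (F n x) ∂(π : Measure X) ≤ ENNReal.ofReal c := by
    intro n
    have hg : Integrable (fun x => Q.gen (fun x => min (V x) (n : ℝ)) x) (π : Measure X) :=
      integrable_of_abs_le (abs_gen_le (hmin n))
    have hi : Integrable (fun x => c - Q.gen (fun x => min (V x) (n : ℝ)) x) (π : Measure X) :=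
      (integrable_const c).sub hg
    calc ∫⁻ x, ENNReal.ofReal (F n x) ∂(π : Measure X)
        ≤ ∫⁻ x, ENNReal.ofReal (c - Q.gen (fun x => min (V x) (n : ℝ)) x) ∂(π : Measure X) :=
          lintegral_mono fun x => ENNReal.ofReal_le_ofReal (hle n x)
      _ = ENNReal.ofReal (∫ x, (c - Q.gen (fun x => min (V x) (n : ℝ)) x) ∂(π : Measure X)) :=
          (ofReal_integral_eq_lintegral_ofReal hi
            (Eventually.of_forall fun x => (hF0 n x).trans (hle n x))).symm
      _ = ENNReal.ofReal c := by
          rw [integral_sub (integrable_const c) hg, hπ _ ⟨n, hmin n⟩]; simp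
  have hlim : Tendsto (fun n => ∫⁻ x, ENNReal.ofReal (F n x) ∂(π : Measure X)) atTop
      (𝓝 (∫⁻ x, ENNReal.ofReal (H x) ∂(π : Measure X))) := by
    refine lintegral_tendsto_of_tendsto_of_monotone
      (fun n => (measurable_of_countable _).aemeasurable) (Eventually.of_forall fun x n m hnm => ?_)
      (Eventually.of_forall fun x => ?_)
    · refine ENNReal.ofReal_le_ofReal ?_
      have : (n : ℝ) ≤ m := by exact_mod_cast hnm
      simp only [hF]
      split_ifs with h1 h2
      · exact le_rfl
      · exact absurd (h1.trans_le this) h2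
      · exact hH x
      · exact le_rfl
    · refine tendsto_const_nhds.congr' ?_
      obtain ⟨n, hn⟩ := exists_nat_gt (V x)
      filter_upwards [eventually_ge_atTop n] with m hm
      have : (n : ℝ) ≤ m := by exact_mod_cast hm
      simp only [hF]
      rw [if_pos (hn.trans_le this)]
  have hfin : ∫⁻ x, ENNReal.ofReal (H x) ∂(π : Measure X) ≤ ENNReal.ofReal c :=
    le_of_tendsto' hlim hFint
  have hint : Integrable H (π : Measure X) := by
    refine ⟨(measurable_of_countable _).aestronglyMeasurable, ?_⟩
    rw [hasFiniteIntegral_iff_ofReal (Eventually.of_forall hH)]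
    exact hfin.trans_lt ENNReal.ofReal_lt_top
  refine ⟨hint, ?_⟩
  rw [← ofReal_integral_eq_lintegral_ofReal hint (Eventually.of_forall hH)] at hfin
  exact (ENNReal.ofReal_le_ofReal_iff hc).1 hfin

end JumpChain

namespace JSQ
namespace System

/-! ### The queue length process in the subcritical regime -/

variable {K M N : ℕ} (G : System K M N)

/-- The queue length process as a jump chain: `Sum.inl j` is an arrival at server `j`, `Sum.inr j`
a departure from server `j`. -/
noncomputable def queueChain {d : ℕ} (hd : 1 ≤ d) {lam : ℝ} (hlam : 0 ≤ lam) {u : Fin M → ℝ}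
    (hu : ∀ m, 0 < u m) (hdeg : ∀ i, d ≤ G.deg i) : JumpChain (Fin N → ℕ) (Fin N ⊕ Fin N) where
  rate a x := a.elim (fun j => G.arrivalRate d lam x j)
    (fun j => if 0 < x j then u (G.servType j) else 0)
  step a x := a.elim (fun j => Function.update x j (x j + 1))
    (fun j => Function.update x j (x j - 1))
  bound := lam * G.numDisp + ∑ j, u (G.servType j) + 1
  rate_nonneg a x := by
    rcases a with j | j
    · exact G.arrivalRate_nonneg d hlam x j
    · simp only [Sum.elim_inr]
      split_ifs
      · exact (hu _).le
      · exact le_rfl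
  bound_pos := by
    have := Finset.sum_nonneg fun (j : Fin N) (_ : j ∈ Finset.univ) => (hu (G.servType j)).le
    positivity
  sum_rate_lt x := by
    simp only [Fintype.sum_sum_type, Sum.elim_inl, Sum.elim_inr]
    rw [G.sum_arrivalRate hd lam x hdeg]
    have : ∑ j, (if 0 < x j then u (G.servType j) else 0) ≤ ∑ j, u (G.servType j) :=
      Finset.sum_le_sum fun j _ => by
        split_ifs
        · exact le_rfl
        · exact (hu _).le
    linarith

theorem queueChain_gen {d : ℕ} (hd : 1 ≤ d) {lam : ℝ} (hlam : 0 ≤ lam) {u : Fin M → ℝ}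
    (hu : ∀ m, 0 < u m) (hdeg : ∀ i, d ≤ G.deg i) (f : (Fin N → ℕ) → ℝ) :
    (G.queueChain hd hlam hu hdeg).gen f = G.generator d lam u f := by
  ext x
  simp only [JumpChain.gen, queueChain, generator, Fintype.sum_sum_type, Sum.elim_inl,
    Sum.elim_inr, Finset.sum_add_distrib]
  congr 1
  exact Finset.sum_congr rfl fun j _ => by split_ifs <;> simp

theorem IsStationary.integral_generator {G : System K M N} {d : ℕ} {lam : ℝ} {u : Fin M → ℝ}
    {π : ProbabilityMeasure (Fin N → ℕ)} (h : G.IsStationary d lam u π) {f : (Fin N → ℕ) → ℝ}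
    (hf : ∃ C : ℝ, ∀ x, |f x| ≤ C) :
    ∫ x, G.generator d lam u f x ∂(π : Measure (Fin N → ℕ)) = 0 :=
  (uniqueDiffOn_Ici (0 : ℝ) 0 (Set.mem_Ici.2 le_rfl)).eq_deriv _ (h f hf 0 le_rfl)
    (hasDerivWithinAt_const _ _ _)

theorem isStationary_iff {d : ℕ} {lam : ℝ} {u : Fin M → ℝ} {π : ProbabilityMeasure (Fin N → ℕ)} :
    G.IsStationary d lam u π ↔ ∀ f : (Fin N → ℕ) → ℝ, (∃ C : ℝ, ∀ x, |f x| ≤ C) →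
      ∫ x, G.generator d lam u f x ∂(π : Measure (Fin N → ℕ)) = 0 := by
  refine ⟨fun h f hf => h.integral_generator hf, fun h f hf t _ => ?_⟩
  rw [h f hf]
  exact hasDerivWithinAt_const _ _ _

/-- The drift of the cubic Lyapunov function. A cubic function is used since its drift controls the
second moments of the stationary queue lengths, and thereby the tails of the occupancies. -/
theorem generator_cube_le {d : ℕ} (hd : 1 ≤ d) {lam : ℝ} {u : Fin M → ℝ}
    (hu : ∀ m, 0 < u m) (hdeg : ∀ i, d ≤ G.deg i) {r : ℝ} (hr : r < 1)
    (hload : G.load d lam u ≤ r) (x : Fin N → ℕ) :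
    G.generator d lam u (fun x => ∑ j, (x j : ℝ) ^ 3) x ≤
      (lam * G.numDisp + 6 / (1 - r) * ∑ j, u (G.servType j)) -
        3 / 2 * (1 - r) * ∑ j, u (G.servType j) * (x j : ℝ) ^ 2 := by
  have hdiff : ∀ j (n : ℕ), ∑ j', ((Function.update x j n) j' : ℝ) ^ 3 - ∑ j', (x j' : ℝ) ^ 3 =
      (n : ℝ) ^ 3 - (x j : ℝ) ^ 3 := by
    intro j n
    rw [← Finset.sum_sub_distrib, Finset.sum_eq_single j]
    · simp
    · intro b _ hb; simp [Function.update_of_ne hb]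
    · simp
  have hg := G.sum_arrivalRate_mul_le (lam := lam) hd hu hdeg x
    (g := fun n : ℕ => 3 * (n : ℝ) ^ 2 + 3 * n)
    (fun a b hab => by
      have : (a : ℝ) ≤ b := by exact_mod_cast hab
      simp only; gcongr) (by simp)
  have hpos : 0 ≤ ∑ j, u (G.servType j) * (3 * (x j : ℝ) ^ 2 + 3 * x j) :=
    Finset.sum_nonneg fun j _ => mul_nonneg (hu _).le (by positivity)
  have hg2 := hg.trans (mul_le_mul_of_nonneg_right hload hpos)
  have harr := G.sum_arrivalRate hd lam x hdeg
  have hterm : ∀ j, G.arrivalRate d lam x j *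
        (∑ j', ((Function.update x j (x j + 1)) j' : ℝ) ^ 3 - ∑ j', (x j' : ℝ) ^ 3) +
      (if 0 < x j then u (G.servType j) *
        (∑ j', ((Function.update x j (x j - 1)) j' : ℝ) ^ 3 - ∑ j', (x j' : ℝ) ^ 3) else 0) ≤
      G.arrivalRate d lam x j * (3 * (x j : ℝ) ^ 2 + 3 * x j) + G.arrivalRate d lam x j +
        u (G.servType j) * (-3 * (x j : ℝ) ^ 2 + 3 * x j) := by
    intro j
    rw [hdiff, hdiff]
    have h1 : ((x j + 1 : ℕ) : ℝ) ^ 3 - (x j : ℝ) ^ 3 = 3 * (x j : ℝ) ^ 2 + 3 * x j + 1 := by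
      push_cast; ring
    rw [h1]
    split_ifs with h
    · have h2 : ((x j - 1 : ℕ) : ℝ) ^ 3 - (x j : ℝ) ^ 3 ≤ -3 * (x j : ℝ) ^ 2 + 3 * x j := by
        rw [Nat.cast_sub h]; push_cast; nlinarith
      have := mul_le_mul_of_nonneg_left h2 (hu (G.servType j)).le
      linarith
    · have h2 : (x j : ℝ) = 0 := by
        have : x j = 0 := by omega
        simp [this]
      rw [h2]; simp
  have hfin : ∀ j, r * (u (G.servType j) * (3 * (x j : ℝ) ^ 2 + 3 * x j)) +
      u (G.servType j) * (-3 * (x j : ℝ) ^ 2 + 3 * x j) ≤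
      6 / (1 - r) * u (G.servType j) - 3 / 2 * (1 - r) * (u (G.servType j) * (x j : ℝ) ^ 2) := by
    intro j
    have hr' : 0 < 1 - r := by linarith
    -- the linear term is absorbed by the quadratic one
    have h3 : 6 * (x j : ℝ) ≤ 3 / 2 * (1 - r) * (x j : ℝ) ^ 2 + 6 / (1 - r) := by
      have : 3 / 2 * (1 - r) * (x j : ℝ) ^ 2 + 6 / (1 - r) - 6 * (x j : ℝ) =
          3 / 2 * (1 - r) * ((x j : ℝ) - 2 / (1 - r)) ^ 2 := by field_simp; ring
      have h4 : 0 ≤ 3 / 2 * (1 - r) * ((x j : ℝ) - 2 / (1 - r)) ^ 2 := by positivity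
      linarith
    have h5 : 3 * (1 + r) * (x j : ℝ) ≤ 6 * x j := by
      have : (0 : ℝ) ≤ x j := Nat.cast_nonneg _
      nlinarith
    have := mul_le_mul_of_nonneg_left (h5.trans h3) (hu (G.servType j)).le
    nlinarith
  refine (Finset.sum_le_sum fun j _ => hterm j).trans ?_
  rw [Finset.sum_add_distrib, Finset.sum_add_distrib, harr]
  have h6 := Finset.sum_le_sum fun (j : Fin N) (_ : j ∈ Finset.univ) => hfin j
  rw [Finset.sum_add_distrib, Finset.sum_sub_distrib, ← Finset.mul_sum, ← Finset.mul_sum,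
    ← Finset.mul_sum] at h6
  linarith

theorem finite_setOf_sum_mul_pow_le {a : Fin N → ℝ} (ha : ∀ j, 0 < a j) {e : ℕ} (he : e ≠ 0)
    (R : ℝ) : {x : Fin N → ℕ | ∑ j, a j * (x j : ℝ) ^ e ≤ R}.Finite := by
  refine (Set.Finite.pi' (t := fun j => {n : ℕ | n ≤ ⌈R / a j⌉₊}) fun j =>
    Set.finite_Iic _).subset fun x hx => ?_
  simp only [Set.mem_ofPred_eq] at hx ⊢
  intro j
  have h1 : a j * (x j : ℝ) ^ e ≤ R := le_trans
    (Finset.single_le_sum (f := fun j => a j * (x j : ℝ) ^ e)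
      (fun i _ => mul_nonneg (ha i).le (by positivity)) (Finset.mem_univ j)) hx
  have h2 : (x j : ℝ) ≤ (x j : ℝ) ^ e := by exact_mod_cast Nat.le_self_pow he _
  have h3 : (x j : ℝ) ≤ R / a j := by
    rw [le_div_iff₀ (ha j)]
    nlinarith [ha j]
  exact_mod_cast h3.trans (Nat.le_ceil _)

theorem queueChain_reach {d : ℕ} (hd : 1 ≤ d) {lam : ℝ} (hlam : 0 ≤ lam) {u : Fin M → ℝ}
    (hu : ∀ m, 0 < u m) (hdeg : ∀ i, d ≤ G.deg i) (x : Fin N → ℕ) :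
    Relation.ReflTransGen (G.queueChain hd hlam hu hdeg).Leads x 0 := by
  induction hn : ∑ j, x j generalizing x with
  | zero =>
    have : x = 0 := by
      ext j
      exact (Finset.sum_eq_zero_iff.1 hn) j (Finset.mem_univ j)
    rw [this]
  | succ n ih =>
    obtain ⟨j, hj⟩ : ∃ j, 0 < x j := by
      by_contra h
      push Not at h
      have : ∑ j, x j = 0 := Finset.sum_eq_zero fun j _ => Nat.le_zero.1 (h j)
      omega
    refine Relation.ReflTransGen.head (b := Function.update x j (x j - 1))
      ⟨Sum.inr j, ?_, rfl⟩ (ih _ ?_)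
    · simp [queueChain, hj, hu]
    · have h1 := Finset.add_sum_erase Finset.univ x (Finset.mem_univ j)
      have h2 := Finset.add_sum_erase Finset.univ (Function.update x j (x j - 1))
        (Finset.mem_univ j)
      have h3 : ∑ i ∈ Finset.univ.erase j, Function.update x j (x j - 1) i =
          ∑ i ∈ Finset.univ.erase j, x i :=
        Finset.sum_congr rfl fun i hi => Function.update_of_ne (Finset.ne_of_mem_erase hi) _ _
      rw [h3, Function.update_self] at h2
      omega

theorem queueChain_stable {d : ℕ} (hd : 1 ≤ d) {lam : ℝ} (hlam : 0 ≤ lam) {u : Fin M → ℝ}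
    (hu : ∀ m, 0 < u m) (hdeg : ∀ i, d ≤ G.deg i) {r : ℝ} (hr : r < 1)
    (hload : G.load d lam u ≤ r) :
    (G.queueChain hd hlam hu hdeg).Stable (fun x => ∑ j, (x j : ℝ) ^ 3)
      (fun x => 3 / 2 * (1 - r) * ∑ j, u (G.servType j) * (x j : ℝ) ^ 2)
      (lam * G.numDisp + 6 / (1 - r) * ∑ j, u (G.servType j)) 0 where
  V_nonneg x := by positivity
  H_nonneg x := mul_nonneg (by linarith)
    (Finset.sum_nonneg fun j _ => mul_nonneg (hu _).le (by positivity))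
  V_finite R := by
    simpa using finite_setOf_sum_mul_pow_le (N := N) (a := fun _ => 1) (fun _ => one_pos)
      three_ne_zero R
  H_finite R := by
    have h : 0 < 3 / 2 * (1 - r) := by linarith
    refine (finite_setOf_sum_mul_pow_le (N := N) (a := fun j => u (G.servType j)) (fun _ => hu _)
      two_ne_zero (R / (3 / 2 * (1 - r)))).subset fun x hx => ?_
    simp only [Set.mem_ofPred_eq] at hx ⊢
    rw [le_div_iff₀ h]; linarith
  drift x := by
    rw [queueChain_gen]
    exact G.generator_cube_le hd hu hdeg hr hload x
  reach := G.queueChain_reach hd hlam hu hdeg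

/-- A uniform bound for the second moments of the stationary queue lengths. -/
theorem IsStationary.integral_sq_le {G : System K M N} {d : ℕ} (hd : 1 ≤ d) {lam : ℝ}
    (hlam : 0 ≤ lam) {u : Fin M → ℝ} (hu : ∀ m, 0 < u m) (hdeg : ∀ i, d ≤ G.deg i) {r : ℝ}
    (hr : r < 1) (hload : G.load d lam u ≤ r) {π : ProbabilityMeasure (Fin N → ℕ)}
    (hπ : G.IsStationary d lam u π) :
    Integrable (fun x : Fin N → ℕ => 3 / 2 * (1 - r) * ∑ j, u (G.servType j) * (x j : ℝ) ^ 2)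
      (π : Measure (Fin N → ℕ)) ∧
    ∫ x : Fin N → ℕ, 3 / 2 * (1 - r) * ∑ j, u (G.servType j) * (x j : ℝ) ^ 2
      ∂(π : Measure (Fin N → ℕ)) ≤ lam * G.numDisp + 6 / (1 - r) * ∑ j, u (G.servType j) := by
  have hs := G.queueChain_stable hd hlam hu hdeg hr hload
  have hu0 := Finset.sum_nonneg fun (j : Fin N) (_ : j ∈ Finset.univ) => (hu (G.servType j)).le
  have hr' : 0 < 1 - r := by linarith
  refine JumpChain.integral_le_of_drift (Q := G.queueChain hd hlam hu hdeg) (by positivity)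
    hs.V_nonneg hs.H_nonneg hs.drift fun f hf => ?_
  rw [queueChain_gen]
  exact hπ.integral_generator hf

/-- In the subcritical regime the queue length process is ergodic. -/
theorem ergodic {d : ℕ} (hd : 1 ≤ d) {lam : ℝ} (hlam : 0 ≤ lam) {u : Fin M → ℝ}
    (hu : ∀ m, 0 < u m) (hdeg : ∀ i, d ≤ G.deg i) (hload : G.load d lam u < 1) :
    (∃! π : ProbabilityMeasure (Fin N → ℕ), G.IsStationary d lam u π) ∧
      ∀ π : ProbabilityMeasure (Fin N → ℕ), G.IsStationary d lam u π →
        ∀ μ : ℝ → ProbabilityMeasure (Fin N → ℕ), G.IsQueueLaw d lam u μ →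
          Tendsto (fun t => G.occupancyLaw (μ t)) atTop (𝓝 (G.occupancyLaw π)) := by
  have hs := G.queueChain_stable hd hlam hu hdeg hload le_rfl
  have hconv : ∀ π : ProbabilityMeasure (Fin N → ℕ), G.IsStationary d lam u π →
      ∀ μ : ℝ → ProbabilityMeasure (Fin N → ℕ), G.IsQueueLaw d lam u μ →
      ∀ (f : (Fin N → ℕ) → ℝ) (B : ℝ), (∀ x, |f x| ≤ B) →
        Tendsto (fun t => ∫ x, f x ∂(μ t : Measure (Fin N → ℕ))) atTop
          (𝓝 (∫ x, f x ∂(π : Measure (Fin N → ℕ)))) := by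
    intro π hπ μ hμ f B hf
    refine hs.tendsto_integral (fun f hf t ht => ?_) (fun f hf => ?_) hf
    · rw [queueChain_gen]; exact hμ f hf t ht
    · rw [queueChain_gen]; exact hπ.integral_generator hf
  refine ⟨?_, fun π hπ μ hμ => ?_⟩
  · obtain ⟨π, hπ⟩ := hs.exists_stationary
    simp only [queueChain_gen] at hπ
    have hπ' : G.IsStationary d lam u π := G.isStationary_iff.2 hπ
    refine ⟨π, hπ', fun π' h' => ?_⟩
    apply Subtype.ext
    refine Measure.ext_of_singleton fun x => ?_
    have h1 := hconv π hπ' _ h' (Set.indicator {x} 1) 1 fun y => by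
      by_cases hy : y = x <;> simp [Set.indicator, hy]
    have h2 := tendsto_nhds_unique tendsto_const_nhds h1
    rw [integral_indicator_one (measurableSet_singleton x),
      integral_indicator_one (measurableSet_singleton x)] at h2
    exact (measureReal_eq_measureReal_iff (measure_ne_top (π' : Measure (Fin N → ℕ)) _)
      (measure_ne_top (π : Measure (Fin N → ℕ)) _)).1 h2
  · rw [ProbabilityMeasure.tendsto_iff_forall_integral_tendsto]
    intro F
    have hmap : ∀ ν : ProbabilityMeasure (Fin N → ℕ),
        ∫ q, F q ∂(G.occupancyLaw ν : Measure (OccSpace M)) =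
          ∫ x, F (G.occupancy x) ∂(ν : Measure (Fin N → ℕ)) := by
      intro ν
      rw [occupancyLaw, ProbabilityMeasure.toMeasure_map]
      exact integral_map (measurable_of_countable _).aemeasurable
        F.continuous.measurable.aestronglyMeasurable
    simp only [hmap]
    exact hconv π hπ μ hμ _ ‖F‖ fun x => F.norm_coe_le_norm _

end System

/-! ### Divided differences of powers and sampling without replacement -/

/-- The divided difference `(a ^ d - b ^ d) / (a - b)` of the `d`-th power, as a polynomial. -/
noncomputable def powDiff (d : ℕ) (a b : ℝ) : ℝ := ∑ r ∈ Finset.range d, a ^ r * b ^ (d - 1 - r)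

theorem powDiff_mul (d : ℕ) (a b : ℝ) : powDiff d a b * (a - b) = a ^ d - b ^ d :=
  (Commute.all a b).geom_sum₂_mul d

theorem powDiff_nonneg (d : ℕ) {a b : ℝ} (ha : 0 ≤ a) (hb : 0 ≤ b) : 0 ≤ powDiff d a b :=
  Finset.sum_nonneg fun _ _ => by positivity

theorem powDiff_mono (d : ℕ) {a b a' b' : ℝ} (ha : 0 ≤ a) (hb : 0 ≤ b) (haa : a ≤ a')
    (hbb : b ≤ b') : powDiff d a b ≤ powDiff d a' b' :=
  Finset.sum_le_sum fun _ _ => by gcongr; exact pow_nonneg (ha.trans haa) _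

theorem powDiff_le (d : ℕ) {a b : ℝ} (ha : 0 ≤ a) (hb : 0 ≤ b) (ha1 : a ≤ 1) (hb1 : b ≤ 1) :
    powDiff d a b ≤ d := by
  refine (powDiff_mono d ha hb ha1 hb1).trans ?_
  simp [powDiff]

theorem abs_pow_sub_pow_le {a b : ℝ} (ha : 0 ≤ a) (hb : 0 ≤ b) (ha1 : a ≤ 1) (hb1 : b ≤ 1)
    (d : ℕ) : |a ^ d - b ^ d| ≤ d * |a - b| := by
  rw [← powDiff_mul, abs_mul, abs_of_nonneg (powDiff_nonneg d ha hb)]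
  exact mul_le_mul_of_nonneg_right (powDiff_le d ha hb ha1 hb1) (abs_nonneg _)

theorem abs_mul_sub_mul_le {a b a' b' A B : ℝ} (hA : |a| ≤ A) (hB : |b'| ≤ B) :
    |a * b - a' * b'| ≤ A * |b - b'| + B * |a - a'| := by
  have : a * b - a' * b' = a * (b - b') + b' * (a - a') := by ring
  rw [this]
  refine (abs_add_le _ _).trans ?_
  rw [abs_mul, abs_mul]
  gcongr

theorem abs_powDiff_sub_le (d : ℕ) {a b a' b' : ℝ} (ha : 0 ≤ a) (hb : 0 ≤ b) (ha1 : a ≤ 1)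
    (hb1 : b ≤ 1) (ha' : 0 ≤ a') (hb' : 0 ≤ b') (ha1' : a' ≤ 1) (hb1' : b' ≤ 1) :
    |powDiff d a b - powDiff d a' b'| ≤ (d : ℝ) ^ 2 * (|a - a'| + |b - b'|) := by
  unfold powDiff
  rw [← Finset.sum_sub_distrib]
  refine (Finset.abs_sum_le_sum_abs _ _).trans ?_
  have h1 : ∀ r ∈ Finset.range d, |a ^ r * b ^ (d - 1 - r) - a' ^ r * b' ^ (d - 1 - r)| ≤
      d * (|a - a'| + |b - b'|) := by
    intro r hr
    have hr' := Finset.mem_range.1 hr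
    refine (abs_mul_sub_mul_le (A := 1) (B := 1) ?_ ?_).trans ?_
    · rw [abs_of_nonneg (by positivity)]; exact pow_le_one₀ ha ha1
    · rw [abs_of_nonneg (by positivity)]; exact pow_le_one₀ hb' hb1'
    · have e1 := abs_pow_sub_pow_le ha ha' ha1 ha1' r
      have e2 := abs_pow_sub_pow_le hb hb' hb1 hb1' (d - 1 - r)
      have e3 : (r : ℝ) * |a - a'| ≤ d * |a - a'| :=
        mul_le_mul_of_nonneg_right (by exact_mod_cast hr'.le) (abs_nonneg _)
      have e4 : ((d - 1 - r : ℕ) : ℝ) * |b - b'| ≤ d * |b - b'| :=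
        mul_le_mul_of_nonneg_right (by exact_mod_cast (by omega : d - 1 - r ≤ d)) (abs_nonneg _)
      linarith
  refine (Finset.sum_le_sum h1).trans ?_
  simp only [Finset.sum_const, Finset.card_range, nsmul_eq_mul]
  exact le_of_eq (by ring)

/-- Sampling `d` items without replacement is close to sampling them with replacement. -/
theorem abs_choose_div_choose_sub_le {d n A : ℕ} (hd : d ≤ n) (hA : A ≤ n) :
    |(A.choose d : ℝ) / (n.choose d : ℝ) - ((A : ℝ) / n) ^ d| ≤ (d : ℝ) ^ 2 / n := by
  have hconv : (A.choose d : ℝ) / (n.choose d : ℝ) = (A.descFactorial d : ℝ) / n.descFactorial d := by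
    rw [Nat.descFactorial_eq_factorial_mul_choose, Nat.descFactorial_eq_factorial_mul_choose]
    push_cast
    rw [mul_div_mul_left _ _ (by positivity)]
  rw [hconv]
  have hA' : (A : ℝ) ≤ n := by exact_mod_cast hA
  have key : ∀ e, e ≤ d → |(A.descFactorial e : ℝ) / n.descFactorial e - ((A : ℝ) / n) ^ e| ≤
      (e : ℝ) * d / n := by
    intro e
    induction e with
    | zero => simp
    | succ e ih =>
      intro he
      have hn : (0 : ℝ) < n := by exact_mod_cast (by omega : 0 < n)
      have hne : (e : ℝ) < n := by exact_mod_cast (by omega : e < n)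
      have hcast : ((n - e : ℕ) : ℝ) = n - e := Nat.cast_sub (by omega)
      rw [Nat.descFactorial_succ, Nat.descFactorial_succ, pow_succ]
      push_cast
      rw [mul_div_mul_comm, hcast]
      have hfac : |((A - e : ℕ) : ℝ) / (n - e) - (A : ℝ) / n| ≤ d / n := by
        have hed : (e : ℝ) ≤ d := by exact_mod_cast (by omega : e ≤ d)
        rcases le_total e A with h | h
        · have heA : (e : ℝ) ≤ A := by exact_mod_cast h
          have hsub : 0 < (n : ℝ) - e := by linarith
          rw [Nat.cast_sub h]
          have h1 : ((A : ℝ) - e) / (n - e) - (A : ℝ) / n = -(e * (n - A) / (n * (n - e))) := by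
            field_simp; ring
          have h2 : 0 ≤ (n : ℝ) - A := by linarith
          rw [h1, abs_neg, abs_of_nonneg (by positivity), div_le_div_iff₀ (by positivity) hn]
          have : (e : ℝ) * (n - A) ≤ d * (n - e) := by gcongr
          nlinarith
        · have heA : (A : ℝ) ≤ e := by exact_mod_cast h
          rw [Nat.sub_eq_zero_of_le h]
          simp only [Nat.cast_zero, zero_div, zero_sub, abs_neg]
          rw [abs_of_nonneg (by positivity)]
          gcongr
          linarith
      have hle : ((A - e : ℕ) : ℝ) / (n - e) ≤ 1 := by
        rw [div_le_one (by linarith), ← hcast]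
        exact_mod_cast Nat.sub_le_sub_right hA e
      have h0 : 0 ≤ ((A - e : ℕ) : ℝ) / (n - e) :=
        div_nonneg (Nat.cast_nonneg _) (by linarith)
      rw [mul_comm (((A : ℝ) / n) ^ e)]
      refine (abs_mul_sub_mul_le (A := 1) (B := 1) ?_ ?_).trans ?_
      · rw [abs_of_nonneg h0]; exact hle
      · rw [abs_of_nonneg (by positivity)]
        exact pow_le_one₀ (by positivity) ((div_le_one hn).2 hA')
      · have := ih (by omega)
        rw [one_mul, one_mul, add_mul, add_div, one_mul]
        linarith
  simpa [sq] using key d le_rfl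

namespace System
variable {K M N : ℕ} (G : System K M N)

/-- The fraction of the neighbours of dispatcher `i` that have type `m` and at least `l` tasks. -/
noncomputable def frac (x : Fin N → ℕ) (i : Fin G.numDisp) (m : Fin M) (l : ℕ) : ℝ :=
  ((G.nbr i ∩ (G.servOf m).filter (fun j => l ≤ x j)).card : ℝ) / G.deg i

theorem sum_card_inter_servOf (S : Finset (Fin N)) (P : Fin N → Prop) [DecidablePred P] :
    ∑ m, (S ∩ (G.servOf m).filter P).card = (S.filter P).card := by
  rw [Finset.card_eq_sum_card_fiberwise (f := G.servType) (t := Finset.univ)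
    (fun _ _ => Finset.mem_coe.2 (Finset.mem_univ _))]
  refine Finset.sum_congr rfl fun m _ => ?_
  congr 1
  ext j
  simp only [servOf, Finset.mem_inter, Finset.mem_filter, Finset.mem_univ, true_and]
  tauto

theorem sum_frac (x : Fin N → ℕ) (i : Fin G.numDisp) (l : ℕ) :
    ∑ m, G.frac x i m l = (((G.nbr i).filter fun j => l ≤ x j).card : ℝ) / G.deg i := by
  simp only [frac]
  rw [← Finset.sum_div, ← G.sum_card_inter_servOf (G.nbr i) (fun j => l ≤ x j)]
  push_cast
  rfl

theorem frac_nonneg (x : Fin N → ℕ) (i : Fin G.numDisp) (m : Fin M) (l : ℕ) :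
    0 ≤ G.frac x i m l := by unfold frac; positivity

theorem sum_frac_le_one (x : Fin N → ℕ) (i : Fin G.numDisp) (l : ℕ) :
    ∑ m, G.frac x i m l ≤ 1 := by
  rw [sum_frac]
  exact div_le_one_of_le₀ (by exact_mod_cast Finset.card_filter_le _ _) (by positivity)

theorem frac_le_one (x : Fin N → ℕ) (i : Fin G.numDisp) (m : Fin M) (l : ℕ) :
    G.frac x i m l ≤ 1 :=
  (Finset.single_le_sum (fun m _ => G.frac_nonneg x i m l) (Finset.mem_univ m)).trans
    (G.sum_frac_le_one x i l)

/-- The probability that a task arriving at dispatcher `i` joins a server of type `m` with exactly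
`l` tasks, up to the effect of sampling without replacement. -/
theorem abs_sum_assignProb_sub_le {d : ℕ} (hd : 1 ≤ d) (x : Fin N → ℕ) {i : Fin G.numDisp}
    (hi : d ≤ G.deg i) (m : Fin M) (l : ℕ) :
    |∑ j ∈ (G.servOf m).filter (fun j => x j = l), G.assignProb d x i j -
      (G.frac x i m l - G.frac x i m (l + 1)) *
        powDiff d (∑ m', G.frac x i m' l) (∑ m', G.frac x i m' (l + 1))| ≤
      2 * ((d : ℝ) ^ 2 / G.deg i) := by
  classical
  set n := G.deg i with hn
  have hn0 : (0 : ℝ) < n := by exact_mod_cast (by omega : 0 < n)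
  set T := (G.servOf m).filter (fun j => x j = l) with hT
  set A := ((G.nbr i).filter fun j => l ≤ x j).card with hA
  set B := ((G.nbr i).filter fun j => l + 1 ≤ x j).card with hB
  set t := (T ∩ G.nbr i).card with ht
  set c := ((G.nbr i).filter fun j => x j = l).card with hc
  have hcAB : A = B + c := by
    rw [hA, hB, hc, ← Finset.card_union_of_disjoint]
    · congr 1; ext j; simp only [Finset.mem_union, Finset.mem_filter]
      constructor
      · rintro ⟨h1, h2⟩; by_cases h : x j = l
        · exact Or.inr ⟨h1, h⟩
        · exact Or.inl ⟨h1, by omega⟩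
      · rintro (⟨h1, h2⟩ | ⟨h1, h2⟩) <;> exact ⟨h1, by omega⟩
    · rw [Finset.disjoint_filter]; intro j _ h; omega
  have htc : t ≤ c := Finset.card_le_card fun j hj => by
    rw [Finset.mem_inter, hT, Finset.mem_filter] at hj
    exact Finset.mem_filter.2 ⟨hj.2, hj.1.2⟩
  have hAn : A ≤ n := Finset.card_filter_le _ _
  have hBn : B ≤ n := Finset.card_filter_le _ _
  have hfr : G.frac x i m l - G.frac x i m (l + 1) = t / n := by
    rw [frac, frac, ← sub_div]
    congr 1
    have : (G.nbr i ∩ (G.servOf m).filter (fun j => l ≤ x j)).card =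
        (G.nbr i ∩ (G.servOf m).filter (fun j => l + 1 ≤ x j)).card + t := by
      rw [ht, ← Finset.card_union_of_disjoint]
      · congr 1; ext j
        simp only [hT, Finset.mem_union, Finset.mem_filter, Finset.mem_inter]
        constructor
        · rintro ⟨h1, h2, h3⟩; by_cases h : x j = l
          · exact Or.inr ⟨⟨h2, h⟩, h1⟩
          · exact Or.inl ⟨h1, h2, by omega⟩
        · rintro (⟨h1, h2, h3⟩ | ⟨⟨h1, h2⟩, h3⟩)
          · exact ⟨h1, h2, by omega⟩
          · exact ⟨h3, h1, by omega⟩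
      · rw [Finset.disjoint_left]
        intro j h1 h2
        simp only [hT, Finset.mem_filter, Finset.mem_inter] at h1 h2
        omega
    rw [this]; push_cast; ring
  rw [hfr, sum_frac, sum_frac, ← hA, ← hB, ← hn]
  have hP := G.sum_assignProb_mul_card (d := d) hi l (T := T)
    (fun j hj => (Finset.mem_filter.1 hj).2)
  rw [G.sum_assignProb_filter_eq hd x hi l, ← hA, ← hB, ← hc, ← ht, ← hn] at hP
  rcases Nat.eq_zero_or_pos c with hc0 | hc0
  · have ht0 : t = 0 := by omega
    have : ∑ j ∈ T, G.assignProb d x i j = 0 := by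
      refine Finset.sum_eq_zero fun j hj => G.assignProb_of_notMem x fun hj' => ?_
      have : 0 < t := Finset.card_pos.2 ⟨j, Finset.mem_inter.2 ⟨hj, hj'⟩⟩
      omega
    rw [this, ht0]
    simp only [Nat.cast_zero, zero_div, zero_mul, sub_zero, abs_zero]
    positivity
  · have hc' : (0 : ℝ) < c := by exact_mod_cast hc0
    have h1 : ∑ j ∈ T, G.assignProb d x i j =
        t / c * ((A.choose d : ℝ) / n.choose d - (B.choose d : ℝ) / n.choose d) := by
      rw [← sub_div]
      field_simp
      rw [hP]; ring
    have h2 : (t : ℝ) / n * powDiff d (A / n) (B / n) =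
        t / c * (((A : ℝ) / n) ^ d - ((B : ℝ) / n) ^ d) := by
      rw [← powDiff_mul, ← sub_div]
      have : (A : ℝ) - B = c := by rw [hcAB]; push_cast; ring
      rw [this]; field_simp
    rw [h1, h2, ← mul_sub, abs_mul, abs_of_nonneg (by positivity)]
    have h3 : (t : ℝ) / c ≤ 1 := (div_le_one hc').2 (by exact_mod_cast htc)
    have h4 := abs_choose_div_choose_sub_le hi hAn
    have h5 := abs_choose_div_choose_sub_le hi hBn
    have h6 : |(A.choose d : ℝ) / n.choose d - (B.choose d : ℝ) / n.choose d -
        (((A : ℝ) / n) ^ d - ((B : ℝ) / n) ^ d)| ≤ 2 * ((d : ℝ) ^ 2 / n) := by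
      rw [abs_le] at h4 h5 ⊢
      constructor <;> linarith [h4.1, h4.2, h5.1, h5.2]
    calc _ ≤ 1 * (2 * ((d : ℝ) ^ 2 / n)) := by
          refine mul_le_mul h3 h6 (abs_nonneg _) zero_le_one
      _ = _ := one_mul _

end System

/-! ### The limiting drift and the graph regularity -/

/-- The parameters of the limiting system. Neither the normalization of `w` and `v` nor `p ≤ 1` is
required. -/
structure LimitData (K M : ℕ) where
  d : ℕ
  lam : ℝ
  ξ : ℝ
  w : Fin K → ℝ
  v : Fin M → ℝ
  u : Fin M → ℝ
  p : Fin K → Fin M → ℝ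
  one_le_d : 1 ≤ d
  lam_pos : 0 < lam
  ξ_pos : 0 < ξ
  w_pos : ∀ k, 0 < w k
  v_pos : ∀ m, 0 < v m
  u_pos : ∀ m, 0 < u m
  p_nonneg : ∀ k m, 0 ≤ p k m
  limDeg_pos : ∀ k, 0 < limDeg p v k

namespace LimitData

variable {K M : ℕ} (D : LimitData K M)

/-- The limiting fraction of the neighbours of a dispatcher of type `k` that have type `m`. -/
noncomputable def mix (k : Fin K) (m : Fin M) : ℝ := D.v m * D.p k m / limDeg D.p D.v k

/-- The occupancy at level `l` as seen by the dispatchers of type `k`. -/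
noncomputable def mixOcc (q : Fin M × ℕ → ℝ) (k : Fin K) (l : ℕ) : ℝ := ∑ m, D.mix k m * q (m, l)

/-- The rate of change of `q (m, l + 1)` due to arrivals. -/
noncomputable def arrDrift (q : Fin M × ℕ → ℝ) (m : Fin M) (l : ℕ) : ℝ :=
  D.lam * D.ξ * (q (m, l) - q (m, l + 1)) *
    ∑ k, D.p k m * D.w k / limDeg D.p D.v k *
      powDiff D.d (D.mixOcc q k l) (D.mixOcc q k (l + 1))

/-- The rate of change of `q (m, l + 1)`. -/
noncomputable def drift (q : Fin M × ℕ → ℝ) (m : Fin M) (l : ℕ) : ℝ :=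
  -D.u m * (q (m, l + 1) - q (m, l + 2)) + D.arrDrift q m l

/-- The probability that a task of a dispatcher of type `k` joins a server of type `m` with
exactly `l` tasks, in the limiting system. -/
noncomputable def joinProb (q : Fin M × ℕ → ℝ) (k : Fin K) (m : Fin M) (l : ℕ) : ℝ :=
  D.mix k m * (q (m, l) - q (m, l + 1)) * powDiff D.d (D.mixOcc q k l) (D.mixOcc q k (l + 1))

theorem mix_nonneg (k : Fin K) (m : Fin M) : 0 ≤ D.mix k m :=
  div_nonneg (mul_nonneg (D.v_pos m).le (D.p_nonneg k m)) (D.limDeg_pos k).le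

theorem sum_mix (k : Fin K) : ∑ m, D.mix k m = 1 := by
  simp only [mix]
  rw [← Finset.sum_div, div_eq_one_iff_eq (D.limDeg_pos k).ne', limDeg]
  exact Finset.sum_congr rfl fun m _ => mul_comm _ _

theorem mul_arrDrift (q : Fin M × ℕ → ℝ) (m : Fin M) (l : ℕ) :
    D.v m * D.arrDrift q m l = D.lam * D.ξ * ∑ k, D.w k * D.joinProb q k m l := by
  simp only [arrDrift, joinProb, mix, Finset.mul_sum]
  exact Finset.sum_congr rfl fun k _ => by ring

theorem arrDrift_eq (q : Fin M × ℕ → ℝ) (m : Fin M) (l : ℕ) :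
    D.arrDrift q m l = ∑ k, D.lam * (D.ξ * D.w k / D.v m) * D.joinProb q k m l := by
  have h := D.mul_arrDrift q m l
  have hv := (D.v_pos m).ne'
  rw [← mul_right_inj' hv, h, Finset.mul_sum, Finset.mul_sum]
  exact Finset.sum_congr rfl fun k _ => by field_simp

end LimitData

/-- The set of occupancy arrays with entries in `[0, 1]`, nonincreasing in `l`, with entries `1`
at level `0`. -/
structure IsOcc {M : ℕ} (q : Fin M × ℕ → ℝ) : Prop where
  zero : ∀ m, q (m, 0) = 1
  nonneg : ∀ m l, 0 ≤ q (m, l)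
  anti : ∀ m l, q (m, l + 1) ≤ q (m, l)

theorem IsOcc.le_one {M : ℕ} {q : Fin M × ℕ → ℝ} (h : IsOcc q) (m : Fin M) (l : ℕ) :
    q (m, l) ≤ 1 := by
  induction l with
  | zero => rw [h.zero]
  | succ l ih => exact (h.anti m l).trans ih

theorem System.isOcc_occ {K M N : ℕ} (G : System K M N) (x : Fin N → ℕ) : IsOcc (G.occ x) where
  zero m := (G.occ_spec x m).1
  nonneg m l := ((G.occ_spec x m).2 l).1
  anti m l := ((G.occ_spec x m).2 l).2

theorem OccSpace.isOcc {M : ℕ} (q : OccSpace M) : IsOcc (fun e => q.1 e) where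
  zero m := (q.2 m).1
  nonneg m l := ((q.2 m).2 l).1
  anti m l := ((q.2 m).2 l).2

namespace LimitData
variable {K M : ℕ} (D : LimitData K M)

theorem mixOcc_nonneg {q : Fin M × ℕ → ℝ} (hq : IsOcc q) (k : Fin K) (l : ℕ) :
    0 ≤ D.mixOcc q k l :=
  Finset.sum_nonneg fun m _ => mul_nonneg (D.mix_nonneg k m) (hq.nonneg m l)

theorem mixOcc_le_one {q : Fin M × ℕ → ℝ} (hq : IsOcc q) (k : Fin K) (l : ℕ) :
    D.mixOcc q k l ≤ 1 := by
  rw [← D.sum_mix k]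
  exact Finset.sum_le_sum fun m _ => mul_le_of_le_one_right (D.mix_nonneg k m) (hq.le_one m l)

theorem mix_le_one (k : Fin K) (m : Fin M) : D.mix k m ≤ 1 := by
  rw [← D.sum_mix k]
  exact Finset.single_le_sum (fun m _ => D.mix_nonneg k m) (Finset.mem_univ m)

theorem joinProb_nonneg {q : Fin M × ℕ → ℝ} (hq : IsOcc q) (k : Fin K) (m : Fin M) (l : ℕ) :
    0 ≤ D.joinProb q k m l :=
  mul_nonneg (mul_nonneg (D.mix_nonneg k m) (sub_nonneg.2 (hq.anti m l)))
    (powDiff_nonneg _ (D.mixOcc_nonneg hq k l) (D.mixOcc_nonneg hq k (l + 1)))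

theorem joinProb_le {q : Fin M × ℕ → ℝ} (hq : IsOcc q) (k : Fin K) (m : Fin M) (l : ℕ) :
    D.joinProb q k m l ≤ D.d := by
  have h1 : D.mix k m * (q (m, l) - q (m, l + 1)) ≤ 1 :=
    mul_le_one₀ (D.mix_le_one k m) (sub_nonneg.2 (hq.anti m l))
      (by linarith [hq.le_one m l, hq.nonneg m (l + 1)])
  have h2 := powDiff_le D.d (D.mixOcc_nonneg hq k l) (D.mixOcc_nonneg hq k (l + 1))
    (D.mixOcc_le_one hq k l) (D.mixOcc_le_one hq k (l + 1))
  have h3 := powDiff_nonneg D.d (D.mixOcc_nonneg hq k l) (D.mixOcc_nonneg hq k (l + 1))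
  calc _ ≤ 1 * (D.d : ℝ) := mul_le_mul h1 h2 h3 zero_le_one
    _ = _ := one_mul _

end LimitData

/-! ### The asymptotic regularity of the graphs -/

/-- The asymptotic assumptions on the sequence of graphs. -/
structure Regime {K M : ℕ} (D : LimitData K M) (G : ∀ N : ℕ, System K M N) : Prop where
  numDisp : Tendsto (fun N : ℕ => ((G N).numDisp : ℝ) / (N : ℝ)) atTop (𝓝 D.ξ)
  dispOf : ∀ k, Tendsto (fun N : ℕ => (((G N).dispOf k).card : ℝ) / ((G N).numDisp : ℝ))
    atTop (𝓝 (D.w k))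
  servOf : ∀ m, Tendsto (fun N : ℕ => (((G N).servOf m).card : ℝ) / (N : ℝ)) atTop (𝓝 (D.v m))
  compat : CompatibilityCondition G D.p
  sparse : ClusteredProportionallySparse G

/-- Degrees whose extreme quotient is close to `1` are close to each other. -/
theorem le_of_degRatio {ι : Type*} (s : Finset ι) (f : ι → ℕ) {η : ℝ} (hη0 : 0 ≤ η) (hη : η < 1)
    (h : |degRatio (sSup (f '' {i | i ∈ s})) (sInf (f '' {i | i ∈ s})) - 1| ≤ η) {a b : ι}
    (ha : a ∈ s) (hb : b ∈ s) : (f a : ℝ) ≤ (1 + η) * f b := by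
  have hfin : (f '' {i | i ∈ s}).Finite := (Finset.finite_toSet s).image f
  have h1 : f a ≤ sSup (f '' {i | i ∈ s}) := le_csSup hfin.bddAbove ⟨a, ha, rfl⟩
  have h2 : sInf (f '' {i | i ∈ s}) ≤ f b := Nat.sInf_le ⟨b, hb, rfl⟩
  set S := sSup (f '' {i | i ∈ s})
  set I := sInf (f '' {i | i ∈ s})
  have h3 : (S : ℝ) ≤ (1 + η) * I := by
    unfold degRatio at h
    split_ifs at h with he
    · rw [he]
      have : (0 : ℝ) ≤ I := Nat.cast_nonneg _
      nlinarith
    · rcases Nat.eq_zero_or_pos I with h0 | h0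
      · rw [h0] at h; simp at h; linarith
      · have h4 : (0 : ℝ) < I := by exact_mod_cast h0
        have := (abs_le.1 h).2
        rw [← div_le_iff₀ h4]; linarith
  have h1' : (f a : ℝ) ≤ S := by exact_mod_cast h1
  have h2' : (I : ℝ) ≤ f b := by exact_mod_cast h2
  calc _ ≤ (1 + η) * (I : ℝ) := h1'.trans h3
    _ ≤ _ := by gcongr

namespace System
variable {K M N : ℕ} (G : System K M N)

theorem card_edgesTo_eq_sum_degV (k : Fin K) (U : Finset (Fin N)) :
    (G.edgesTo k U).card = ∑ j ∈ U, G.degV k j := by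
  rw [edgesTo, Finset.card_eq_sum_card_fiberwise (f := Prod.snd) (t := U)]
  · refine Finset.sum_congr rfl fun j hj => ?_
    rw [degV, ← Finset.card_map (⟨fun i => (i, j), fun a b h => (Prod.mk.inj h).1⟩ :
      Fin G.numDisp ↪ Fin G.numDisp × Fin N)]
    congr 1
    ext ⟨a, b⟩
    simp only [Finset.mem_filter, Finset.mem_product, Finset.mem_map]
    constructor
    · rintro ⟨⟨⟨h1, h2⟩, h3⟩, rfl⟩; exact ⟨a, ⟨h1, h3⟩, rfl⟩
    · rintro ⟨a', ⟨h1, h3⟩, h⟩; cases h; exact ⟨⟨⟨h1, hj⟩, h3⟩, rfl⟩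
  · intro e he
    exact (Finset.mem_product.1 (Finset.mem_filter.1 he).1).2

theorem card_edgesTo_servOf_eq_sum_degW (k : Fin K) (m : Fin M) :
    (G.edgesTo k (G.servOf m)).card = ∑ i ∈ G.dispOf k, G.degW i m := by
  rw [edgesTo, Finset.card_eq_sum_card_fiberwise (f := Prod.fst) (t := G.dispOf k)]
  · refine Finset.sum_congr rfl fun i hi => ?_
    rw [degW, ← Finset.card_map (⟨fun j => (i, j), fun a b h => (Prod.mk.inj h).2⟩ :
      Fin N ↪ Fin G.numDisp × Fin N)]
    congr 1
    ext ⟨a, b⟩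
    simp only [Finset.mem_filter, Finset.mem_product, Finset.mem_map]
    constructor
    · rintro ⟨⟨⟨h1, h2⟩, h3⟩, rfl⟩; exact ⟨b, ⟨h2, h3⟩, rfl⟩
    · rintro ⟨a', ⟨h1, h3⟩, h⟩; cases h; exact ⟨⟨⟨hi, h1⟩, h3⟩, rfl⟩
  · intro e he
    exact (Finset.mem_product.1 (Finset.mem_filter.1 he).1).1

theorem sum_card_edgesTo_servOf (k : Fin K) :
    ∑ m, (G.edgesTo k (G.servOf m)).card = (G.edgesTo k Finset.univ).card := by
  simp only [card_edgesTo_eq_sum_degV]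
  exact Finset.sum_fiberwise Finset.univ G.servType (fun j => G.degV k j)

theorem degW_le_deg (i : Fin G.numDisp) (m : Fin M) : G.degW i m ≤ G.deg i := by
  refine Finset.card_le_card fun j hj => ?_
  exact Finset.mem_filter.2 ⟨Finset.mem_univ _, (Finset.mem_filter.1 hj).2⟩

end System

namespace Regime
variable {K M : ℕ} {D : LimitData K M} {G : ∀ N : ℕ, System K M N} (R : Regime D G)
include R

theorem tendsto_servOf (m : Fin M) :
    Tendsto (fun N : ℕ => (((G N).servOf m).card : ℝ)) atTop atTop := by
  have h := (R.servOf m).pos_mul_atTop (D.v_pos m) tendsto_natCast_atTop_atTop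
  refine h.congr' ?_
  filter_upwards [eventually_gt_atTop 0] with N hN
  have : (N : ℝ) ≠ 0 := by positivity
  field_simp

theorem tendsto_numDisp : Tendsto (fun N : ℕ => ((G N).numDisp : ℝ)) atTop atTop := by
  have h := R.numDisp.pos_mul_atTop D.ξ_pos tendsto_natCast_atTop_atTop
  refine h.congr' ?_
  filter_upwards [eventually_gt_atTop 0] with N hN
  have : (N : ℝ) ≠ 0 := by positivity
  field_simp

theorem dispOf_div (k : Fin K) :
    Tendsto (fun N : ℕ => (((G N).dispOf k).card : ℝ) / N) atTop (𝓝 (D.ξ * D.w k)) := by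
  refine (R.numDisp.mul (R.dispOf k)).congr' ?_
  filter_upwards [R.tendsto_numDisp.eventually_gt_atTop 0] with N hN
  field_simp

theorem dispOf_div_servOf (k : Fin K) (m : Fin M) :
    Tendsto (fun N : ℕ => (((G N).dispOf k).card : ℝ) / ((G N).servOf m).card) atTop
      (𝓝 (D.ξ * D.w k / D.v m)) := by
  refine ((R.dispOf_div k).div (R.servOf m) (D.v_pos m).ne').congr' ?_
  filter_upwards [eventually_gt_atTop 0] with N hN
  have : (N : ℝ) ≠ 0 := by positivity
  rw [Pi.div_apply, div_div_div_cancel_right₀ this]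

theorem eventually_dispOf_pos (k : Fin K) : ∀ᶠ N in atTop, 0 < (((G N).dispOf k).card : ℝ) := by
  filter_upwards [(R.dispOf k).eventually_const_lt (D.w_pos k)] with N hN
  by_contra h
  have : (((G N).dispOf k).card : ℝ) = 0 := le_antisymm (not_lt.1 h) (Nat.cast_nonneg _)
  rw [this] at hN
  simp at hN

/-- The degrees of the dispatchers are uniformly large: a dispatcher of type `k` has about
`p k m * N * v m` neighbours of some type `m` with `p k m > 0`. -/
theorem eventually_le_deg (C : ℝ) : ∀ᶠ N in atTop, ∀ i, C ≤ ((G N).deg i : ℝ) := by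
  have h : ∀ k, ∀ᶠ N in atTop, ∀ i ∈ (G N).dispOf k, C ≤ ((G N).deg i : ℝ) := by
    intro k
    obtain ⟨m, hm⟩ : ∃ m, 0 < D.p k m := by
      by_contra hn
      push Not at hn
      have : limDeg D.p D.v k ≤ 0 :=
        Finset.sum_nonpos fun m _ => mul_nonpos_of_nonpos_of_nonneg (hn m) (D.v_pos m).le
      exact absurd (D.limDeg_pos k) (not_lt.2 this)
    have h1 := R.compat.disp_regular k m
    rw [Metric.tendsto_nhds] at h1
    have h2 := (R.compat.density k m).pos_mul_atTop hm (R.tendsto_servOf m)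
    filter_upwards [h1 (1 / 2) (by norm_num), h2.eventually_ge_atTop (2 * C),
      R.eventually_dispOf_pos k, (R.tendsto_servOf m).eventually_gt_atTop 0] with N a1 a2 a3 a4 i hi
    rw [Real.dist_eq] at a1
    have h3 : (((G N).edgesTo k ((G N).servOf m)).card : ℝ) ≤
        ((G N).dispOf k).card * (2 * ((G N).degW i m : ℝ)) := by
      rw [System.card_edgesTo_servOf_eq_sum_degW]
      push_cast
      rw [← nsmul_eq_mul, ← Finset.sum_const]
      refine Finset.sum_le_sum fun i' hi' => ?_
      have := le_of_degRatio ((G N).dispOf k) (fun i => (G N).degW i m) (by norm_num)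
        (by norm_num) a1.le hi' hi
      have h0 : (0 : ℝ) ≤ (G N).degW i m := Nat.cast_nonneg _
      linarith
    have h4 : (((G N).edgesTo k ((G N).servOf m)).card : ℝ) /
        (((G N).dispOf k).card * ((G N).servOf m).card) * ((G N).servOf m).card ≤
        2 * ((G N).degW i m : ℝ) := by
      rw [div_mul_eq_mul_div, div_le_iff₀ (by positivity)]
      nlinarith
    have h5 : ((G N).degW i m : ℝ) ≤ (G N).deg i := by exact_mod_cast (G N).degW_le_deg i m
    linarith
  filter_upwards [eventually_all.2 h] with N hN i
  exact hN ((G N).dispType i) i (by simp [System.dispOf])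

theorem tendsto_edges_ratio (k : Fin K) (m : Fin M) :
    Tendsto (fun N => (((G N).edgesTo k ((G N).servOf m)).card : ℝ) /
      ((G N).edgesTo k Finset.univ).card) atTop (𝓝 (D.mix k m)) := by
  have h1 : ∀ m, Tendsto (fun N : ℕ => (((G N).edgesTo k ((G N).servOf m)).card : ℝ) / (N : ℝ) ^ 2)
      atTop (𝓝 (D.p k m * (D.ξ * D.w k) * D.v m)) := by
    intro m
    refine (((R.compat.density k m).mul (R.dispOf_div k)).mul (R.servOf m)).congr' ?_
    filter_upwards [eventually_gt_atTop 0, R.eventually_dispOf_pos k,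
      (R.tendsto_servOf m).eventually_gt_atTop 0] with N hN a1 a2
    have : (N : ℝ) ≠ 0 := by positivity
    field_simp
  have h2 : Tendsto (fun N : ℕ => (((G N).edgesTo k Finset.univ).card : ℝ) / (N : ℝ) ^ 2)
      atTop (𝓝 (∑ m, D.p k m * (D.ξ * D.w k) * D.v m)) := by
    refine (tendsto_finsetSum Finset.univ fun m _ => h1 m).congr fun N => ?_
    rw [← System.sum_card_edgesTo_servOf, ← Finset.sum_div]
    push_cast
    rfl
  have h3 : ∑ m, D.p k m * (D.ξ * D.w k) * D.v m = D.ξ * D.w k * limDeg D.p D.v k := by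
    rw [limDeg, Finset.mul_sum]
    exact Finset.sum_congr rfl fun m _ => by ring
  have hne := (mul_pos (mul_pos D.ξ_pos (D.w_pos k)) (D.limDeg_pos k)).ne'
  rw [h3] at h2
  have h4 := (h1 m).div h2 hne
  have h5 : D.p k m * (D.ξ * D.w k) * D.v m / (D.ξ * D.w k * limDeg D.p D.v k) = D.mix k m := by
    have := D.ξ_pos.ne'
    have := (D.w_pos k).ne'
    have := (D.limDeg_pos k).ne'
    rw [LimitData.mix]; field_simp
  rw [h5] at h4
  refine h4.congr' ?_
  filter_upwards [eventually_gt_atTop 0] with N hN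
  have : (N : ℝ) ^ 2 ≠ 0 := by positivity
  rw [Pi.div_apply, div_div_div_cancel_right₀ this]

/-- By the regularity of the degrees of the servers, the edges between dispatchers of type `k` and
a set `U` of servers of type `m` are asymptotically proportional to the cardinality of `U`. -/
theorem eventually_edgesTo_ratio {ε : ℝ} (hε : 0 < ε) : ∀ᶠ N in atTop, ∀ k m,
    ∀ U ⊆ (G N).servOf m, |(((G N).edgesTo k U).card : ℝ) / ((G N).edgesTo k Finset.univ).card -
      D.mix k m * ((U.card : ℝ) / ((G N).servOf m).card)| ≤ ε := by
  rw [eventually_all]; intro k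
  rw [eventually_all]; intro m
  set η := min (ε / 2) (1 / 2) with hη
  have hη0 : 0 < η := lt_min (half_pos hε) (by norm_num)
  have hη1 : η < 1 := (min_le_right _ _).trans_lt (by norm_num)
  have h1 := R.compat.serv_regular k m
  have h2 := R.tendsto_edges_ratio k m
  rw [Metric.tendsto_nhds] at h1 h2
  filter_upwards [h1 η hη0, h2 (ε / 2) (half_pos hε), (R.tendsto_servOf m).eventually_gt_atTop 0]
    with N a1 a2 a3 U hU
  rw [Real.dist_eq] at a1 a2
  set V := (G N).servOf m
  set E := (((G N).edgesTo k Finset.univ).card : ℝ) with hE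
  have hdiff : ∀ j ∈ V, ∀ j' ∈ V, |((G N).degV k j : ℝ) - (G N).degV k j'| ≤
      η * (G N).degV k j' := by
    intro j hj j' hj'
    have b1 := le_of_degRatio V (fun j => (G N).degV k j) hη0.le hη1 a1.le hj hj'
    have b2 := le_of_degRatio V (fun j => (G N).degV k j) hη0.le hη1 a1.le hj' hj
    rw [abs_le]
    constructor
    · rcases le_total ((G N).degV k j : ℝ) ((G N).degV k j') with h | h <;> nlinarith
    · linarith
  have hUV : (U.card : ℝ) ≤ V.card := by exact_mod_cast Finset.card_le_card hU
  have h3 : |(V.card : ℝ) * ((G N).edgesTo k U).card - U.card * ((G N).edgesTo k V).card| ≤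
      η * (V.card * ((G N).edgesTo k V).card) := by
    rw [System.card_edgesTo_eq_sum_degV, System.card_edgesTo_eq_sum_degV]
    push_cast
    have e1 : (V.card : ℝ) * ∑ j ∈ U, ((G N).degV k j : ℝ) -
        U.card * ∑ j ∈ V, ((G N).degV k j : ℝ) =
        ∑ j ∈ U, ∑ j' ∈ V, (((G N).degV k j : ℝ) - (G N).degV k j') := by
      simp only [Finset.sum_sub_distrib, Finset.sum_const, nsmul_eq_mul, Finset.mul_sum]
    rw [e1]
    refine (Finset.abs_sum_le_sum_abs _ _).trans ?_
    have e2 : ∀ j ∈ U, |∑ j' ∈ V, (((G N).degV k j : ℝ) - (G N).degV k j')| ≤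
        η * ∑ j' ∈ V, ((G N).degV k j' : ℝ) := by
      intro j hj
      rw [Finset.mul_sum]
      exact (Finset.abs_sum_le_sum_abs _ _).trans
        (Finset.sum_le_sum fun j' hj' => hdiff j (hU hj) j' hj')
    refine (Finset.sum_le_sum e2).trans ?_
    rw [Finset.sum_const, nsmul_eq_mul]
    have : 0 ≤ η * ∑ j' ∈ V, ((G N).degV k j' : ℝ) := by positivity
    nlinarith
  have hEV : (((G N).edgesTo k V).card : ℝ) ≤ E := by
    rw [hE, ← System.sum_card_edgesTo_servOf]
    exact_mod_cast Finset.single_le_sum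
      (f := fun m => ((G N).edgesTo k ((G N).servOf m)).card) (fun _ _ => Nat.zero_le _)
      (Finset.mem_univ m)
  have hE0 : 0 ≤ E := Nat.cast_nonneg _
  have h4 : |(((G N).edgesTo k U).card : ℝ) / E -
      (((G N).edgesTo k V).card : ℝ) / E * ((U.card : ℝ) / V.card)| ≤ η := by
    rcases hE0.eq_or_lt with h0 | h0
    · rw [← h0]; simp [hη0.le]
    · have : (((G N).edgesTo k U).card : ℝ) / E -
          (((G N).edgesTo k V).card : ℝ) / E * ((U.card : ℝ) / V.card) =
          ((V.card : ℝ) * ((G N).edgesTo k U).card - U.card * ((G N).edgesTo k V).card) /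
            (V.card * E) := by field_simp
      rw [this, abs_div, abs_of_pos (mul_pos a3 h0), div_le_iff₀ (mul_pos a3 h0)]
      refine h3.trans ?_
      gcongr
  have hfr0 : 0 ≤ (U.card : ℝ) / V.card := by positivity
  have hfr1 : (U.card : ℝ) / V.card ≤ 1 := (div_le_one a3).2 hUV
  have h5 : |((((G N).edgesTo k V).card : ℝ) / E - D.mix k m) * ((U.card : ℝ) / V.card)| ≤
      ε / 2 := by
    rw [abs_mul, abs_of_nonneg hfr0]
    nlinarith [abs_nonneg ((((G N).edgesTo k V).card : ℝ) / E - D.mix k m)]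
  have hη2 : η ≤ ε / 2 := min_le_left _ _
  rw [abs_le] at h4 h5 ⊢
  constructor <;> nlinarith [h4.1, h4.2, h5.1, h5.2]

/-- For any set `U` of servers of type `m`, most dispatchers of type `k` have nearly the expected
fraction of neighbours in `U`. -/
theorem eventually_card_atypical {ε : ℝ} (hε : 0 < ε) : ∀ᶠ N in atTop, ∀ k m,
    ∀ U ⊆ (G N).servOf m, ((((G N).dispOf k).filter (fun i =>
      ε ≤ |(((G N).nbr i ∩ U).card : ℝ) / ((G N).deg i : ℝ) -
        D.mix k m * ((U.card : ℝ) / ((G N).servOf m).card)|)).card : ℝ) ≤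
      ε * ((G N).dispOf k).card := by
  classical
  have h1 := R.sparse (ε / 2) (half_pos hε)
  rw [Metric.tendsto_nhds] at h1
  filter_upwards [h1 ε hε, R.eventually_edgesTo_ratio (half_pos hε)] with N a1 a2 k m U hU
  rw [Real.dist_eq, sub_zero] at a1
  have a3 := (le_abs_self _).trans a1.le
  have a4 := (le_ciSup (Set.finite_range _).bddAbove U).trans
    ((le_ciSup (Set.finite_range _).bddAbove k).trans a3)
  have a5 := a2 k m U hU
  have hsub : ((G N).dispOf k).filter (fun i =>
      ε ≤ |(((G N).nbr i ∩ U).card : ℝ) / ((G N).deg i : ℝ) -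
        D.mix k m * ((U.card : ℝ) / ((G N).servOf m).card)|) ⊆
      ((G N).dispOf k).filter (fun i =>
        ε / 2 ≤ |(((G N).nbr i ∩ U).card : ℝ) / (((G N).nbr i).card : ℝ) -
          (((G N).edgesTo k U).card : ℝ) / (((G N).edgesTo k Finset.univ).card : ℝ)|) := by
    intro i hi
    rw [Finset.mem_filter] at hi ⊢
    refine ⟨hi.1, ?_⟩
    have := hi.2.trans (abs_sub_le _ ((((G N).edgesTo k U).card : ℝ) /
      (((G N).edgesTo k Finset.univ).card : ℝ)) _)
    change _ ≤ |(((G N).nbr i ∩ U).card : ℝ) / ((G N).deg i : ℝ) - _|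
    linarith
  have hle : ((((G N).dispOf k).filter (fun i =>
        ε / 2 ≤ |(((G N).nbr i ∩ U).card : ℝ) / (((G N).nbr i).card : ℝ) -
          (((G N).edgesTo k U).card : ℝ) / (((G N).edgesTo k Finset.univ).card : ℝ)|)).card : ℝ) ≤
      ε * ((G N).dispOf k).card := by
    rcases Nat.eq_zero_or_pos ((G N).dispOf k).card with h0 | h0
    · have : (G N).dispOf k = ∅ := Finset.card_eq_zero.1 h0
      rw [this]; simp
    · have h0' : (0 : ℝ) < ((G N).dispOf k).card := by exact_mod_cast h0
      rw [← div_le_iff₀ h0']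
      convert a4
  refine le_trans ?_ hle
  exact_mod_cast Finset.card_le_card hsub

end Regime

/-! ### The generator on functions of the occupancy -/

namespace System
variable {K M N : ℕ} (G : System K M N)

theorem occ_succ (x : Fin N → ℕ) (m : Fin M) (l : ℕ) : G.occ x (m, l + 1) =
    (((G.servOf m).filter (fun j => l + 1 ≤ x j)).card : ℝ) / ((G.servOf m).card : ℝ) := by
  simp [occ]

theorem occ_eq_of_pos (x : Fin N → ℕ) {m : Fin M} (hm : 0 < ((G.servOf m).card : ℝ)) (l : ℕ) :
    G.occ x (m, l) =
      (((G.servOf m).filter (fun j => l ≤ x j)).card : ℝ) / ((G.servOf m).card : ℝ) := by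
  cases l with
  | zero => simp [occ, hm.ne']
  | succ l => exact G.occ_succ x m l

theorem occ_update (x : Fin N → ℕ) (j : Fin N) (y : ℕ) (m : Fin M) (l : ℕ) :
    G.occ (Function.update x j y) (m, l + 1) = G.occ x (m, l + 1) +
      if G.servType j = m then ((if l + 1 ≤ y then 1 else 0) - (if l + 1 ≤ x j then 1 else 0)) /
        ((G.servOf m).card : ℝ) else 0 := by
  have hsum : ∀ z : Fin N → ℕ, (((G.servOf m).filter (fun j => l + 1 ≤ z j)).card : ℝ) =
      ∑ j, if G.servType j = m then (if l + 1 ≤ z j then (1 : ℝ) else 0) else 0 := by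
    intro z
    rw [Finset.card_filter, servOf, Finset.sum_filter]
    push_cast
    rfl
  have hd : (∑ j', if G.servType j' = m then (if l + 1 ≤ Function.update x j y j' then (1 : ℝ)
      else 0) else 0) - (∑ j', if G.servType j' = m then (if l + 1 ≤ x j' then (1 : ℝ)
      else 0) else 0) = if G.servType j = m then ((if l + 1 ≤ y then 1 else 0) -
        (if l + 1 ≤ x j then 1 else 0)) else 0 := by
    rw [← Finset.sum_sub_distrib, Finset.sum_eq_single j]
    · simp only [Function.update_self]
      split_ifs <;> simp
    · intro b _ hb
      simp [Function.update_of_ne hb]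
    · simp
  rw [occ_succ, occ_succ, hsum, hsum, ← sub_eq_iff_eq_add', ← sub_div, hd]
  split_ifs <;> simp

theorem occ_update_add (x : Fin N → ℕ) (j : Fin N) :
    G.occ (Function.update x j (x j + 1)) = Function.update (G.occ x) (G.servType j, x j + 1)
      (G.occ x (G.servType j, x j + 1) + 1 / ((G.servOf (G.servType j)).card : ℝ)) := by
  ext ⟨m, l⟩
  cases l with
  | zero => rw [Function.update_of_ne (by simp)]; simp [occ]
  | succ l =>
    rw [occ_update]
    by_cases h : (m, l + 1) = (G.servType j, x j + 1)
    · rw [h, Function.update_self]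
      obtain ⟨h1, h2⟩ := Prod.mk.inj h
      have : l = x j := by omega
      subst h1; subst this
      simp
    · rw [Function.update_of_ne h]
      by_cases hm : G.servType j = m
      · have h2 : l ≠ x j := fun h2 => h (by rw [h2, hm])
        rw [if_pos hm]
        split_ifs <;> first | omega | simp
      · simp [hm]

theorem occ_update_sub (x : Fin N → ℕ) (j : Fin N) {n : ℕ} (hj : x j = n + 1) :
    G.occ (Function.update x j (x j - 1)) = Function.update (G.occ x) (G.servType j, n + 1)
      (G.occ x (G.servType j, n + 1) + -(1 / ((G.servOf (G.servType j)).card : ℝ))) := by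
  ext ⟨m, l⟩
  cases l with
  | zero => rw [Function.update_of_ne (by simp)]; simp [occ]
  | succ l =>
    rw [occ_update]
    by_cases h : (m, l + 1) = (G.servType j, n + 1)
    · rw [h, Function.update_self]
      obtain ⟨h1, h2⟩ := Prod.mk.inj h
      have : l = n := by omega
      subst h1; subst this
      simp [hj, neg_div]
    · rw [Function.update_of_ne h]
      by_cases hm : G.servType j = m
      · have h2 : l ≠ n := fun h2 => h (by rw [h2, hm])
        rw [if_pos hm]
        split_ifs <;> first | omega | simp
      · simp [hm]

/-- The rate at which servers of type `m` with `l` tasks receive tasks, per server of type `m`. -/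
noncomputable def levelRate (d : ℕ) (lam : ℝ) (x : Fin N → ℕ) (m : Fin M) (l : ℕ) : ℝ :=
  (∑ j ∈ (G.servOf m).filter (fun j => x j = l), G.arrivalRate d lam x j) / (G.servOf m).card

theorem sum_eq_sum_levels (x : Fin N → ℕ) (L : ℕ) (a : Fin N → ℝ) (g : Fin M → ℕ → ℝ)
    (hg : ∀ m l, L ≤ l → g m l = 0) :
    ∑ j, a j * (1 / ((G.servOf (G.servType j)).card : ℝ) * g (G.servType j) (x j)) =
      ∑ m, ∑ l ∈ Finset.range L, (∑ j ∈ (G.servOf m).filter (fun j => x j = l), a j) /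
        (G.servOf m).card * g m l := by
  rw [← Finset.sum_fiberwise Finset.univ G.servType]
  refine Finset.sum_congr rfl fun m _ => ?_
  have h1 : ∀ j, g m (x j) = ∑ l ∈ Finset.range L, if x j = l then g m l else 0 := by
    intro j
    rw [Finset.sum_ite_eq]
    split_ifs with h
    · rfl
    · exact hg m _ (by simpa using h)
  have h2 : ∀ j ∈ Finset.univ.filter (fun j => G.servType j = m),
      a j * (1 / ((G.servOf (G.servType j)).card : ℝ) * g (G.servType j) (x j)) =
      ∑ l ∈ Finset.range L, if x j = l then a j / (G.servOf m).card * g m l else 0 := by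
    intro j hj
    rw [(Finset.mem_filter.1 hj).2, h1 j, Finset.mul_sum, Finset.mul_sum]
    refine Finset.sum_congr rfl fun l _ => ?_
    split_ifs
    · ring
    · simp
  rw [Finset.sum_congr rfl h2, Finset.sum_comm]
  refine Finset.sum_congr rfl fun l _ => ?_
  rw [← Finset.sum_filter, Finset.sum_div, Finset.sum_mul]
  rfl

/-- First-order expansion of the generator on a function of the occupancy that depends on the
levels up to `L`; `g m l` plays the role of the derivative in the coordinate `(m, l + 1)`. -/
theorem abs_generator_occ_sub_le {d : ℕ} (hd : 1 ≤ d) {lam : ℝ} (hlam : 0 ≤ lam) {u : Fin M → ℝ}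
    (hu : ∀ m, 0 < u m) (hdeg : ∀ i, d ≤ G.deg i) {f : (Fin M × ℕ → ℝ) → ℝ}
    {g : Fin M → ℕ → (Fin M × ℕ → ℝ) → ℝ} {L : ℕ} {C δ : ℝ}
    (hf : ∀ q m l h, |f (Function.update q (m, l + 1) (q (m, l + 1) + h)) - f q - h * g m l q| ≤
      C * h ^ 2)
    (hg : ∀ m l q, L ≤ l → g m l q = 0)
    (hδ : ∀ m, C * (1 / ((G.servOf m).card : ℝ)) ^ 2 ≤ δ) (x : Fin N → ℕ) :
    |G.generator d lam u (fun x => f (G.occ x)) x -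
      ∑ m, ∑ l ∈ Finset.range L, (-u m * (G.occ x (m, l + 1) - G.occ x (m, l + 2)) +
        G.levelRate d lam x m l) * g m l (G.occ x)| ≤
      (lam * G.numDisp + ∑ j, u (G.servType j)) * δ := by
  set q := G.occ x with hq
  set n : Fin N → ℝ := fun j => ((G.servOf (G.servType j)).card : ℝ) with hn
  have harr := G.sum_eq_sum_levels x L (fun j => G.arrivalRate d lam x j) (fun m l => g m l q)
    (fun m l h => hg m l q h)
  have hdep := G.sum_eq_sum_levels (fun j => x j - 1) L
    (fun j => if 0 < x j then -u (G.servType j) else 0) (fun m l => g m l q)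
    (fun m l h => hg m l q h)
  have hdep2 : ∀ m l, (∑ j ∈ (G.servOf m).filter (fun j => x j - 1 = l),
      if 0 < x j then -u (G.servType j) else 0) / ((G.servOf m).card : ℝ) =
      -u m * (q (m, l + 1) - q (m, l + 2)) := by
    intro m l
    rw [hq, occ_succ, occ_succ, ← sub_div, ← mul_div_assoc]
    congr 1
    rw [← Finset.sum_filter, Finset.filter_filter]
    have h1 : ∀ j ∈ (G.servOf m).filter (fun j => x j - 1 = l ∧ 0 < x j),
        -u (G.servType j) = -u m := by
      intro j hj
      have := (Finset.mem_filter.1 (Finset.mem_filter.1 hj).1).2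
      rw [this]
    rw [Finset.sum_congr rfl h1, Finset.sum_const, nsmul_eq_mul, mul_comm]
    congr 1
    rw [eq_sub_iff_add_eq]
    norm_cast
    rw [← Finset.card_union_of_disjoint]
    · congr 1
      ext j
      simp only [Finset.mem_union, Finset.mem_filter]
      constructor
      · rintro (⟨h, h2, h3⟩ | ⟨h, h2⟩) <;> exact ⟨h, by omega⟩
      · rintro ⟨h, h2⟩
        by_cases h3 : x j = l + 1
        · exact Or.inl ⟨h, by omega, by omega⟩
        · exact Or.inr ⟨h, by omega⟩
    · rw [Finset.disjoint_filter]
      intro j _ h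
      omega
  have hmain : ∑ m, ∑ l ∈ Finset.range L, (-u m * (q (m, l + 1) - q (m, l + 2)) +
        G.levelRate d lam x m l) * g m l q =
      ∑ j, (G.arrivalRate d lam x j * (1 / n j * g (G.servType j) (x j) q) +
        (if 0 < x j then -u (G.servType j) else 0) *
          (1 / n j * g (G.servType j) (x j - 1) q)) := by
    rw [Finset.sum_add_distrib, harr, hdep, ← Finset.sum_add_distrib]
    refine Finset.sum_congr rfl fun m _ => ?_
    rw [← Finset.sum_add_distrib]
    refine Finset.sum_congr rfl fun l _ => ?_
    rw [hdep2, levelRate]; ring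
  rw [hmain, generator, ← Finset.sum_sub_distrib]
  refine (Finset.abs_sum_le_sum_abs _ _).trans ?_
  have hterm : ∀ j, |G.arrivalRate d lam x j * (f (G.occ (Function.update x j (x j + 1))) - f q) +
      (if 0 < x j then u (G.servType j) * (f (G.occ (Function.update x j (x j - 1))) - f q)
        else 0) -
      (G.arrivalRate d lam x j * (1 / n j * g (G.servType j) (x j) q) +
        (if 0 < x j then -u (G.servType j) else 0) *
          (1 / n j * g (G.servType j) (x j - 1) q))| ≤
      (G.arrivalRate d lam x j + u (G.servType j)) * δ := by
    intro j
    have ha := G.arrivalRate_nonneg d hlam x j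
    have hδj := hδ (G.servType j)
    have hδ0 : 0 ≤ δ := by
      refine le_trans ?_ hδj
      exact (abs_nonneg _).trans (hf q (G.servType j) 0 _)
    have h1 := (hf q (G.servType j) (x j) (1 / n j)).trans hδj
    rw [show Function.update q _ _ = _ from (G.occ_update_add x j).symm] at h1
    have e1 : |G.arrivalRate d lam x j * (f (G.occ (Function.update x j (x j + 1))) - f q -
        1 / n j * g (G.servType j) (x j) q)| ≤ G.arrivalRate d lam x j * δ := by
      rw [abs_mul, abs_of_nonneg ha]
      exact mul_le_mul_of_nonneg_left h1 ha
    have e2 : |(if 0 < x j then u (G.servType j) *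
          (f (G.occ (Function.update x j (x j - 1))) - f q) else 0) -
        (if 0 < x j then -u (G.servType j) else 0) *
          (1 / n j * g (G.servType j) (x j - 1) q)| ≤ u (G.servType j) * δ := by
      split_ifs with h
      · obtain ⟨a, hxa⟩ := Nat.exists_eq_succ_of_ne_zero h.ne'
        have h2 := hf q (G.servType j) a (-(1 / n j))
        rw [neg_sq] at h2
        have h2 := h2.trans hδj
        rw [show Function.update q _ _ = _ from (G.occ_update_sub x j hxa).symm] at h2
        have hxa' : x j - 1 = a := by omega
        have : u (G.servType j) * (f (G.occ (Function.update x j (x j - 1))) - f q) -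
            -u (G.servType j) * (1 / n j * g (G.servType j) (x j - 1) q) =
            u (G.servType j) * (f (G.occ (Function.update x j (x j - 1))) - f q -
              -(1 / n j) * g (G.servType j) a q) := by rw [hxa']; ring
        rw [this, abs_mul, abs_of_pos (hu _)]
        exact mul_le_mul_of_nonneg_left h2 (hu _).le
      · simp only [zero_mul, sub_zero, abs_zero]
        exact mul_nonneg (hu _).le hδ0
    rw [abs_le] at e1 e2 ⊢
    constructor <;> linarith [e1.1, e1.2, e2.1, e2.2]
  refine (Finset.sum_le_sum fun j _ => hterm j).trans (le_of_eq ?_)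
  rw [← Finset.sum_mul, Finset.sum_add_distrib, G.sum_arrivalRate hd lam x hdeg]

end System

namespace Regime
variable {K M : ℕ} {D : LimitData K M} {G : ∀ N : ℕ, System K M N} (R : Regime D G)
include R

theorem eventually_d_le_deg : ∀ᶠ N in atTop, ∀ i, D.d ≤ (G N).deg i := by
  filter_upwards [R.eventually_le_deg D.d] with N hN i
  exact_mod_cast hN i

/-! ### Convergence of the generator -/

/-- Averaged over the dispatchers of type `k`, the probability of joining a server of type `m`
with `l` tasks is close to its limiting value, uniformly in the state. -/
theorem eventually_sum_abs_sub_joinProb {θ : ℝ} (hθ : 0 < θ) : ∀ᶠ N in atTop, ∀ k m x l,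
    ∑ i ∈ (G N).dispOf k, |∑ j ∈ ((G N).servOf m).filter (fun j => x j = l),
      (G N).assignProb D.d x i j - D.joinProb ((G N).occ x) k m l| ≤
        θ * ((G N).dispOf k).card := by
  classical
  -- a fraction of `2 * M * ε` of the dispatchers contributes at most `1 + d` each, the others an
  -- error of `θ / 2` from sampling without replacement and of `ε * (2 * d ^ 2 * M + 2 * d)` from
  -- their neighbourhoods
  set d : ℝ := ((D.d : ℕ) : ℝ) with hd
  have hd0 : 0 ≤ d := Nat.cast_nonneg _
  set c : ℝ := 2 * d ^ 2 * M + 2 * d + 2 * M * (1 + d) + 1 with hc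
  have hc0 : 0 < c := by positivity
  set ε := θ / 2 / c with hε
  have hε0 : 0 < ε := by positivity
  have hεc : ε * c = θ / 2 := by rw [hε]; field_simp
  filter_upwards [R.eventually_card_atypical hε0, R.eventually_le_deg (4 * d ^ 2 / θ),
    R.eventually_le_deg 1, R.eventually_d_le_deg,
    eventually_all.2 fun m => (R.tendsto_servOf m).eventually_gt_atTop 0]
    with N a1 a2 a3 a4 a5 k m x l
  set q := (G N).occ x
  have hq : IsOcc q := (G N).isOcc_occ x
  set U : Fin M → ℕ → Finset (Fin N) := fun m' l' =>
    ((G N).servOf m').filter (fun j => l' ≤ x j) with hU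
  set bad : Fin M → ℕ → Finset (Fin (G N).numDisp) := fun m' l' =>
    ((G N).dispOf k).filter (fun i => ε ≤ |(((G N).nbr i ∩ U m' l').card : ℝ) / ((G N).deg i : ℝ) -
        D.mix k m' * (((U m' l').card : ℝ) / ((G N).servOf m').card)|) with hbad
  have hbadcard : ∀ m' l', ((bad m' l').card : ℝ) ≤ ε * ((G N).dispOf k).card :=
    fun m' l' => a1 k m' _ (Finset.filter_subset _ _)
  set Bad := Finset.univ.biUnion fun m' => bad m' l ∪ bad m' (l + 1) with hBad
  have hBadcard : (Bad.card : ℝ) ≤ 2 * M * ε * ((G N).dispOf k).card := by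
    have h1 : (Bad.card : ℝ) ≤ ∑ m', ((bad m' l ∪ bad m' (l + 1)).card : ℝ) := by
      exact_mod_cast Finset.card_biUnion_le
    refine h1.trans ?_
    have h2 : ∀ m' ∈ (Finset.univ : Finset (Fin M)), ((bad m' l ∪ bad m' (l + 1)).card : ℝ) ≤
        2 * (ε * ((G N).dispOf k).card) := by
      intro m' _
      have h3 : ((bad m' l ∪ bad m' (l + 1)).card : ℝ) ≤
          (bad m' l).card + (bad m' (l + 1)).card := by exact_mod_cast Finset.card_union_le _ _
      linarith [hbadcard m' l, hbadcard m' (l + 1)]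
    refine (Finset.sum_le_sum h2).trans (le_of_eq ?_)
    simp only [Finset.sum_const, Finset.card_univ, Fintype.card_fin, nsmul_eq_mul]
    ring
  set P : Fin (G N).numDisp → ℝ := fun i =>
    ∑ j ∈ ((G N).servOf m).filter (fun j => x j = l), (G N).assignProb D.d x i j with hP
  have hP0 : ∀ i, 0 ≤ P i := fun i => Finset.sum_nonneg fun j _ => (G N).assignProb_nonneg _ _ _ _
  have hP1 : ∀ i, P i ≤ 1 := fun i => by
    rw [← (G N).sum_assignProb D.one_le_d x (a4 i)]
    exact Finset.sum_le_sum_of_subset_of_nonneg (Finset.subset_univ _)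
      fun j _ _ => (G N).assignProb_nonneg _ _ _ _
  have hbadterm : ∀ i, |P i - D.joinProb q k m l| ≤ 1 + d := by
    intro i
    have := D.joinProb_nonneg hq k m l
    have := D.joinProb_le hq k m l
    rw [abs_le]
    constructor <;> linarith [hP0 i, hP1 i]
  have hgood : ∀ i ∈ (G N).dispOf k, i ∉ Bad → |P i - D.joinProb q k m l| ≤
      θ / 2 + ε * (2 * d ^ 2 * M + 2 * d) := by
    intro i hi hnb
    have hclose : ∀ m' l', l' = l ∨ l' = l + 1 →
        |(G N).frac x i m' l' - D.mix k m' * q (m', l')| ≤ ε := by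
      intro m' l' hl'
      have hni : i ∉ bad m' l' := by
        intro h
        refine hnb (Finset.mem_biUnion.2 ⟨m', Finset.mem_univ _, ?_⟩)
        rcases hl' with rfl | rfl
        · exact Finset.mem_union_left _ h
        · exact Finset.mem_union_right _ h
      have h1 := lt_of_not_ge fun h => hni (Finset.mem_filter.2 ⟨hi, h⟩)
      have h2 : q (m', l') = ((U m' l').card : ℝ) / ((G N).servOf m').card :=
        (G N).occ_eq_of_pos x (a5 m') l'
      rw [h2]
      exact h1.le
    have hsum : ∀ l', l' = l ∨ l' = l + 1 →
        |∑ m', (G N).frac x i m' l' - D.mixOcc q k l'| ≤ M * ε := by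
      intro l' hl'
      rw [LimitData.mixOcc, ← Finset.sum_sub_distrib]
      refine (Finset.abs_sum_le_sum_abs _ _).trans
        ((Finset.sum_le_sum fun m' _ => hclose m' l' hl').trans (le_of_eq ?_))
      simp
    have h1 := (G N).abs_sum_assignProb_sub_le D.one_le_d x (a4 i) m l
    have hs0 : ∀ l', 0 ≤ ∑ m', (G N).frac x i m' l' :=
      fun l' => Finset.sum_nonneg fun m' _ => (G N).frac_nonneg x i m' l'
    have h2 := abs_powDiff_sub_le D.d (hs0 l) (hs0 (l + 1)) ((G N).sum_frac_le_one x i l)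
      ((G N).sum_frac_le_one x i (l + 1)) (D.mixOcc_nonneg hq k l) (D.mixOcc_nonneg hq k (l + 1))
      (D.mixOcc_le_one hq k l) (D.mixOcc_le_one hq k (l + 1))
    have h2' : |powDiff D.d (∑ m', (G N).frac x i m' l) (∑ m', (G N).frac x i m' (l + 1)) -
        powDiff D.d (D.mixOcc q k l) (D.mixOcc q k (l + 1))| ≤ d ^ 2 * (2 * (M * ε)) := by
      refine h2.trans (mul_le_mul_of_nonneg_left ?_ (by positivity))
      linarith [hsum l (Or.inl rfl), hsum (l + 1) (Or.inr rfl)]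
    have h3 : |(G N).frac x i m l - (G N).frac x i m (l + 1)| ≤ 1 := by
      rw [abs_le]
      constructor <;> linarith [(G N).frac_nonneg x i m l, (G N).frac_nonneg x i m (l + 1),
        (G N).frac_le_one x i m l, (G N).frac_le_one x i m (l + 1)]
    have h4 : |powDiff D.d (D.mixOcc q k l) (D.mixOcc q k (l + 1))| ≤ d := by
      rw [abs_of_nonneg (powDiff_nonneg _ (D.mixOcc_nonneg hq k l) (D.mixOcc_nonneg hq k (l + 1)))]
      exact powDiff_le D.d (D.mixOcc_nonneg hq k l) (D.mixOcc_nonneg hq k (l + 1))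
        (D.mixOcc_le_one hq k l) (D.mixOcc_le_one hq k (l + 1))
    have h5 := abs_mul_sub_mul_le (a' := D.mix k m * (q (m, l) - q (m, l + 1)))
      (b := powDiff D.d (∑ m', (G N).frac x i m' l) (∑ m', (G N).frac x i m' (l + 1))) h3 h4
    have h6 : |(G N).frac x i m l - (G N).frac x i m (l + 1) -
        D.mix k m * (q (m, l) - q (m, l + 1))| ≤ 2 * ε := by
      have e1 := hclose m l (Or.inl rfl)
      have e2 := hclose m (l + 1) (Or.inr rfl)
      rw [abs_le] at e1 e2 ⊢
      constructor <;> linarith [e1.1, e1.2, e2.1, e2.2]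
    have h7 : 2 * (d ^ 2 / (G N).deg i) ≤ θ / 2 := by
      have e1 := a2 i
      have e2 : (0 : ℝ) < (G N).deg i := lt_of_lt_of_le one_pos (a3 i)
      rw [div_le_iff₀ hθ] at e1
      rw [← mul_div_assoc, div_le_iff₀ e2]
      linarith
    have h8 : d * |(G N).frac x i m l - (G N).frac x i m (l + 1) -
        D.mix k m * (q (m, l) - q (m, l + 1))| ≤ d * (2 * ε) := mul_le_mul_of_nonneg_left h6 hd0
    have h9 := abs_sub_le (P i) (((G N).frac x i m l - (G N).frac x i m (l + 1)) *
      powDiff D.d (∑ m', (G N).frac x i m' l) (∑ m', (G N).frac x i m' (l + 1)))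
      (D.joinProb q k m l)
    have h10 : D.joinProb q k m l = D.mix k m * (q (m, l) - q (m, l + 1)) *
      powDiff D.d (D.mixOcc q k l) (D.mixOcc q k (l + 1)) := rfl
    rw [← h10] at h5
    linarith
  have hterm : ∀ i ∈ (G N).dispOf k, |P i - D.joinProb q k m l| ≤
      (θ / 2 + ε * (2 * d ^ 2 * M + 2 * d)) + if i ∈ Bad then 1 + d else 0 := by
    intro i hi
    split_ifs with h
    · have : 0 ≤ θ / 2 + ε * (2 * d ^ 2 * M + 2 * d) := by positivity
      linarith [hbadterm i]
    · linarith [hgood i hi h]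
  refine (Finset.sum_le_sum hterm).trans ?_
  rw [Finset.sum_add_distrib, Finset.sum_const, nsmul_eq_mul, ← Finset.sum_filter,
    Finset.sum_const, nsmul_eq_mul]
  have h1 : ((((G N).dispOf k).filter (fun i => i ∈ Bad)).card : ℝ) ≤ Bad.card := by
    exact_mod_cast Finset.card_le_card fun i hi => (Finset.mem_filter.1 hi).2
  have h2 : ((((G N).dispOf k).filter (fun i => i ∈ Bad)).card : ℝ) * (1 + d) ≤
      2 * M * ε * ((G N).dispOf k).card * (1 + d) :=
    mul_le_mul_of_nonneg_right (h1.trans hBadcard) (by positivity)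
  have h3 : θ * ((G N).dispOf k).card = ((G N).dispOf k).card * (θ / 2 + ε * c) := by
    rw [hεc]; ring
  have h4 : 0 ≤ ε * ((G N).dispOf k).card := by positivity
  rw [h3, hc]
  linarith

/-- The rate of arrivals at the servers of each type and queue length is asymptotically a function
of the occupancy. -/
theorem eventually_levelRate {η : ℝ} (hη : 0 < η) : ∀ᶠ N in atTop, ∀ m x l,
    |(G N).levelRate D.d D.lam x m l - D.arrDrift ((G N).occ x) m l| ≤ η := by
  rw [eventually_all]; intro m
  have hlam := D.lam_pos
  set η' := η / (K + 1) with hη'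
  have hη'0 : 0 < η' := by positivity
  -- error per type of dispatchers
  have hk : ∀ k, ∀ᶠ N in atTop, ∀ x l,
      |D.lam * ((∑ i ∈ (G N).dispOf k, ∑ j ∈ ((G N).servOf m).filter (fun j => x j = l),
        (G N).assignProb D.d x i j) / ((G N).servOf m).card) -
        D.lam * (D.ξ * D.w k / D.v m) * D.joinProb ((G N).occ x) k m l| ≤ η' := by
    intro k
    set A := D.ξ * D.w k / D.v m with hA
    have hA0 : 0 < A := div_pos (mul_pos D.ξ_pos (D.w_pos k)) (D.v_pos m)
    set θ := η' / (2 * D.lam * (A + 1)) with hθ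
    have hθ0 : 0 < θ := by positivity
    set κ := η' / (2 * D.lam * (D.d + 1)) with hκ
    have hκ0 : 0 < κ := by positivity
    have h1 := R.dispOf_div_servOf k m
    have h2 := h1.eventually_lt_const (lt_add_one A)
    rw [Metric.tendsto_nhds] at h1
    filter_upwards [R.eventually_sum_abs_sub_joinProb hθ0, h1 κ hκ0, h2,
      (R.tendsto_servOf m).eventually_gt_atTop 0] with N a1 a2 a3 a4 x l
    rw [Real.dist_eq] at a2
    have b1 := a1 k m x l
    set J := D.joinProb ((G N).occ x) k m l
    set W := (((G N).dispOf k).card : ℝ)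
    set V := (((G N).servOf m).card : ℝ)
    set S := ∑ i ∈ (G N).dispOf k, ∑ j ∈ ((G N).servOf m).filter (fun j => x j = l),
        (G N).assignProb D.d x i j
    have b2 : |S - W * J| ≤ θ * W := by
      have : S - W * J = ∑ i ∈ (G N).dispOf k,
          (∑ j ∈ ((G N).servOf m).filter (fun j => x j = l), (G N).assignProb D.d x i j - J) := by
        rw [Finset.sum_sub_distrib, Finset.sum_const, nsmul_eq_mul]
      rw [this]
      exact (Finset.abs_sum_le_sum_abs _ _).trans b1
    have b3 : D.lam * (S / V) - D.lam * A * J = D.lam * ((S - W * J) / V) +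
        D.lam * ((W / V - A) * J) := by field_simp; ring
    have hJ0 : 0 ≤ J := D.joinProb_nonneg ((G N).isOcc_occ x) k m l
    have hJ1 : J ≤ D.d := D.joinProb_le ((G N).isOcc_occ x) k m l
    have b4 : |(S - W * J) / V| ≤ θ * (A + 1) := by
      rw [abs_div, abs_of_pos a4, div_le_iff₀ a4]
      rw [div_lt_iff₀ a4] at a3
      nlinarith
    have b5 : |(W / V - A) * J| ≤ κ * (D.d + 1) := by
      rw [abs_mul, abs_of_nonneg hJ0]
      exact mul_le_mul a2.le (by linarith) hJ0 hκ0.le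
    have b6 : D.lam * (θ * (A + 1)) = η' / 2 := by rw [hθ]; field_simp
    have b7 : D.lam * (κ * (D.d + 1)) = η' / 2 := by rw [hκ]; field_simp
    rw [b3]
    refine (abs_add_le _ _).trans ?_
    rw [abs_mul, abs_mul, abs_of_pos hlam]
    have b8 := mul_le_mul_of_nonneg_left b4 hlam.le
    have b9 := mul_le_mul_of_nonneg_left b5 hlam.le
    linarith
  filter_upwards [eventually_all.2 hk] with N hN x l
  have h1 : (G N).levelRate D.d D.lam x m l = ∑ k, D.lam *
      ((∑ i ∈ (G N).dispOf k, ∑ j ∈ ((G N).servOf m).filter (fun j => x j = l),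
        (G N).assignProb D.d x i j) / ((G N).servOf m).card) := by
    rw [System.levelRate, ← Finset.mul_sum, ← Finset.sum_div, ← mul_div_assoc]
    congr 1
    simp only [System.arrivalRate]
    rw [Finset.sum_comm]
    simp only [← Finset.mul_sum]
    congr 1
    exact (Finset.sum_fiberwise Finset.univ (G N).dispType _).symm
  rw [h1, LimitData.arrDrift_eq, ← Finset.sum_sub_distrib]
  refine (Finset.abs_sum_le_sum_abs _ _).trans
    ((Finset.sum_le_sum fun k _ => hN k x l).trans ?_)
  rw [Finset.sum_const, nsmul_eq_mul, hη']
  simp only [Finset.card_univ, Fintype.card_fin]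
  rw [← mul_div_assoc, div_le_iff₀ (by positivity)]
  nlinarith

theorem tendsto_sum_u_div : Tendsto (fun N : ℕ => (∑ j, D.u ((G N).servType j)) / (N : ℝ)) atTop
    (𝓝 (∑ m, D.u m * D.v m)) := by
  refine (tendsto_finsetSum Finset.univ fun m _ => (R.servOf m).const_mul (D.u m)).congr
    fun N => ?_
  rw [← Finset.sum_fiberwise Finset.univ (G N).servType, Finset.sum_div]
  refine Finset.sum_congr rfl fun m _ => ?_
  have : ∀ j ∈ Finset.univ.filter (fun j => (G N).servType j = m),
      D.u ((G N).servType j) = D.u m := fun j hj => by rw [(Finset.mem_filter.1 hj).2]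
  rw [Finset.sum_congr rfl this, Finset.sum_const, nsmul_eq_mul, System.servOf]
  ring

/-- The total rate of transitions is of order `N`, the squares of the jumps of the occupancy are of
order `1 / N ^ 2`. -/
theorem tendsto_rate_div (m : Fin M) : Tendsto (fun N : ℕ =>
    (D.lam * (G N).numDisp + ∑ j, D.u ((G N).servType j)) *
      (1 / (((G N).servOf m).card : ℝ)) ^ 2) atTop (𝓝 0) := by
  have h1 := (R.numDisp.const_mul D.lam).add R.tendsto_sum_u_div
  have h2 : Tendsto (fun N : ℕ => 1 / (((G N).servOf m).card : ℝ)) atTop (𝓝 0) := by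
    simp only [one_div]
    exact (R.tendsto_servOf m).inv_tendsto_atTop
  have h3 := (h1.mul ((R.servOf m).inv₀ (D.v_pos m).ne')).mul h2
  rw [mul_zero] at h3
  refine h3.congr' ?_
  filter_upwards [eventually_gt_atTop 0, (R.tendsto_servOf m).eventually_gt_atTop 0] with N hN hV
  have : (N : ℝ) ≠ 0 := by positivity
  field_simp

/-- On functions of the occupancy that depend on finitely many levels the generator converges to
the derivative along the limiting drift, uniformly in the state and over functions with the same
bounds. -/
theorem eventually_generator (L : ℕ) (B C : ℝ) {η : ℝ} (hη : 0 < η) : ∀ᶠ N in atTop,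
    ∀ (f : (Fin M × ℕ → ℝ) → ℝ) (g : Fin M → ℕ → (Fin M × ℕ → ℝ) → ℝ),
    (∀ q m l h, |f (Function.update q (m, l + 1) (q (m, l + 1) + h)) - f q - h * g m l q| ≤
      C * h ^ 2) → (∀ m l q, L ≤ l → g m l q = 0) → (∀ m l q, IsOcc q → |g m l q| ≤ B) → ∀ x,
    |(G N).generator D.d D.lam D.u (fun x => f ((G N).occ x)) x -
      ∑ m, ∑ l ∈ Finset.range L, D.drift ((G N).occ x) m l * g m l ((G N).occ x)| ≤ η := by
  set κ := η / 2 / (M * L * |B| + 1) with hκ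
  have hκ0 : 0 < κ := by positivity
  have h1 : ∀ m, ∀ᶠ N in atTop, (D.lam * (G N).numDisp + ∑ j, D.u ((G N).servType j)) *
      (1 / (((G N).servOf m).card : ℝ)) ^ 2 < η / 2 / (|C| + 1) := fun m =>
    (R.tendsto_rate_div m).eventually_lt_const (by positivity)
  filter_upwards [R.eventually_levelRate hκ0, eventually_all.2 h1, R.eventually_d_le_deg,
    R.tendsto_numDisp.eventually_gt_atTop 0] with N a1 a2 a3 a4 f g hf hg hB x
  set q := (G N).occ x
  have hq : IsOcc q := (G N).isOcc_occ x
  set T := D.lam * (G N).numDisp + ∑ j, D.u ((G N).servType j) with hT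
  have hT0 : 0 < T := by
    have := D.lam_pos
    have := Finset.sum_nonneg fun (j : Fin N) (_ : j ∈ Finset.univ) =>
      (D.u_pos ((G N).servType j)).le
    positivity
  have e1 := (G N).abs_generator_occ_sub_le D.one_le_d D.lam_pos.le D.u_pos a3 hf hg
    (δ := η / 2 / T) (fun m => by
      have := (a2 m).le
      rw [le_div_iff₀ hT0]
      rw [le_div_iff₀ (by positivity)] at this
      have h2 : C ≤ |C| + 1 := by linarith [le_abs_self C]
      have h3 : 0 ≤ (1 / (((G N).servOf m).card : ℝ)) ^ 2 * T := by positivity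
      nlinarith) x
  rw [← hT, mul_div_cancel₀ _ hT0.ne'] at e1
  have e2 : |∑ m, ∑ l ∈ Finset.range L, (-D.u m * (q (m, l + 1) - q (m, l + 2)) +
        (G N).levelRate D.d D.lam x m l) * g m l q -
      ∑ m, ∑ l ∈ Finset.range L, D.drift q m l * g m l q| ≤ η / 2 := by
    rw [← Finset.sum_sub_distrib]
    have hb : ∀ m ∈ (Finset.univ : Finset (Fin M)),
        |∑ l ∈ Finset.range L, (-D.u m * (q (m, l + 1) - q (m, l + 2)) +
          (G N).levelRate D.d D.lam x m l) * g m l q -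
          ∑ l ∈ Finset.range L, D.drift q m l * g m l q| ≤ L * (κ * |B|) := by
      intro m _
      rw [← Finset.sum_sub_distrib]
      have hc : ∀ l ∈ Finset.range L, |(-D.u m * (q (m, l + 1) - q (m, l + 2)) +
          (G N).levelRate D.d D.lam x m l) * g m l q - D.drift q m l * g m l q| ≤ κ * |B| := by
        intro l _
        rw [← sub_mul, abs_mul, LimitData.drift, add_sub_add_left_eq_sub]
        exact mul_le_mul (a1 m x l) ((hB m l q hq).trans (le_abs_self B)) (abs_nonneg _) hκ0.le
      refine (Finset.abs_sum_le_sum_abs _ _).trans ((Finset.sum_le_sum hc).trans (le_of_eq ?_))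
      simp
    refine (Finset.abs_sum_le_sum_abs _ _).trans ((Finset.sum_le_sum hb).trans ?_)
    simp only [Finset.sum_const, Finset.card_univ, Fintype.card_fin, nsmul_eq_mul]
    have : κ * (M * L * |B| + 1) = η / 2 := by rw [hκ]; field_simp
    nlinarith
  have := abs_sub_le ((G N).generator D.d D.lam D.u (fun x => f ((G N).occ x)) x)
    (∑ m, ∑ l ∈ Finset.range L, (-D.u m * (q (m, l + 1) - q (m, l + 2)) +
        (G N).levelRate D.d D.lam x m l) * g m l q)
    (∑ m, ∑ l ∈ Finset.range L, D.drift q m l * g m l q)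
  linarith

end Regime

/-! ### Contraction of the limiting system in `ℓ¹` -/

namespace LimitData
variable {K M : ℕ} (D : LimitData K M)

theorem sum_joinProb (q : Fin M × ℕ → ℝ) (k : Fin K) (l : ℕ) :
    ∑ m, D.joinProb q k m l = D.mixOcc q k l ^ D.d - D.mixOcc q k (l + 1) ^ D.d := by
  rw [← powDiff_mul]
  simp only [joinProb]
  rw [← Finset.sum_mul, mul_comm]
  congr 1
  simp only [mixOcc, mul_sub, Finset.sum_sub_distrib]

theorem mixOcc_mono {q z : Fin M × ℕ → ℝ} (hqz : ∀ e, q e ≤ z e) (k : Fin K) (l : ℕ) :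
    D.mixOcc q k l ≤ D.mixOcc z k l :=
  Finset.sum_le_sum fun m _ => mul_le_mul_of_nonneg_left (hqz _) (D.mix_nonneg k m)

/-- `joinProb` is monotone in all coordinates but the one at level `l + 1`, in which it is
Lipschitz. -/
theorem joinProb_le_add {q z : Fin M × ℕ → ℝ} (hq : IsOcc q) (hz : IsOcc z)
    (hqz : ∀ e, q e ≤ z e) (k : Fin K) (m : Fin M) (l : ℕ) :
    D.joinProb q k m l ≤
      D.joinProb z k m l + D.d * D.mix k m * (z (m, l + 1) - q (m, l + 1)) := by
  have hκ := D.mix_nonneg k m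
  have h1 := powDiff_mono D.d (D.mixOcc_nonneg hq k l) (D.mixOcc_nonneg hq k (l + 1))
    (D.mixOcc_mono hqz k l) (D.mixOcc_mono hqz k (l + 1))
  have h2 := powDiff_le D.d (D.mixOcc_nonneg hz k l) (D.mixOcc_nonneg hz k (l + 1))
    (D.mixOcc_le_one hz k l) (D.mixOcc_le_one hz k (l + 1))
  have h0 := powDiff_nonneg D.d (D.mixOcc_nonneg hz k l) (D.mixOcc_nonneg hz k (l + 1))
  set P := powDiff D.d (D.mixOcc z k l) (D.mixOcc z k (l + 1))
  have e1 : D.joinProb q k m l ≤ D.mix k m * (q (m, l) - q (m, l + 1)) * P :=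
    mul_le_mul_of_nonneg_left h1 (mul_nonneg hκ (sub_nonneg.2 (hq.anti m l)))
  have e2 : D.mix k m * (q (m, l) - z (m, l)) * P ≤ 0 :=
    mul_nonpos_of_nonpos_of_nonneg
      (mul_nonpos_of_nonneg_of_nonpos hκ (sub_nonpos.2 (hqz _))) h0
  have e3 : D.mix k m * (z (m, l + 1) - q (m, l + 1)) * P ≤
      D.mix k m * (z (m, l + 1) - q (m, l + 1)) * D.d :=
    mul_le_mul_of_nonneg_left h2 (mul_nonneg hκ (sub_nonneg.2 (hqz _)))
  have e4 : D.joinProb z k m l = D.mix k m * (z (m, l) - z (m, l + 1)) * P := rfl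
  rw [e4]
  linarith

theorem isOcc_max {q q' : Fin M × ℕ → ℝ} (hq : IsOcc q) (hq' : IsOcc q') :
    IsOcc (fun e => max (q e) (q' e)) where
  zero m := by simp [hq.zero, hq'.zero]
  nonneg m l := (hq.nonneg m l).trans (le_max_left _ _)
  anti m l := max_le_max (hq.anti m l) (hq'.anti m l)

/-- The arrivals are monotone and conservative, hence contract the `ℓ¹` distance; `s` is an
approximation of the sign of `q - q'`. The comparison with `max q q'` is the argument of Crandall
and Tartar. -/
theorem sum_mul_joinProb_sub_le {q q' : Fin M × ℕ → ℝ} (hq : IsOcc q) (hq' : IsOcc q') {ε : ℝ}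
    {s : Fin M → ℕ → ℝ} (hs : ∀ m l, |s m l| ≤ 1)
    (hε : ∀ m l, |q (m, l + 1) - q' (m, l + 1)| - s m l * (q (m, l + 1) - q' (m, l + 1)) ≤ ε)
    (k : Fin K) (L : ℕ) :
    ∑ l ∈ Finset.range L, ∑ m, s m l * (D.joinProb q k m l - D.joinProb q' k m l) ≤
      L * (2 * D.d * ε) := by
  set z : Fin M × ℕ → ℝ := fun e => max (q e) (q' e) with hz
  have hzO : IsOcc z := isOcc_max hq hq'
  have hqz : ∀ e, q e ≤ z e := fun e => le_max_left _ _
  have hqz' : ∀ e, q' e ≤ z e := fun e => le_max_right _ _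
  set Φ : ℕ → ℝ := fun l => (D.mixOcc z k l ^ D.d - D.mixOcc q k l ^ D.d) +
    (D.mixOcc z k l ^ D.d - D.mixOcc q' k l ^ D.d) with hΦ
  have hstep : ∀ l, ∑ m, s m l * (D.joinProb q k m l - D.joinProb q' k m l) ≤
      (Φ l - Φ (l + 1)) + 2 * D.d * ε := by
    intro l
    have hm : ∀ m ∈ (Finset.univ : Finset (Fin M)),
        s m l * (D.joinProb q k m l - D.joinProb q' k m l) ≤
        ((D.joinProb z k m l - D.joinProb q k m l) + (D.joinProb z k m l - D.joinProb q' k m l)) +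
          D.mix k m * (2 * D.d * ε) := by
      intro m _
      have e1 := D.joinProb_le_add hq hzO hqz k m l
      have e2 := D.joinProb_le_add hq' hzO hqz' k m l
      have hs1 := abs_le.1 (hs m l)
      have hc : 0 ≤ D.d * D.mix k m := mul_nonneg (Nat.cast_nonneg _) (D.mix_nonneg k m)
      have h1 : (1 + s m l) * (z (m, l + 1) - q (m, l + 1)) ≤ ε := by
        have := hε m l
        rcases le_total (q (m, l + 1)) (q' (m, l + 1)) with h | h
        · simp only [hz, max_eq_right h]
          rw [abs_of_nonpos (sub_nonpos.2 h)] at this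
          linarith
        · simp only [hz, max_eq_left h, sub_self, mul_zero]
          rw [abs_of_nonneg (sub_nonneg.2 h)] at this
          nlinarith
      have h2 : (1 - s m l) * (z (m, l + 1) - q' (m, l + 1)) ≤ ε := by
        have := hε m l
        rcases le_total (q (m, l + 1)) (q' (m, l + 1)) with h | h
        · simp only [hz, max_eq_right h, sub_self, mul_zero]
          rw [abs_of_nonpos (sub_nonpos.2 h)] at this
          nlinarith
        · simp only [hz, max_eq_left h]
          rw [abs_of_nonneg (sub_nonneg.2 h)] at this
          linarith
      have f1 := mul_le_mul_of_nonneg_left e1 (by linarith : 0 ≤ 1 + s m l)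
      have f2 := mul_le_mul_of_nonneg_left e2 (by linarith : 0 ≤ 1 - s m l)
      have f3 := mul_le_mul_of_nonneg_left h1 hc
      have f4 := mul_le_mul_of_nonneg_left h2 hc
      nlinarith
    refine (Finset.sum_le_sum hm).trans (le_of_eq ?_)
    simp only [Finset.sum_add_distrib, Finset.sum_sub_distrib, sum_joinProb]
    rw [← Finset.sum_mul, D.sum_mix, hΦ]
    ring
  refine (Finset.sum_le_sum fun l _ => hstep l).trans ?_
  rw [Finset.sum_add_distrib, Finset.sum_range_sub', Finset.sum_const, Finset.card_range,
    nsmul_eq_mul]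
  have h0 : Φ 0 = 0 := by
    have : ∀ y : Fin M × ℕ → ℝ, IsOcc y → D.mixOcc y k 0 = 1 := fun y hy => by
      simp [mixOcc, hy.zero, D.sum_mix]
    simp [hΦ, this _ hq, this _ hq', this _ hzO]
  have hL : 0 ≤ Φ L := add_nonneg
    (sub_nonneg.2 (pow_le_pow_left₀ (D.mixOcc_nonneg hq k L) (D.mixOcc_mono hqz k L) _))
    (sub_nonneg.2 (pow_le_pow_left₀ (D.mixOcc_nonneg hq' k L) (D.mixOcc_mono hqz' k L) _))
  linarith

/-- The weighted `ℓ¹` distance of two occupancies, truncated at level `L`, decreases along the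
limiting drift at least at the rate `∑ m, u m * v m * |q (m, 1) - q' (m, 1)|`, up to the effect of
the truncation and of the smoothing of the sign. -/
theorem sum_mul_drift_sub_le {q q' : Fin M × ℕ → ℝ} (hq : IsOcc q) (hq' : IsOcc q') {ε : ℝ}
    {s : Fin M → ℕ → ℝ} (hs : ∀ m l, |s m l| ≤ 1)
    (hε : ∀ m l, |q (m, l + 1) - q' (m, l + 1)| - s m l * (q (m, l + 1) - q' (m, l + 1)) ≤ ε)
    (L : ℕ) :
    ∑ m, ∑ l ∈ Finset.range L, (D.drift q m l - D.drift q' m l) * (D.v m * s m l) ≤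
      -(∑ m, D.u m * D.v m * |q (m, 1) - q' (m, 1)|) +
        ∑ m, D.u m * D.v m * |q (m, L + 1) - q' (m, L + 1)| +
        L * ε * (∑ m, D.u m * D.v m + 2 * D.d * (D.lam * D.ξ * ∑ k, D.w k)) := by
  set x : Fin M → ℕ → ℝ := fun m l => q (m, l) - q' (m, l) with hx
  have hsplit : ∑ m, ∑ l ∈ Finset.range L, (D.drift q m l - D.drift q' m l) * (D.v m * s m l) =
      ∑ m, D.u m * D.v m * (∑ l ∈ Finset.range L, -(s m l * (x m (l + 1) - x m (l + 2)))) +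
      D.lam * D.ξ * ∑ k, D.w k * ∑ l ∈ Finset.range L, ∑ m,
        s m l * (D.joinProb q k m l - D.joinProb q' k m l) := by
    have h1 : ∀ m l, (D.drift q m l - D.drift q' m l) * (D.v m * s m l) =
        D.u m * D.v m * -(s m l * (x m (l + 1) - x m (l + 2))) +
        ∑ k, D.lam * D.ξ * (D.w k * (s m l * (D.joinProb q k m l - D.joinProb q' k m l))) := by
      intro m l
      have a1 := D.mul_arrDrift q m l
      have a2 := D.mul_arrDrift q' m l
      have a3 : ∑ k, D.lam * D.ξ * (D.w k * (s m l *
          (D.joinProb q k m l - D.joinProb q' k m l))) =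
          s m l * (D.v m * D.arrDrift q m l - D.v m * D.arrDrift q' m l) := by
        rw [a1, a2, ← mul_sub, ← Finset.sum_sub_distrib, Finset.mul_sum, Finset.mul_sum]
        exact Finset.sum_congr rfl fun k _ => by ring
      rw [a3, drift, drift]; simp only [hx]; ring
    simp only [h1, Finset.sum_add_distrib]
    congr 1
    · simp only [Finset.mul_sum]
    · rw [Finset.sum_comm]
      simp only [Finset.mul_sum]
      rw [Finset.sum_congr rfl fun l _ => Finset.sum_comm, Finset.sum_comm]
  rw [hsplit]
  have hA : ∑ m, D.u m * D.v m * (∑ l ∈ Finset.range L, -(s m l * (x m (l + 1) - x m (l + 2)))) ≤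
      ∑ m, D.u m * D.v m * (-|x m 1| + |x m (L + 1)| + L * ε) := by
    refine Finset.sum_le_sum fun m _ => mul_le_mul_of_nonneg_left ?_
      (mul_nonneg (D.u_pos m).le (D.v_pos m).le)
    have h1 : ∀ l ∈ Finset.range L, -(s m l * (x m (l + 1) - x m (l + 2))) ≤
        (|x m (l + 1 + 1)| - |x m (l + 1)|) + ε := by
      intro l _
      have e1 := hε m l
      have e2 : s m l * x m (l + 2) ≤ |x m (l + 2)| := by
        refine (le_abs_self _).trans ?_
        rw [abs_mul]
        exact mul_le_of_le_one_left (abs_nonneg _) (hs m l)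
      simp only [hx] at e2 ⊢
      have : l + 1 + 1 = l + 2 := rfl
      rw [this]
      linarith
    refine (Finset.sum_le_sum h1).trans (le_of_eq ?_)
    rw [Finset.sum_add_distrib, Finset.sum_range_sub (fun l => |x m (l + 1)|), Finset.sum_const,
      Finset.card_range, nsmul_eq_mul]
    ring
  have hB : D.lam * D.ξ * ∑ k, D.w k * ∑ l ∈ Finset.range L, ∑ m,
        s m l * (D.joinProb q k m l - D.joinProb q' k m l) ≤
      D.lam * D.ξ * ∑ k, D.w k * (L * (2 * D.d * ε)) :=
    mul_le_mul_of_nonneg_left (Finset.sum_le_sum fun k _ => mul_le_mul_of_nonneg_left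
      (D.sum_mul_joinProb_sub_le hq hq' hs hε k L) (D.w_pos k).le)
      (mul_nonneg D.lam_pos.le D.ξ_pos.le)
  refine (add_le_add hA hB).trans (le_of_eq ?_)
  rw [← Finset.sum_mul]
  simp only [mul_add, Finset.sum_add_distrib, ← Finset.sum_mul, mul_neg, Finset.sum_neg_distrib]
  simp only [hx]
  ring

theorem abs_mixOcc_sub_le (q q' : Fin M × ℕ → ℝ) (k : Fin K) (l : ℕ) :
    |D.mixOcc q k l - D.mixOcc q' k l| ≤ ∑ m, |q (m, l) - q' (m, l)| := by
  rw [mixOcc, mixOcc, ← Finset.sum_sub_distrib]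
  refine (Finset.abs_sum_le_sum_abs _ _).trans (Finset.sum_le_sum fun m _ => ?_)
  rw [← mul_sub, abs_mul, abs_of_nonneg (D.mix_nonneg k m)]
  exact mul_le_of_le_one_left (abs_nonneg _) (D.mix_le_one k m)

theorem exists_abs_arrDrift_sub_le : ∃ C : ℝ, 0 ≤ C ∧ ∀ q q' : Fin M × ℕ → ℝ, IsOcc q → IsOcc q' →
    ∀ m l, |D.arrDrift q m l - D.arrDrift q' m l| ≤
      C * (∑ m', |q (m', l) - q' (m', l)| + ∑ m', |q (m', l + 1) - q' (m', l + 1)|) := by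
  have hnn : ∀ k m, 0 ≤ D.lam * (D.ξ * D.w k / D.v m) * ((D.d : ℝ) ^ 2 + D.d) := fun k m => by
    have := D.lam_pos
    have := D.ξ_pos
    have := D.w_pos k
    have := D.v_pos m
    positivity
  refine ⟨∑ m, ∑ k, D.lam * (D.ξ * D.w k / D.v m) * ((D.d : ℝ) ^ 2 + D.d),
    Finset.sum_nonneg fun m _ => Finset.sum_nonneg fun k _ => hnn k m, fun q q' hq hq' m l => ?_⟩
  set S := ∑ m', |q (m', l) - q' (m', l)| + ∑ m', |q (m', l + 1) - q' (m', l + 1)| with hS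
  have hS0 : 0 ≤ S := by positivity
  have hJ : ∀ k, |D.joinProb q k m l - D.joinProb q' k m l| ≤ ((D.d : ℝ) ^ 2 + D.d) * S := by
    intro k
    have h1 : |D.mix k m * (q (m, l) - q (m, l + 1))| ≤ 1 := by
      rw [abs_of_nonneg (mul_nonneg (D.mix_nonneg k m) (sub_nonneg.2 (hq.anti m l)))]
      exact mul_le_one₀ (D.mix_le_one k m) (sub_nonneg.2 (hq.anti m l))
        (by linarith [hq.le_one m l, hq.nonneg m (l + 1)])
    have h2 : |powDiff D.d (D.mixOcc q' k l) (D.mixOcc q' k (l + 1))| ≤ D.d := by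
      rw [abs_of_nonneg (powDiff_nonneg _ (D.mixOcc_nonneg hq' k l) (D.mixOcc_nonneg hq' k _))]
      exact powDiff_le D.d (D.mixOcc_nonneg hq' k l) (D.mixOcc_nonneg hq' k _)
        (D.mixOcc_le_one hq' k l) (D.mixOcc_le_one hq' k _)
    refine (abs_mul_sub_mul_le h1 h2).trans ?_
    have h3 := abs_powDiff_sub_le D.d (D.mixOcc_nonneg hq k l) (D.mixOcc_nonneg hq k (l + 1))
      (D.mixOcc_le_one hq k l) (D.mixOcc_le_one hq k (l + 1)) (D.mixOcc_nonneg hq' k l)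
      (D.mixOcc_nonneg hq' k (l + 1)) (D.mixOcc_le_one hq' k l) (D.mixOcc_le_one hq' k (l + 1))
    have h4 := D.abs_mixOcc_sub_le q q' k l
    have h5 := D.abs_mixOcc_sub_le q q' k (l + 1)
    have h6 : |D.mix k m * (q (m, l) - q (m, l + 1)) - D.mix k m * (q' (m, l) - q' (m, l + 1))| ≤
        S := by
      rw [← mul_sub, abs_mul, abs_of_nonneg (D.mix_nonneg k m)]
      refine (mul_le_of_le_one_left (abs_nonneg _) (D.mix_le_one k m)).trans ?_
      have e1 : |q (m, l) - q' (m, l)| ≤ ∑ m', |q (m', l) - q' (m', l)| :=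
        Finset.single_le_sum (f := fun m' => |q (m', l) - q' (m', l)|)
          (fun _ _ => abs_nonneg _) (Finset.mem_univ m)
      have e2 : |q (m, l + 1) - q' (m, l + 1)| ≤ ∑ m', |q (m', l + 1) - q' (m', l + 1)| :=
        Finset.single_le_sum (f := fun m' => |q (m', l + 1) - q' (m', l + 1)|)
          (fun _ _ => abs_nonneg _) (Finset.mem_univ m)
      have e3 : q (m, l) - q (m, l + 1) - (q' (m, l) - q' (m, l + 1)) =
          (q (m, l) - q' (m, l)) - (q (m, l + 1) - q' (m, l + 1)) := by ring
      rw [e3]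
      exact (abs_sub _ _).trans (add_le_add e1 e2)
    have h7 : (D.d : ℝ) ^ 2 * (|D.mixOcc q k l - D.mixOcc q' k l| +
        |D.mixOcc q k (l + 1) - D.mixOcc q' k (l + 1)|) ≤ (D.d : ℝ) ^ 2 * S := by
      gcongr
      linarith
    have h8 := mul_le_mul_of_nonneg_left h6 (Nat.cast_nonneg (α := ℝ) D.d)
    linarith
  rw [arrDrift_eq, arrDrift_eq, ← Finset.sum_sub_distrib]
  refine (Finset.abs_sum_le_sum_abs _ _).trans ?_
  refine le_trans (b := (∑ k, D.lam * (D.ξ * D.w k / D.v m) * ((D.d : ℝ) ^ 2 + D.d)) * S) ?_ ?_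
  · rw [Finset.sum_mul]
    refine Finset.sum_le_sum fun k _ => ?_
    have hc : 0 ≤ D.lam * (D.ξ * D.w k / D.v m) :=
      mul_nonneg D.lam_pos.le (div_nonneg (mul_nonneg D.ξ_pos.le (D.w_pos k).le) (D.v_pos m).le)
    rw [← mul_sub, abs_mul, abs_of_nonneg hc]
    exact (mul_le_mul_of_nonneg_left (hJ k) hc).trans (le_of_eq (by ring))
  · refine mul_le_mul_of_nonneg_right ?_ hS0
    exact Finset.single_le_sum
      (f := fun m => ∑ k, D.lam * (D.ξ * D.w k / D.v m) * ((D.d : ℝ) ^ 2 + D.d))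
      (fun m _ => Finset.sum_nonneg fun k _ => hnn k m) (Finset.mem_univ m)

theorem exists_abs_drift_le : ∃ C : ℝ, 0 ≤ C ∧ ∀ q : Fin M × ℕ → ℝ, IsOcc q →
    ∀ m l, |D.drift q m l| ≤ C := by
  have hnn : ∀ m, 0 ≤ D.u m + ∑ k, D.lam * (D.ξ * D.w k / D.v m) * D.d := fun m =>
    add_nonneg (D.u_pos m).le (Finset.sum_nonneg fun k _ => by
      have := D.lam_pos
      have := D.ξ_pos
      have := D.w_pos k
      have := D.v_pos m
      positivity)
  refine ⟨∑ m, (D.u m + ∑ k, D.lam * (D.ξ * D.w k / D.v m) * D.d),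
    Finset.sum_nonneg fun m _ => hnn m, fun q hq m l => ?_⟩
  refine le_trans ?_ (Finset.single_le_sum (fun m _ => hnn m) (Finset.mem_univ m))
  rw [drift, arrDrift_eq]
  refine (abs_add_le _ _).trans (add_le_add ?_ ((Finset.abs_sum_le_sum_abs _ _).trans
    (Finset.sum_le_sum fun k _ => ?_)))
  · rw [abs_mul, abs_neg, abs_of_pos (D.u_pos m)]
    refine mul_le_of_le_one_right (D.u_pos m).le ?_
    rw [abs_of_nonneg (sub_nonneg.2 (hq.anti m (l + 1)))]
    linarith [hq.le_one m (l + 1), hq.nonneg m (l + 2)]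
  · have hc : 0 ≤ D.lam * (D.ξ * D.w k / D.v m) :=
      mul_nonneg D.lam_pos.le (div_nonneg (mul_nonneg D.ξ_pos.le (D.w_pos k).le) (D.v_pos m).le)
    rw [abs_mul, abs_of_nonneg hc, abs_of_nonneg (D.joinProb_nonneg hq k m l)]
    exact mul_le_mul_of_nonneg_left (D.joinProb_le hq k m l) hc

/-- The right-hand side of the limiting system, with the quotient replaced by the polynomial
`powDiff`. -/
theorem odeDrift_eq (q : OccSpace M) (m : Fin M) (l : ℕ) :
    odeDrift D.d D.lam D.ξ D.w D.v D.u D.p q m (l + 1) = D.drift (fun e => q.1 e) m l := by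
  have hq := q.isOcc
  simp only [odeDrift, drift, arrDrift, Nat.add_sub_cancel]
  congr 1
  simp only [Finset.mul_sum]
  refine Finset.sum_congr rfl fun k _ => ?_
  have h1 : ∀ l, qTilde D.p D.v q k l = D.mixOcc (fun e => q.1 e) k l := fun l => rfl
  rw [h1, h1, ← powDiff_mul]
  by_cases h : D.mixOcc (fun e => q.1 e) k l - D.mixOcc (fun e => q.1 e) k (l + 1) = 0
  · -- all the increments seen by type `k` vanish
    have h2 : ∑ m, D.mix k m * (q.1 (m, l) - q.1 (m, l + 1)) = 0 := by
      rw [← h]; simp only [mixOcc, mul_sub, Finset.sum_sub_distrib]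
    have h3 := (Finset.sum_eq_zero_iff_of_nonneg fun m _ =>
      mul_nonneg (D.mix_nonneg k m) (sub_nonneg.2 (hq.anti m l))).1 h2 m (Finset.mem_univ m)
    have h4 : D.p k m * (q.1 (m, l) - q.1 (m, l + 1)) = 0 := by
      rcases mul_eq_zero.1 h3 with h5 | h5
      · rw [mix, div_eq_zero_iff, or_iff_left (D.limDeg_pos k).ne', mul_eq_zero,
          or_iff_right (D.v_pos m).ne'] at h5
        rw [h5, zero_mul]
      · rw [h5, mul_zero]
    have h6 : ∀ y, D.lam * D.ξ * (q.1 (m, l) - q.1 (m, l + 1)) *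
        (D.p k m * D.w k / limDeg D.p D.v k * y) =
        D.lam * D.ξ * (D.w k / limDeg D.p D.v k * y) *
          (D.p k m * (q.1 (m, l) - q.1 (m, l + 1))) := fun y => by ring
    rw [h6, h6, h4, mul_zero, mul_zero]
  · rw [mul_div_cancel_right₀ _ h]

theorem isFixedPoint_iff (q : OccSpace M) :
    IsFixedPoint D.d D.lam D.ξ D.w D.v D.u D.p q ↔ ∀ m l, D.drift (fun e => q.1 e) m l = 0 := by
  constructor
  · intro h m l
    rw [← odeDrift_eq]
    exact h m (l + 1) (by omega)
  · intro h m l hl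
    obtain ⟨l, rfl⟩ := Nat.exists_eq_succ_of_ne_zero (by omega : l ≠ 0)
    rw [Nat.succ_eq_add_one, odeDrift_eq]
    exact h m l

/-- Two fixed points agree at level `1` by the contraction, and then at all levels since the
equation at level `l` determines level `l + 1`. -/
theorem fixedPoint_unique {q q' : OccSpace M} (h : ∀ m l, D.drift (fun e => q.1 e) m l = 0)
    (h' : ∀ m l, D.drift (fun e => q'.1 e) m l = 0) : q = q' := by
  have hq := q.isOcc
  have hq' := q'.isOcc
  have huv : ∀ m, 0 < D.u m * D.v m := fun m => mul_pos (D.u_pos m) (D.v_pos m)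
  have hcon : ∀ L : ℕ, ∑ m, D.u m * D.v m * |q.1 (m, 1) - q'.1 (m, 1)| ≤
      ∑ m, D.u m * D.v m * |q.1 (m, L + 1) - q'.1 (m, L + 1)| := by
    intro L
    have := D.sum_mul_drift_sub_le hq hq' (ε := 0)
      (s := fun m l => (SignType.sign (q.1 (m, l + 1) - q'.1 (m, l + 1)) : ℝ))
      (fun m l => by
        rcases lt_trichotomy (q.1 (m, l + 1) - q'.1 (m, l + 1)) 0 with h | h | h <;> simp [h])
      (fun m l => by rw [sign_mul_self]; simp) L
    simp only [h, h', sub_self, zero_mul, Finset.sum_const_zero, mul_zero, add_zero] at this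
    linarith
  have hlim : ∀ (y : OccSpace M) m, Tendsto (fun L => y.1 (m, L + 1)) atTop (𝓝 0) := by
    intro y m
    have h1 : Summable fun e : Fin M × ℕ => ‖y.1 e‖ := by
      have := lp.memℓp y.1
      rw [memℓp_gen_iff (by simp)] at this
      simpa using this
    have h2 : Summable fun l : ℕ => ‖y.1 (m, l + 1)‖ := h1.comp_injective
      (i := fun l : ℕ => (m, l + 1)) fun a b h => by simpa using h
    exact h2.of_norm.tendsto_atTop_zero
  have h1 : ∀ m, q.1 (m, 1) = q'.1 (m, 1) := by
    have hle : ∑ m, D.u m * D.v m * |q.1 (m, 1) - q'.1 (m, 1)| ≤ 0 := by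
      have ht : Tendsto (fun L => ∑ m, D.u m * D.v m * |q.1 (m, L + 1) - q'.1 (m, L + 1)|) atTop
          (𝓝 (∑ m, D.u m * D.v m * |(0 : ℝ) - 0|)) :=
        tendsto_finsetSum _ fun m _ => (((hlim q m).sub (hlim q' m)).abs).const_mul _
      simp only [sub_self, abs_zero, mul_zero, Finset.sum_const_zero] at ht
      exact ge_of_tendsto' ht hcon
    have hnn : ∀ m ∈ (Finset.univ : Finset (Fin M)),
        0 ≤ D.u m * D.v m * |q.1 (m, 1) - q'.1 (m, 1)| :=
      fun m _ => mul_nonneg (huv m).le (abs_nonneg _)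
    intro m
    have := (Finset.sum_eq_zero_iff_of_nonneg hnn).1
      (le_antisymm hle (Finset.sum_nonneg hnn)) m (Finset.mem_univ m)
    rw [mul_eq_zero, or_iff_right (huv m).ne', abs_eq_zero, sub_eq_zero] at this
    exact this
  have hall : ∀ l, (∀ m, q.1 (m, l) = q'.1 (m, l)) ∧ ∀ m, q.1 (m, l + 1) = q'.1 (m, l + 1) := by
    intro l
    induction l with
    | zero => exact ⟨fun m => by rw [hq.zero m, hq'.zero m], h1⟩
    | succ l ih =>
      refine ⟨ih.2, fun m => ?_⟩
      obtain ⟨C, _, hC⟩ := D.exists_abs_arrDrift_sub_le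
      have e1 := hC _ _ hq hq' m l
      simp only [ih.1, ih.2, sub_self, abs_zero, Finset.sum_const_zero, add_zero, mul_zero] at e1
      have e2 := abs_eq_zero.1 (le_antisymm e1 (abs_nonneg _))
      have e3 := h m l
      have e4 := h' m l
      simp only [drift] at e3 e4
      rw [ih.2 m] at e3
      have e5 : D.u m * (q.1 (m, l + 2) - q'.1 (m, l + 2)) = 0 := by linarith
      rw [mul_eq_zero, or_iff_right (D.u_pos m).ne', sub_eq_zero] at e5
      exact e5
  apply Subtype.ext
  apply lp.ext
  ext ⟨m, l⟩
  exact (hall l).1 m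

end LimitData

/-! ### A smooth approximation of the absolute value -/

/-- A smooth approximation of the absolute value. -/
noncomputable def softAbs (ε x : ℝ) : ℝ := √(x ^ 2 + ε ^ 2)

/-- The derivative of `softAbs`, an approximation of the sign. -/
noncomputable def softSign (ε x : ℝ) : ℝ := x / softAbs ε x

theorem softAbs_sq (ε x : ℝ) : softAbs ε x ^ 2 = x ^ 2 + ε ^ 2 :=
  Real.sq_sqrt (by positivity)

theorem le_softAbs {ε : ℝ} (hε : 0 < ε) (x : ℝ) : ε ≤ softAbs ε x :=
  Real.le_sqrt_of_sq_le (by nlinarith [sq_nonneg x])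

theorem abs_le_softAbs (ε x : ℝ) : |x| ≤ softAbs ε x :=
  Real.abs_le_sqrt (by nlinarith [sq_nonneg ε])

theorem softAbs_le {ε : ℝ} (hε : 0 < ε) (x : ℝ) : softAbs ε x ≤ |x| + ε := by
  refine Real.sqrt_le_iff.2 ⟨add_nonneg (abs_nonneg x) hε.le, ?_⟩
  nlinarith [sq_abs x, abs_nonneg x]

theorem abs_softSign_le {ε : ℝ} (hε : 0 < ε) (x : ℝ) : |softSign ε x| ≤ 1 := by
  have h : 0 < softAbs ε x := hε.trans_le (le_softAbs hε x)
  rw [softSign, abs_div, abs_of_pos h, div_le_one h]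
  exact abs_le_softAbs ε x

theorem softSign_neg (ε x : ℝ) : softSign ε (-x) = -softSign ε x := by
  simp [softSign, softAbs, neg_div]

theorem abs_sub_softSign_mul_le {ε : ℝ} (hε : 0 < ε) (x : ℝ) : |x| - softSign ε x * x ≤ ε := by
  have h : 0 < softAbs ε x := hε.trans_le (le_softAbs hε x)
  have h1 := abs_le_softAbs ε x
  have h2 := softAbs_le hε x
  have h3 : softSign ε x * x = |x| * |x| / softAbs ε x := by
    rw [softSign, abs_mul_abs_self]; ring
  rw [h3, sub_le_iff_le_add, ← sub_le_iff_le_add', le_div_iff₀ h]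
  nlinarith [abs_nonneg x]

theorem abs_softAbs_add_sub_le {ε : ℝ} (hε : 0 < ε) (x h : ℝ) :
    |softAbs ε (x + h) - softAbs ε x - h * softSign ε x| ≤ 1 / ε * h ^ 2 := by
  have hpos : 0 < softAbs ε x := hε.trans_le (le_softAbs hε x)
  have hpos' : 0 < softAbs ε (x + h) := hε.trans_le (le_softAbs hε (x + h))
  have hle := le_softAbs hε x
  have s1 := softAbs_sq ε x
  have s2 := softAbs_sq ε (x + h)
  set a := softAbs ε x
  set b := softAbs ε (x + h)
  -- `a * (b - a - h * x / a)` lies between `0` and `h ^ 2`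
  have hab : 0 ≤ a * b - a ^ 2 - h * x := by
    have h1 : (x * (x + h) + ε ^ 2) ≤ a * b := by
      refine (le_abs_self _).trans (abs_le_of_sq_le_sq ?_ (by positivity))
      rw [mul_pow, s1, s2]
      nlinarith [sq_nonneg (ε * h)]
    nlinarith
  have hab2 : a * b - a ^ 2 - h * x ≤ h ^ 2 := by
    nlinarith [sq_nonneg (a - b)]
  have hdiv : b - a - h * softSign ε x = (a * b - a ^ 2 - h * x) / a := by
    rw [softSign]
    change b - a - h * (x / a) = _
    field_simp
  rw [hdiv, abs_of_nonneg (div_nonneg hab hpos.le), div_le_iff₀ hpos]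
  have h3 : 1 / ε * h ^ 2 * a = h ^ 2 * (a / ε) := by ring
  have h4 : 1 ≤ a / ε := (one_le_div hε).2 hle
  rw [h3]
  nlinarith [sq_nonneg h]

/-- The truncated weighted `ℓ¹` distance to `y`, smoothed, as a test function. -/
theorem softAbs_test {K M : ℕ} (D : LimitData K M) {ε : ℝ} (hε : 0 < ε) (L : ℕ)
    (y q : Fin M × ℕ → ℝ) (m : Fin M) (l : ℕ) (h : ℝ) :
    |∑ e ∈ Finset.univ ×ˢ Finset.range L, D.v e.1 * softAbs ε
        (Function.update q (m, l + 1) (q (m, l + 1) + h) (e.1, e.2 + 1) - y (e.1, e.2 + 1)) -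
      ∑ e ∈ Finset.univ ×ˢ Finset.range L, D.v e.1 * softAbs ε
        (q (e.1, e.2 + 1) - y (e.1, e.2 + 1)) -
      h * (if l < L then D.v m * softSign ε (q (m, l + 1) - y (m, l + 1)) else 0)| ≤
      (∑ m, D.v m) * (1 / ε) * h ^ 2 := by
  have hV : D.v m ≤ ∑ m, D.v m := Finset.single_le_sum (fun m _ => (D.v_pos m).le)
    (Finset.mem_univ m)
  have hV0 : 0 ≤ ∑ m, D.v m := (D.v_pos m).le.trans hV
  rw [← Finset.sum_sub_distrib]
  have hzero : ∀ e : Fin M × ℕ, e ≠ (m, l) → D.v e.1 * softAbs ε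
        (Function.update q (m, l + 1) (q (m, l + 1) + h) (e.1, e.2 + 1) - y (e.1, e.2 + 1)) -
        D.v e.1 * softAbs ε (q (e.1, e.2 + 1) - y (e.1, e.2 + 1)) = 0 := by
    intro e he
    rw [Function.update_of_ne, sub_self]
    intro h'
    obtain ⟨h1, h2⟩ := Prod.mk.inj h'
    exact he (Prod.ext h1 (by simpa using h2))
  split_ifs with hl
  · rw [Finset.sum_eq_single_of_mem (m, l) (by simp [hl]) fun e _ he => hzero e he]
    simp only [Function.update_self]
    have h1 := abs_softAbs_add_sub_le hε (q (m, l + 1) - y (m, l + 1)) h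
    have h2 : q (m, l + 1) + h - y (m, l + 1) = q (m, l + 1) - y (m, l + 1) + h := by ring
    have h3 : ∀ a b c : ℝ, D.v m * a - D.v m * b - h * (D.v m * c) = D.v m * (a - b - h * c) :=
      fun a b c => by ring
    rw [h2, h3, abs_mul, abs_of_pos (D.v_pos m), mul_assoc]
    exact mul_le_mul hV h1 (abs_nonneg _) hV0
  · rw [Finset.sum_eq_zero, mul_zero, sub_zero, abs_zero]
    · positivity
    · intro e he
      refine hzero e fun h' => hl ?_
      rw [h'] at he
      simpa using he

/-! ### Two independent stationary systems -/

/-- The function `F` is bounded on pairs of occupancies. -/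
def OccBdd {M : ℕ} (F : (Fin M × ℕ → ℝ) → (Fin M × ℕ → ℝ) → ℝ) : Prop :=
  ∃ B, ∀ q q', IsOcc q → IsOcc q' → |F q q'| ≤ B

namespace OccBdd
variable {M : ℕ} {F F' : (Fin M × ℕ → ℝ) → (Fin M × ℕ → ℝ) → ℝ}

theorem add (h : OccBdd F) (h' : OccBdd F') : OccBdd (fun q q' => F q q' + F' q q') := by
  obtain ⟨B, hB⟩ := h
  obtain ⟨B', hB'⟩ := h'
  exact ⟨B + B', fun q q' hq hq' =>
    (abs_add_le _ _).trans (add_le_add (hB q q' hq hq') (hB' q q' hq hq'))⟩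

theorem const (c : ℝ) : OccBdd (fun (_ _ : Fin M × ℕ → ℝ) => c) := ⟨|c|, fun _ _ _ _ => le_rfl⟩

theorem mul (h : OccBdd F) (h' : OccBdd F') : OccBdd (fun q q' => F q q' * F' q q') := by
  obtain ⟨B, hB⟩ := h
  obtain ⟨B', hB'⟩ := h'
  refine ⟨B * B', fun q q' hq hq' => ?_⟩
  rw [abs_mul]
  exact mul_le_mul (hB q q' hq hq') (hB' q q' hq hq') (abs_nonneg _)
    ((abs_nonneg _).trans (hB q q' hq hq'))

theorem sub (h : OccBdd F) (h' : OccBdd F') : OccBdd (fun q q' => F q q' - F' q q') := by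
  obtain ⟨B, hB⟩ := h
  obtain ⟨B', hB'⟩ := h'
  exact ⟨B + B', fun q q' hq hq' =>
    (abs_sub _ _).trans (add_le_add (hB q q' hq hq') (hB' q q' hq hq'))⟩

theorem abs (h : OccBdd F) : OccBdd (fun q q' => |F q q'|) := by
  obtain ⟨B, hB⟩ := h
  exact ⟨B, fun q q' hq hq' => by rw [abs_abs]; exact hB q q' hq hq'⟩

theorem sum {ι : Type*} (s : Finset ι) {F : ι → (Fin M × ℕ → ℝ) → (Fin M × ℕ → ℝ) → ℝ}
    (h : ∀ i, OccBdd (F i)) : OccBdd (fun q q' => ∑ i ∈ s, F i q q') := by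
  choose B hB using h
  exact ⟨∑ i ∈ s, B i, fun q q' hq hq' =>
    (Finset.abs_sum_le_sum_abs _ _).trans (Finset.sum_le_sum fun i _ => hB i q q' hq hq')⟩

theorem swap (h : OccBdd F) : OccBdd (fun q q' => F q' q) := by
  obtain ⟨B, hB⟩ := h
  exact ⟨B, fun q q' hq hq' => hB q' q hq' hq⟩

theorem fst (e : Fin M × ℕ) : OccBdd (fun (q _ : Fin M × ℕ → ℝ) => q e) :=
  ⟨1, fun q _ hq _ => by rw [abs_of_nonneg (hq.nonneg e.1 e.2)]; exact hq.le_one e.1 e.2⟩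

theorem snd (e : Fin M × ℕ) : OccBdd (fun (_ q' : Fin M × ℕ → ℝ) => q' e) := (fst e).swap

theorem drift {K : ℕ} (D : LimitData K M) (m : Fin M) (l : ℕ) :
    OccBdd (fun q _ => D.drift q m l) := by
  obtain ⟨C, _, hC⟩ := D.exists_abs_drift_le
  exact ⟨C, fun q _ hq _ => hC q hq m l⟩

end OccBdd

section pairs
variable {K M : ℕ} {D : LimitData K M} {G : ∀ N : ℕ, System K M N}
  (π : ∀ N : ℕ, ProbabilityMeasure (Fin N → ℕ))

variable (G) in
/-- The mean of a function of the occupancies of two independent systems with `z.1` and `z.2`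
servers whose states have the laws `π z.1` and `π z.2`. -/
noncomputable def pairMean (F : (Fin M × ℕ → ℝ) → (Fin M × ℕ → ℝ) → ℝ) (z : ℕ × ℕ) : ℝ :=
  ∫ s : (Fin z.1 → ℕ) × (Fin z.2 → ℕ), F ((G z.1).occ s.1) ((G z.2).occ s.2)
    ∂((π z.1 : Measure (Fin z.1 → ℕ)).prod (π z.2 : Measure (Fin z.2 → ℕ)))

theorem OccBdd.integrable {F : (Fin M × ℕ → ℝ) → (Fin M × ℕ → ℝ) → ℝ} (h : OccBdd F) (z : ℕ × ℕ) :
    Integrable (fun s : (Fin z.1 → ℕ) × (Fin z.2 → ℕ) =>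
      F ((G z.1).occ s.1) ((G z.2).occ s.2))
      ((π z.1 : Measure (Fin z.1 → ℕ)).prod (π z.2 : Measure (Fin z.2 → ℕ))) := by
  obtain ⟨B, hB⟩ := h
  exact JumpChain.integrable_of_abs_le fun s => hB _ _ ((G z.1).isOcc_occ _) ((G z.2).isOcc_occ _)

theorem pairMean_mono {F F' : (Fin M × ℕ → ℝ) → (Fin M × ℕ → ℝ) → ℝ} (h : OccBdd F)
    (h' : OccBdd F') (hle : ∀ q q', IsOcc q → IsOcc q' → F q q' ≤ F' q q') (z : ℕ × ℕ) :
    pairMean G π F z ≤ pairMean G π F' z :=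
  integral_mono (h.integrable π z) (h'.integrable π z) fun _ =>
    hle _ _ ((G z.1).isOcc_occ _) ((G z.2).isOcc_occ _)

theorem pairMean_add {F F' : (Fin M × ℕ → ℝ) → (Fin M × ℕ → ℝ) → ℝ} (h : OccBdd F)
    (h' : OccBdd F') (z : ℕ × ℕ) :
    pairMean G π (fun q q' => F q q' + F' q q') z = pairMean G π F z + pairMean G π F' z :=
  integral_add (h.integrable π z) (h'.integrable π z)

theorem pairMean_const_mul (c : ℝ) (F : (Fin M × ℕ → ℝ) → (Fin M × ℕ → ℝ) → ℝ) (z : ℕ × ℕ) :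
    pairMean G π (fun q q' => c * F q q') z = c * pairMean G π F z :=
  integral_const_mul c _

theorem pairMean_const (c : ℝ) (z : ℕ × ℕ) : pairMean G π (fun _ _ => c) z = c := by
  simp [pairMean]

theorem pairMean_sum {ι : Type*} (s : Finset ι)
    {F : ι → (Fin M × ℕ → ℝ) → (Fin M × ℕ → ℝ) → ℝ} (h : ∀ i, OccBdd (F i)) (z : ℕ × ℕ) :
    pairMean G π (fun q q' => ∑ i ∈ s, F i q q') z = ∑ i ∈ s, pairMean G π (F i) z :=
  integral_finsetSum s fun i _ => (h i).integrable π z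

theorem pairMean_nonneg {F : (Fin M × ℕ → ℝ) → (Fin M × ℕ → ℝ) → ℝ}
    (h : ∀ q q', 0 ≤ F q q') (z : ℕ × ℕ) : 0 ≤ pairMean G π F z :=
  integral_nonneg fun _ => h _ _

theorem pairMean_swap {F : (Fin M × ℕ → ℝ) → (Fin M × ℕ → ℝ) → ℝ} (z : ℕ × ℕ) :
    pairMean G π F z = pairMean G π (fun q q' => F q' q) z.swap :=
  (integral_prod_swap (μ := (π z.1 : Measure (Fin z.1 → ℕ)))
    (ν := (π z.2 : Measure (Fin z.2 → ℕ)))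
    (fun s => F ((G z.1).occ s.1) ((G z.2).occ s.2))).symm

theorem pairMean_fst (F : (Fin M × ℕ → ℝ) → ℝ) (z : ℕ × ℕ) :
    pairMean G π (fun q _ => F q) z =
      ∫ x, F ((G z.1).occ x) ∂(π z.1 : Measure (Fin z.1 → ℕ)) := by
  rw [pairMean, integral_fun_fst (fun x => F ((G z.1).occ x))]
  simp

variable {π}

/-- Stationarity tested on a function of the occupancy that depends on finitely many levels. -/
theorem Regime.eventually_integral (R : Regime D G) (L : ℕ) (B C : ℝ) {η : ℝ} (hη : 0 < η) :
    ∀ᶠ N in atTop, ∀ π : ProbabilityMeasure (Fin N → ℕ), (G N).IsStationary D.d D.lam D.u π →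
    ∀ (f : (Fin M × ℕ → ℝ) → ℝ) (g : Fin M → ℕ → (Fin M × ℕ → ℝ) → ℝ),
    (∀ q m l h, |f (Function.update q (m, l + 1) (q (m, l + 1) + h)) - f q - h * g m l q| ≤
      C * h ^ 2) → (∀ m l q, L ≤ l → g m l q = 0) → (∀ m l q, IsOcc q → |g m l q| ≤ B) →
    (∃ B', ∀ q, IsOcc q → |f q| ≤ B') →
    |∫ x, ∑ m, ∑ l ∈ Finset.range L, D.drift ((G N).occ x) m l * g m l ((G N).occ x)
      ∂(π : Measure (Fin N → ℕ))| ≤ η := by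
  filter_upwards [R.eventually_generator L B C hη] with N hN π hπ f g hf hg hB hfb
  set H : (Fin N → ℕ) → ℝ := fun x =>
    ∑ m, ∑ l ∈ Finset.range L, D.drift ((G N).occ x) m l * g m l ((G N).occ x) with hH
  have h1 := hN f g hf hg hB
  obtain ⟨C2, _, hC2⟩ := D.exists_abs_drift_le
  have hHb : ∀ x, |H x| ≤ ∑ _m : Fin M, ∑ _l ∈ Finset.range L, C2 * B := fun x => by
    refine (Finset.abs_sum_le_sum_abs _ _).trans (Finset.sum_le_sum fun m _ => ?_)
    refine (Finset.abs_sum_le_sum_abs _ _).trans (Finset.sum_le_sum fun l _ => ?_)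
    have hq := (G N).isOcc_occ x
    rw [abs_mul]
    exact mul_le_mul (hC2 _ hq m l) (hB m l _ hq) (abs_nonneg _)
      ((abs_nonneg _).trans (hC2 _ hq m l))
  have hHi : Integrable H (π : Measure (Fin N → ℕ)) := JumpChain.integrable_of_abs_le hHb
  have hGi : Integrable ((G N).generator D.d D.lam D.u (fun x => f ((G N).occ x)))
      (π : Measure (Fin N → ℕ)) := by
    refine JumpChain.integrable_of_abs_le (B := η + ∑ _m : Fin M, ∑ _l ∈ Finset.range L, C2 * B) fun x => ?_
    have e1 := abs_le.1 (h1 x)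
    have e2 := abs_le.1 (hHb x)
    rw [abs_le]
    constructor <;> linarith [e1.1, e1.2, e2.1, e2.2]
  have hG0 : ∫ x, (G N).generator D.d D.lam D.u (fun x => f ((G N).occ x)) x
      ∂(π : Measure (Fin N → ℕ)) = 0 := by
    obtain ⟨B', hB'⟩ := hfb
    exact hπ.integral_generator ⟨B', fun x => hB' _ ((G N).isOcc_occ x)⟩
  have h2 := integral_sub hGi hHi
  rw [hG0, zero_sub] at h2
  have h3 := norm_integral_le_of_norm_le_const (μ := (π : Measure (Fin N → ℕ)))
    (f := fun x => (G N).generator D.d D.lam D.u (fun x => f ((G N).occ x)) x - H x)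
    (Eventually.of_forall h1)
  rw [h2] at h3
  simpa using h3

/-- Stationarity of the first of two independent systems, tested on functions `f y` of its occupancy
that depend on the occupancy `y` of the second one. -/
theorem Regime.tendsto_pairMean_drift (R : Regime D G)
    (hπ : ∀ᶠ N in atTop, (G N).IsStationary D.d D.lam D.u (π N)) (L : ℕ) (B C : ℝ)
    (f : (Fin M × ℕ → ℝ) → (Fin M × ℕ → ℝ) → ℝ)
    (g : (Fin M × ℕ → ℝ) → Fin M → ℕ → (Fin M × ℕ → ℝ) → ℝ)
    (hf : ∀ y, IsOcc y → ∀ q m l h,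
      |f y (Function.update q (m, l + 1) (q (m, l + 1) + h)) - f y q - h * g y m l q| ≤ C * h ^ 2)
    (hg : ∀ y m l q, L ≤ l → g y m l q = 0)
    (hB : ∀ y m l q, IsOcc y → IsOcc q → |g y m l q| ≤ B)
    (hfb : ∀ y, IsOcc y → ∃ B', ∀ q, IsOcc q → |f y q| ≤ B') :
    Tendsto (pairMean G π (fun q q' => ∑ m, ∑ l ∈ Finset.range L, D.drift q m l * g q' m l q))
      (atTop ×ˢ atTop) (𝓝 0) := by
  have hbdd : OccBdd (fun q q' => ∑ m, ∑ l ∈ Finset.range L, D.drift q m l * g q' m l q) :=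
    OccBdd.sum _ fun m => OccBdd.sum _ fun l => (OccBdd.drift D m l).mul
      ⟨B, fun q q' hq hq' => hB q' m l q hq' hq⟩
  rw [Metric.tendsto_nhds]
  intro η hη
  have h1 := (R.eventually_integral L B C (half_pos hη)).and hπ
  filter_upwards [tendsto_fst.eventually h1] with z hz
  obtain ⟨hz1, hz2⟩ := hz
  rw [Real.dist_eq, sub_zero, pairMean, integral_prod_symm _ (hbdd.integrable π z)]
  have h2 : ∀ y : Fin z.2 → ℕ, ‖∫ x, ∑ m, ∑ l ∈ Finset.range L, D.drift ((G z.1).occ x) m l *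
      g ((G z.2).occ y) m l ((G z.1).occ x) ∂(π z.1 : Measure (Fin z.1 → ℕ))‖ ≤ η / 2 := by
    intro y
    have hy := (G z.2).isOcc_occ y
    exact hz1 (π z.1) hz2 (f ((G z.2).occ y)) (g ((G z.2).occ y)) (hf _ hy) (hg _)
      (fun m l q hq => hB _ m l q hy hq) (hfb _ hy)
  have h3 := norm_integral_le_of_norm_le_const (μ := (π z.2 : Measure (Fin z.2 → ℕ)))
    (Eventually.of_forall h2)
  simp only [Real.norm_eq_abs, probReal_univ, mul_one] at h3
  linarith

/-- Stationarity of both of two independent systems, for a test function with antisymmetric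
derivative. -/
theorem Regime.tendsto_pairMean_drift_add (R : Regime D G)
    (hπ : ∀ᶠ N in atTop, (G N).IsStationary D.d D.lam D.u (π N)) (L : ℕ) (B C : ℝ)
    (f : (Fin M × ℕ → ℝ) → (Fin M × ℕ → ℝ) → ℝ)
    (g : (Fin M × ℕ → ℝ) → Fin M → ℕ → (Fin M × ℕ → ℝ) → ℝ)
    (hf : ∀ y, IsOcc y → ∀ q m l h,
      |f y (Function.update q (m, l + 1) (q (m, l + 1) + h)) - f y q - h * g y m l q| ≤ C * h ^ 2)
    (hg : ∀ y m l q, L ≤ l → g y m l q = 0)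
    (hB : ∀ y m l q, IsOcc y → IsOcc q → |g y m l q| ≤ B)
    (hfb : ∀ y, IsOcc y → ∃ B', ∀ q, IsOcc q → |f y q| ≤ B')
    (hodd : ∀ q q' m l, g q m l q' = -g q' m l q) :
    Tendsto (pairMean G π (fun q q' => ∑ m, ∑ l ∈ Finset.range L,
      (D.drift q m l - D.drift q' m l) * g q' m l q)) (atTop ×ˢ atTop) (𝓝 0) := by
  have h1 := R.tendsto_pairMean_drift hπ L B C f g hf hg hB hfb
  have h2 := h1.comp (tendsto_snd.prodMk tendsto_fst :
    Tendsto Prod.swap (atTop ×ˢ atTop) (atTop ×ˢ atTop : Filter (ℕ × ℕ)))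
  have h3 := h1.add h2
  rw [add_zero] at h3
  have hbdd : OccBdd (fun q q' => ∑ m, ∑ l ∈ Finset.range L, D.drift q m l * g q' m l q) :=
    OccBdd.sum _ fun m => OccBdd.sum _ fun l => (OccBdd.drift D m l).mul
      ⟨B, fun q q' hq hq' => hB q' m l q hq' hq⟩
  refine h3.congr fun z => ?_
  rw [Function.comp_apply, pairMean_swap π (z := (z.2, z.1))]
  change pairMean G π _ z + pairMean G π _ z = _
  rw [← pairMean_add _ hbdd hbdd.swap]
  congr 1
  ext q q'
  rw [← Finset.sum_add_distrib]
  refine Finset.sum_congr rfl fun m _ => ?_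
  rw [← Finset.sum_add_distrib]
  refine Finset.sum_congr rfl fun l _ => ?_
  rw [hodd q q']; ring

end pairs

/-! ### Uniform second moments -/

namespace System
variable {K M N : ℕ} (G : System K M N)

/-- The mean of the squared queue lengths over the servers of type `m`. -/
noncomputable def meanSq (m : Fin M) (x : Fin N → ℕ) : ℝ :=
  (∑ j ∈ G.servOf m, (x j : ℝ) ^ 2) / ((G.servOf m).card : ℝ)

theorem meanSq_nonneg (m : Fin M) (x : Fin N → ℕ) : 0 ≤ G.meanSq m x :=
  div_nonneg (Finset.sum_nonneg fun _ _ => sq_nonneg _) (Nat.cast_nonneg _)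

/-- The tail of the occupancy is the mean over `j` of a quantity at most `x j - L`, and
`(L + 1) * (x j - L) ≤ x j ^ 2`. -/
theorem sum_occ_tail_le (x : Fin N → ℕ) (m : Fin M) (L n : ℕ) :
    ∑ i ∈ Finset.range n, G.occ x (m, L + 1 + i) ≤ G.meanSq m x / (L + 1) := by
  have h1 : ∀ i, G.occ x (m, L + 1 + i) =
      (∑ j ∈ G.servOf m, if L + 1 + i ≤ x j then (1 : ℝ) else 0) / ((G.servOf m).card : ℝ) := by
    intro i
    rw [show L + 1 + i = (L + i) + 1 by ring, occ_succ, Finset.card_filter]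
    push_cast
    rfl
  simp only [h1]
  rw [← Finset.sum_div, meanSq, div_right_comm, Finset.sum_comm]
  refine div_le_div_of_nonneg_right ?_ (Nat.cast_nonneg _)
  rw [Finset.sum_div]
  refine Finset.sum_le_sum fun j _ => ?_
  have h2 : ∀ n : ℕ, (∑ i ∈ Finset.range n, if L + 1 + i ≤ x j then (1 : ℝ) else 0) ≤
      ((x j - L : ℕ) : ℝ) := by
    intro n
    rw [← Finset.sum_filter, Finset.sum_const, nsmul_eq_mul, mul_one, Nat.cast_le]
    calc ((Finset.range n).filter fun i => L + 1 + i ≤ x j).card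
        ≤ (Finset.range (x j - L)).card := Finset.card_le_card fun i hi => by
          simp only [Finset.mem_filter, Finset.mem_range] at hi ⊢
          omega
      _ = x j - L := Finset.card_range _
  refine (h2 n).trans ?_
  rw [le_div_iff₀ (by positivity)]
  have h3 : (x j - L) * (L + 1) ≤ x j ^ 2 := by
    rcases Nat.lt_or_ge L (x j) with h | h
    · rw [sq]; exact Nat.mul_le_mul (Nat.sub_le _ _) h
    · simp [Nat.sub_eq_zero_of_le h]
  exact_mod_cast h3

end System

section moments
variable {K M : ℕ} {D : LimitData K M} {G : ∀ N : ℕ, System K M N}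

/-- In the subcritical regime the stationary second moments are bounded uniformly in `N`. -/
theorem Regime.exists_integral_meanSq_le (R : Regime D G) {ρ : ℝ} (hρ : ρ < 1)
    (hsub : Tendsto (fun N : ℕ => (G N).load D.d D.lam D.u) atTop (𝓝 ρ)) :
    ∃ C : ℝ, 0 ≤ C ∧ ∀ᶠ N in atTop, ∀ π : ProbabilityMeasure (Fin N → ℕ),
      (G N).IsStationary D.d D.lam D.u π → ∀ m,
        Integrable ((G N).meanSq m) (π : Measure (Fin N → ℕ)) ∧
        ∫ x, (G N).meanSq m x ∂(π : Measure (Fin N → ℕ)) ≤ C := by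
  -- any bound for the loads strictly between `ρ` and `1` will do
  set r := (ρ + 1) / 2 with hr
  have hr1 : r < 1 := by rw [hr]; linarith
  set κ := 3 / 2 * (1 - r) with hκ
  have hκ0 : 0 < κ := by rw [hκ]; linarith
  have hload : ∀ᶠ N in atTop, (G N).load D.d D.lam D.u ≤ r :=
    (hsub.eventually (gt_mem_nhds (show ρ < r by rw [hr]; linarith))).mono fun _ h => le_of_lt h
  set c : Fin M → ℝ := fun m =>
    (D.lam * D.ξ + 6 / (1 - r) * ∑ m, D.u m * D.v m) / D.v m / (κ * D.u m) with hc
  have hc0 : ∀ m, 0 ≤ c m := fun m => by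
    have h1 := D.lam_pos
    have h2 := D.ξ_pos
    have h3 := D.v_pos m
    have h4 := D.u_pos m
    have h5 : 0 ≤ ∑ m, D.u m * D.v m :=
      Finset.sum_nonneg fun m _ => (mul_pos (D.u_pos m) (D.v_pos m)).le
    have h6 : 0 < 1 - r := by linarith
    rw [hc]
    positivity
  have hlim : ∀ m, Tendsto (fun N : ℕ => (D.lam * (G N).numDisp +
      6 / (1 - r) * ∑ j, D.u ((G N).servType j)) / (((G N).servOf m).card : ℝ) / (κ * D.u m))
      atTop (𝓝 (c m)) := by
    intro m
    have h := ((((R.numDisp.const_mul D.lam).add (R.tendsto_sum_u_div.const_mul (6 / (1 - r)))).div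
      (R.servOf m) (D.v_pos m).ne').div_const (κ * D.u m))
    refine h.congr' ?_
    filter_upwards [eventually_gt_atTop 0] with N hN
    have hN' : (N : ℝ) ≠ 0 := by positivity
    congr 1
    rw [Pi.div_apply, ← mul_div_assoc, ← mul_div_assoc, ← add_div,
      div_div_div_cancel_right₀ hN']
  refine ⟨∑ m, (c m + 1), Finset.sum_nonneg fun m _ => by linarith [hc0 m], ?_⟩
  have hev : ∀ᶠ N in atTop, ∀ m, (D.lam * (G N).numDisp +
      6 / (1 - r) * ∑ j, D.u ((G N).servType j)) / (((G N).servOf m).card : ℝ) / (κ * D.u m) ≤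
      c m + 1 :=
    eventually_all.2 fun m => ((hlim m).eventually (gt_mem_nhds (lt_add_one (c m)))).mono
      fun _ h => le_of_lt h
  filter_upwards [hev, hload, R.eventually_d_le_deg] with N hN hl hdeg π hπ m
  obtain ⟨hi, hle⟩ := hπ.integral_sq_le D.one_le_d D.lam_pos.le D.u_pos hdeg hr1 hl
  have hum := D.u_pos m
  set T : (Fin N → ℕ) → ℝ := fun x =>
    3 / 2 * (1 - r) * ∑ j, D.u ((G N).servType j) * (x j : ℝ) ^ 2 with hT
  have hpt : ∀ x : Fin N → ℕ,
      (G N).meanSq m x ≤ T x / (((G N).servOf m).card : ℝ) / (κ * D.u m) := by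
    intro x
    rw [div_right_comm, System.meanSq]
    refine div_le_div_of_nonneg_right ?_ (Nat.cast_nonneg _)
    rw [le_div_iff₀ (by positivity), hT]
    change _ ≤ κ * _
    rw [mul_left_comm]
    refine mul_le_mul_of_nonneg_left ?_ hκ0.le
    rw [Finset.sum_mul]
    refine le_trans (Finset.sum_le_sum fun j hj => ?_) (Finset.sum_le_sum_of_subset_of_nonneg
      (Finset.subset_univ ((G N).servOf m)) fun j _ _ =>
        mul_nonneg (D.u_pos _).le (sq_nonneg _))
    rw [(Finset.mem_filter.1 hj).2, mul_comm]
  have hTi : Integrable (fun x => T x / (((G N).servOf m).card : ℝ) / (κ * D.u m))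
      (π : Measure (Fin N → ℕ)) := (hi.div_const _).div_const _
  have hmi : Integrable ((G N).meanSq m) (π : Measure (Fin N → ℕ)) :=
    hTi.mono' (measurable_of_countable _).aestronglyMeasurable (Eventually.of_forall fun x => by
      rw [Real.norm_eq_abs, abs_of_nonneg ((G N).meanSq_nonneg m x)]
      exact hpt x)
  refine ⟨hmi, (integral_mono hmi hTi hpt).trans ?_⟩
  rw [integral_div, integral_div]
  refine le_trans ?_ ((hN m).trans (Finset.single_le_sum
    (f := fun m => c m + 1) (fun m _ => by linarith [hc0 m]) (Finset.mem_univ m)))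
  gcongr

theorem integral_occ_le {N : ℕ} {G : System K M N} {π : ProbabilityMeasure (Fin N → ℕ)} {C : ℝ}
    {m : Fin M} (hi : Integrable (G.meanSq m) (π : Measure (Fin N → ℕ)))
    (hC : ∫ x, G.meanSq m x ∂(π : Measure (Fin N → ℕ)) ≤ C) (L n : ℕ) :
    ∑ i ∈ Finset.range n, ∫ x, G.occ x (m, L + 1 + i) ∂(π : Measure (Fin N → ℕ)) ≤
      C / (L + 1) := by
  have h1 : ∀ i, Integrable (fun x => G.occ x (m, L + 1 + i)) (π : Measure (Fin N → ℕ)) := fun i =>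
    JumpChain.integrable_of_abs_le (B := 1) fun x => by
      rw [abs_of_nonneg ((G.isOcc_occ x).nonneg m _)]
      exact (G.isOcc_occ x).le_one m _
  rw [← integral_finsetSum _ fun i _ => h1 i]
  refine (integral_mono (integrable_finsetSum _ fun i _ => h1 i) (hi.div_const _)
    fun x => G.sum_occ_tail_le x m L n).trans ?_
  rw [integral_div]
  gcongr
end moments

/-! ### Coupling of the occupancies of two stationary systems -/

section coupling
variable {K M : ℕ} {D : LimitData K M} {G : ∀ N : ℕ, System K M N}
  {π : ∀ N : ℕ, ProbabilityMeasure (Fin N → ℕ)}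

theorem OccBdd.abs_sub (e : Fin M × ℕ) :
    OccBdd (fun q q' : Fin M × ℕ → ℝ => |q e - q' e|) := ((OccBdd.fst e).sub (OccBdd.snd e)).abs

theorem IsOcc.abs_sub_le_one {q q' : Fin M × ℕ → ℝ} (hq : IsOcc q) (hq' : IsOcc q') (m : Fin M)
    (l : ℕ) : |q (m, l) - q' (m, l)| ≤ 1 := by
  rw [abs_le]
  constructor <;> linarith [hq.le_one m l, hq'.le_one m l, hq.nonneg m l, hq'.nonneg m l]

theorem pairMean_abs_sub_le (m : Fin M) (l : ℕ) (z : ℕ × ℕ) :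
    pairMean G π (fun q q' => |q (m, l) - q' (m, l)|) z ≤
      ∫ x, (G z.1).occ x (m, l) ∂(π z.1 : Measure (Fin z.1 → ℕ)) +
        ∫ x, (G z.2).occ x (m, l) ∂(π z.2 : Measure (Fin z.2 → ℕ)) := by
  have h1 := pairMean_mono (G := G) π (OccBdd.abs_sub (m, l))
    ((OccBdd.fst (m, l)).add (OccBdd.snd (m, l))) (fun q q' hq hq' => by
      rw [abs_le]
      constructor <;> linarith [hq.nonneg m l, hq'.nonneg m l]) z
  rw [pairMean_add _ (OccBdd.fst _) (OccBdd.snd _), pairMean_fst π (fun q => q (m, l)),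
    pairMean_swap π (F := fun _ q' => q' (m, l)), pairMean_fst π (fun q => q (m, l))] at h1
  exact h1

/-- Asymptotically, the occupancies of two independent stationary systems agree at level `1`: up to
the tails, this difference is the rate at which their `ℓ¹` distance decreases. -/
theorem Regime.tendsto_pairMean_one (R : Regime D G)
    (hπ : ∀ᶠ N in atTop, (G N).IsStationary D.d D.lam D.u (π N)) {C : ℝ}
    (hocc : ∀ᶠ N in atTop, ∀ m (L : ℕ),
      ∫ x, (G N).occ x (m, L + 1) ∂(π N : Measure (Fin N → ℕ)) ≤ C / (L + 1)) (m : Fin M) :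
    Tendsto (pairMean G π (fun q q' => |q (m, 1) - q' (m, 1)|)) (atTop ×ˢ atTop) (𝓝 0) := by
  have huv : ∀ m, 0 < D.u m * D.v m := fun m => mul_pos (D.u_pos m) (D.v_pos m)
  set U := ∑ m, D.u m * D.v m with hU
  have hU0 : 0 ≤ U := Finset.sum_nonneg fun m _ => (huv m).le
  set C0 := U + 2 * D.d * (D.lam * D.ξ * ∑ k, D.w k) with hC0
  have hC00 : 0 ≤ C0 := by
    have h1 := D.lam_pos
    have h2 := D.ξ_pos
    have h3 : 0 ≤ ∑ k, D.w k := Finset.sum_nonneg fun k _ => (D.w_pos k).le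
    positivity
  set A : ℕ → (Fin M × ℕ → ℝ) → (Fin M × ℕ → ℝ) → ℝ := fun l q q' =>
    ∑ m, D.u m * D.v m * |q (m, l) - q' (m, l)| with hA
  have hAb : ∀ l, OccBdd (A l) := fun l => OccBdd.sum _ fun m =>
    (OccBdd.const (D.u m * D.v m)).mul (OccBdd.abs_sub (m, l))
  have hA0 : ∀ l q q', 0 ≤ A l q q' := fun l q q' => Finset.sum_nonneg fun m _ =>
    mul_nonneg (huv m).le (abs_nonneg _)
  have hmain : Tendsto (pairMean G π (A 1)) (atTop ×ˢ atTop) (𝓝 0) := by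
    rw [Metric.tendsto_nhds]
    intro η hη
    -- first the level `L` of the truncation is chosen, then the smoothing `ε` of the distance
    obtain ⟨L, hL⟩ : ∃ L : ℕ, U * (2 * C) / (L + 1) < η / 3 := by
      have h := (tendsto_one_div_add_atTop_nhds_zero_nat (𝕜 := ℝ)).const_mul (U * (2 * C))
      rw [mul_zero] at h
      obtain ⟨L, hL⟩ := (h.eventually (gt_mem_nhds (show 0 < η / 3 by positivity))).exists
      exact ⟨L, by simpa only [mul_one_div] using hL⟩
    set ε := η / 3 / (L * C0 + 1) with hε
    have hε0 : 0 < ε := by positivity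
    have hεle : L * ε * C0 ≤ η / 3 := by
      rw [hε, mul_div_assoc', div_mul_eq_mul_div, div_le_iff₀ (by positivity)]
      nlinarith [show (0 : ℝ) ≤ L * C0 by positivity]
    have hlim := R.tendsto_pairMean_drift_add hπ L (∑ m, D.v m) ((∑ m, D.v m) * (1 / ε))
      (fun y q => ∑ e ∈ Finset.univ ×ˢ Finset.range L,
        D.v e.1 * softAbs ε (q (e.1, e.2 + 1) - y (e.1, e.2 + 1)))
      (fun y m l q => if l < L then D.v m * softSign ε (q (m, l + 1) - y (m, l + 1)) else 0)
      (fun y _ q m l h => softAbs_test D hε0 L y q m l h)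
      (fun y m l q hl => if_neg (by omega))
      (fun y m l q _ _ => by
        have hv : D.v m ≤ ∑ m, D.v m :=
          Finset.single_le_sum (fun m _ => (D.v_pos m).le) (Finset.mem_univ m)
        split_ifs
        · rw [abs_mul, abs_of_pos (D.v_pos m)]
          exact (mul_le_of_le_one_right (D.v_pos m).le (abs_softSign_le hε0 _)).trans hv
        · rw [abs_zero]; exact (D.v_pos m).le.trans hv)
      (fun y hy => ⟨∑ e ∈ (Finset.univ : Finset (Fin M)) ×ˢ Finset.range L, D.v e.1 * (1 + ε),
        fun q hq => by
          refine (Finset.abs_sum_le_sum_abs _ _).trans (Finset.sum_le_sum fun e _ => ?_)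
          have h1 := le_softAbs hε0 (q (e.1, e.2 + 1) - y (e.1, e.2 + 1))
          have h2 := softAbs_le hε0 (q (e.1, e.2 + 1) - y (e.1, e.2 + 1))
          have h3 := hq.abs_sub_le_one hy e.1 (e.2 + 1)
          rw [abs_mul, abs_of_pos (D.v_pos e.1), abs_of_pos (hε0.trans_le h1)]
          exact mul_le_mul_of_nonneg_left (by linarith) (D.v_pos e.1).le⟩)
      (fun q q' m l => by
        split_ifs
        · rw [← neg_sub (q (m, l + 1)), softSign_neg]; ring
        · simp)
    set Φ : (Fin M × ℕ → ℝ) → (Fin M × ℕ → ℝ) → ℝ := fun q q' => ∑ m, ∑ l ∈ Finset.range L,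
      (D.drift q m l - D.drift q' m l) *
        (if l < L then D.v m * softSign ε (q (m, l + 1) - q' (m, l + 1)) else 0) with hΦ
    have hΦb : OccBdd Φ := OccBdd.sum _ fun m => OccBdd.sum _ fun l =>
      ((OccBdd.drift D m l).sub (OccBdd.drift D m l).swap).mul ⟨D.v m, fun q q' _ _ => by
        split_ifs
        · rw [abs_mul, abs_of_pos (D.v_pos m)]
          exact mul_le_of_le_one_right (D.v_pos m).le (abs_softSign_le hε0 _)
        · rw [abs_zero]; exact (D.v_pos m).le⟩
    have hpt : ∀ q q', IsOcc q → IsOcc q' →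
        A 1 q q' ≤ -1 * Φ q q' + A (L + 1) q q' + L * ε * C0 := by
      intro q q' hq hq'
      have h1 := D.sum_mul_drift_sub_le hq hq' (ε := ε)
        (s := fun m l => softSign ε (q (m, l + 1) - q' (m, l + 1)))
        (fun m l => abs_softSign_le hε0 _) (fun m l => abs_sub_softSign_mul_le hε0 _) L
      have h2 : Φ q q' = ∑ m, ∑ l ∈ Finset.range L, (D.drift q m l - D.drift q' m l) *
          (D.v m * softSign ε (q (m, l + 1) - q' (m, l + 1))) :=
        Finset.sum_congr rfl fun m _ => Finset.sum_congr rfl fun l hl => by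
          rw [if_pos (Finset.mem_range.1 hl)]
      rw [h2]
      linarith
    filter_upwards [hlim.eventually (lt_mem_nhds (show -(η / 3) < 0 by linarith)),
      tendsto_fst.eventually hocc, tendsto_snd.eventually hocc] with z hz h1 h2
    have h3 := pairMean_mono (G := G) π (hAb 1)
      ((((OccBdd.const (-1)).mul hΦb).add (hAb (L + 1))).add (OccBdd.const (L * ε * C0))) hpt z
    rw [pairMean_add π (((OccBdd.const (-1)).mul hΦb).add (hAb (L + 1))) (OccBdd.const _),
      pairMean_add π ((OccBdd.const (-1)).mul hΦb) (hAb (L + 1)), pairMean_const_mul,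
      pairMean_const] at h3
    have h4 : pairMean G π (A (L + 1)) z ≤ U * (2 * C) / (L + 1) := by
      rw [hA, pairMean_sum π _ fun m => (OccBdd.const (D.u m * D.v m)).mul (OccBdd.abs_sub (m, _)),
        hU, Finset.sum_mul, Finset.sum_div]
      refine Finset.sum_le_sum fun m _ => ?_
      rw [pairMean_const_mul, mul_div_assoc]
      refine mul_le_mul_of_nonneg_left ?_ (huv m).le
      refine (pairMean_abs_sub_le m (L + 1) z).trans ?_
      have := h1 m L
      have := h2 m L
      rw [two_mul, add_div]
      linarith
    rw [Real.dist_eq, sub_zero, abs_of_nonneg (pairMean_nonneg π (hA0 1) z)]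
    linarith
  have hle : ∀ z, pairMean G π (fun q q' => |q (m, 1) - q' (m, 1)|) z ≤
      (D.u m * D.v m)⁻¹ * pairMean G π (A 1) z := by
    intro z
    rw [← pairMean_const_mul]
    refine pairMean_mono π (OccBdd.abs_sub _) ((OccBdd.const _).mul (hAb 1)) (fun q q' _ _ => ?_) z
    rw [← div_eq_inv_mul, le_div_iff₀ (huv m), mul_comm]
    exact Finset.single_le_sum (f := fun m => D.u m * D.v m * |q (m, 1) - q' (m, 1)|)
      (fun m _ => mul_nonneg (huv m).le (abs_nonneg _)) (Finset.mem_univ m)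
  have h := hmain.const_mul (D.u m * D.v m)⁻¹
  rw [mul_zero] at h
  exact squeeze_zero (fun z => pairMean_nonneg π (fun q q' => abs_nonneg _) z) hle h

/-- If two independent stationary systems agree at the levels `a` and `a + 1`, they agree at level
`a + 2`: the latter enters the drift of the former through the departures. -/
theorem Regime.tendsto_pairMean_succ (R : Regime D G)
    (hπ : ∀ᶠ N in atTop, (G N).IsStationary D.d D.lam D.u (π N)) (a : ℕ)
    (h0 : ∀ m, Tendsto (pairMean G π (fun q q' => |q (m, a) - q' (m, a)|))
      (atTop ×ˢ atTop) (𝓝 0))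
    (h1 : ∀ m, Tendsto (pairMean G π (fun q q' => |q (m, a + 1) - q' (m, a + 1)|))
      (atTop ×ˢ atTop) (𝓝 0)) (m : Fin M) :
    Tendsto (pairMean G π (fun q q' => |q (m, a + 2) - q' (m, a + 2)|))
      (atTop ×ˢ atTop) (𝓝 0) := by
  obtain ⟨C1, hC1, hC1'⟩ := D.exists_abs_arrDrift_sub_le
  obtain ⟨C2, hC2, hC2'⟩ := D.exists_abs_drift_le
  have hum := D.u_pos m
  -- the derivatives of the test function
  -- `(q (m, a + 1) - y (m, a + 1)) * (q (m, a + 2) - y (m, a + 2))`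
  set g : (Fin M × ℕ → ℝ) → Fin M → ℕ → (Fin M × ℕ → ℝ) → ℝ := fun y m' l q =>
    if m' = m then (if l = a then q (m, a + 2) - y (m, a + 2) else
      if l = a + 1 then q (m, a + 1) - y (m, a + 1) else 0) else 0 with hg
  have hgb : ∀ y m' l q, IsOcc y → IsOcc q → |g y m' l q| ≤ 1 := by
    intro y m' l q hy hq
    rw [hg]
    dsimp only
    split_ifs
    · exact hq.abs_sub_le_one hy m _
    · exact hq.abs_sub_le_one hy m _
    · simp
    · simp
  have hlim := R.tendsto_pairMean_drift_add hπ (a + 2) 1 0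
    (fun y q => (q (m, a + 1) - y (m, a + 1)) * (q (m, a + 2) - y (m, a + 2))) g
    (fun y _ q m' l h => by
      rw [zero_mul, abs_nonpos_iff, hg]
      dsimp only
      by_cases hm : m' = m
      · subst hm
        by_cases hl : l = a
        · subst hl
          rw [if_pos rfl, if_pos rfl, Function.update_self, Function.update_of_ne (by simp)]
          ring
        · by_cases hl' : l = a + 1
          · subst hl'
            rw [if_pos rfl, if_neg (by omega), if_pos rfl, Function.update_self,
              Function.update_of_ne (by simp)]
            ring
          · rw [if_pos rfl, if_neg hl, if_neg hl', Function.update_of_ne (by simp; omega),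
              Function.update_of_ne (by simp; omega)]
            ring
      · rw [if_neg hm, Function.update_of_ne (by simp [Ne.symm hm]),
          Function.update_of_ne (by simp [Ne.symm hm])]
        ring)
    (fun y m' l q hl => by
      rw [hg]; dsimp only
      rw [if_neg (show l ≠ a by omega), if_neg (show l ≠ a + 1 by omega), ite_self])
    hgb
    (fun y hy => ⟨1, fun q hq => by
      rw [abs_mul]
      exact mul_le_one₀ (hq.abs_sub_le_one hy _ _) (abs_nonneg _) (hq.abs_sub_le_one hy _ _)⟩)
    (fun q q' m' l => by
      rw [hg]; dsimp only
      split_ifs <;> ring)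
  set Φ : (Fin M × ℕ → ℝ) → (Fin M × ℕ → ℝ) → ℝ := fun q q' => ∑ m, ∑ l ∈ Finset.range (a + 2),
      (D.drift q m l - D.drift q' m l) * g q' m l q with hΦ
  have hΦb : OccBdd Φ := OccBdd.sum _ fun m => OccBdd.sum _ fun l =>
    ((OccBdd.drift D m l).sub (OccBdd.drift D m l).swap).mul
      ⟨1, fun q q' hq hq' => hgb q' m l q hq' hq⟩
  have hΦeq : ∀ q q', Φ q q' =
      (D.drift q m a - D.drift q' m a) * (q (m, a + 2) - q' (m, a + 2)) +
      (D.drift q m (a + 1) - D.drift q' m (a + 1)) * (q (m, a + 1) - q' (m, a + 1)) := by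
    intro q q'
    rw [hΦ]
    dsimp only
    rw [Finset.sum_eq_single m (fun m' _ hm => Finset.sum_eq_zero fun l _ => by
        rw [hg]; dsimp only; rw [if_neg hm, mul_zero]) (by simp),
      Finset.sum_range_succ, Finset.sum_range_succ, Finset.sum_eq_zero fun l hl => by
        have := Finset.mem_range.1 hl
        rw [hg]; dsimp only
        rw [if_pos rfl, if_neg (by omega), if_neg (by omega), mul_zero]]
    rw [hg]
    simp
  set S : (Fin M × ℕ → ℝ) → (Fin M × ℕ → ℝ) → ℝ := fun q q' =>
    ∑ m, |q (m, a) - q' (m, a)| + ∑ m, |q (m, a + 1) - q' (m, a + 1)| with hS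
  have hSb : OccBdd S := (OccBdd.sum _ fun m => OccBdd.abs_sub (m, a)).add
    (OccBdd.sum _ fun m => OccBdd.abs_sub (m, a + 1))
  have hSlim : Tendsto (pairMean G π S) (atTop ×ˢ atTop) (𝓝 0) := by
    have h := (tendsto_finsetSum Finset.univ fun m _ => h0 m).add
      (tendsto_finsetSum Finset.univ fun m _ => h1 m)
    simp only [Finset.sum_const_zero, add_zero] at h
    refine h.congr fun z => ?_
    rw [hS, pairMean_add π (OccBdd.sum _ fun m => OccBdd.abs_sub (m, a))
      (OccBdd.sum _ fun m => OccBdd.abs_sub (m, a + 1)),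
      pairMean_sum π _ fun m => OccBdd.abs_sub (m, a),
      pairMean_sum π _ fun m => OccBdd.abs_sub (m, a + 1)]
  set E : (Fin M × ℕ → ℝ) → (Fin M × ℕ → ℝ) → ℝ := fun q q' =>
    Φ q q' + (D.u m + 2 * C2) * |q (m, a + 1) - q' (m, a + 1)| + C1 * S q q' with hE
  have hEb : OccBdd E := (hΦb.add ((OccBdd.const _).mul (OccBdd.abs_sub (m, a + 1)))).add
    ((OccBdd.const _).mul hSb)
  have hElim : Tendsto (pairMean G π E) (atTop ×ˢ atTop) (𝓝 0) := by
    have h := (hlim.add ((h1 m).const_mul (D.u m + 2 * C2))).add (hSlim.const_mul C1)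
    simp only [mul_zero, add_zero] at h
    refine h.congr fun z => ?_
    rw [hE, pairMean_add π (hΦb.add ((OccBdd.const _).mul (OccBdd.abs_sub (m, a + 1))))
      ((OccBdd.const _).mul hSb), pairMean_add π hΦb ((OccBdd.const _).mul (OccBdd.abs_sub _)),
      pairMean_const_mul, pairMean_const_mul]
  have hpt : ∀ q q', IsOcc q → IsOcc q' → D.u m * (q (m, a + 2) - q' (m, a + 2)) ^ 2 ≤ E q q' := by
    intro q q' hq hq'
    have e1 := hC1' q q' hq hq' m a
    have e2 : |D.drift q m (a + 1) - D.drift q' m (a + 1)| ≤ 2 * C2 :=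
      (_root_.abs_sub _ _).trans (by linarith [hC2' q hq m (a + 1), hC2' q' hq' m (a + 1)])
    have e3 := hq.abs_sub_le_one hq' m (a + 2)
    have e4 : D.drift q m a - D.drift q' m a = -D.u m * (q (m, a + 1) - q' (m, a + 1)) +
        D.u m * (q (m, a + 2) - q' (m, a + 2)) + (D.arrDrift q m a - D.arrDrift q' m a) := by
      rw [LimitData.drift, LimitData.drift]; ring
    have e5 : E q q' = Φ q q' + (D.u m + 2 * C2) * |q (m, a + 1) - q' (m, a + 1)| + C1 * S q q' :=
      rfl
    rw [e5, hΦeq, e4]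
    set x1 := q (m, a + 1) - q' (m, a + 1)
    set x2 := q (m, a + 2) - q' (m, a + 2)
    set δ := D.arrDrift q m a - D.arrDrift q' m a
    set τ := D.drift q m (a + 1) - D.drift q' m (a + 1)
    have f1 : |x1 * x2| ≤ |x1| := by
      rw [abs_mul]; exact mul_le_of_le_one_right (abs_nonneg _) e3
    have f2 : |δ * x2| ≤ C1 * S q q' := by
      rw [abs_mul]; exact (mul_le_of_le_one_right (abs_nonneg _) e3).trans e1
    have f3 : |τ * x1| ≤ 2 * C2 * |x1| := by
      rw [abs_mul]; exact mul_le_mul_of_nonneg_right e2 (abs_nonneg _)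
    have f4 := mul_le_mul_of_nonneg_left ((abs_le.1 f1).2) hum.le
    have f5 := (abs_le.1 f2).1
    have f6 := (abs_le.1 f3).1
    nlinarith
  rw [Metric.tendsto_nhds]
  intro η hη
  filter_upwards [hElim.eventually (gt_mem_nhds (show 0 < D.u m * η / 2 * (η / 2) by positivity))]
    with z hz
  have h3 := pairMean_mono (G := G) π (OccBdd.abs_sub (m, a + 2))
    ((OccBdd.const (η / 2)).add ((OccBdd.const (D.u m * (η / 2))⁻¹).mul hEb))
    (fun q q' hq hq' => by
      have e1 := hpt q q' hq hq'
      rw [← sq_abs] at e1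
      have e2 : |q (m, a + 2) - q' (m, a + 2)| ^ 2 / (η / 2) ≤ (D.u m * (η / 2))⁻¹ * E q q' := by
        rw [← div_eq_inv_mul, div_le_div_iff₀ (by positivity) (by positivity)]
        nlinarith
      refine le_trans ?_ (add_le_add_right e2 _)
      rw [← sub_le_iff_le_add', le_div_iff₀ (by positivity)]
      nlinarith [sq_nonneg (|q (m, a + 2) - q' (m, a + 2)| - η / 2)]) z
  rw [pairMean_add π (OccBdd.const _) ((OccBdd.const _).mul hEb), pairMean_const,
    pairMean_const_mul] at h3
  have h4 : (D.u m * (η / 2))⁻¹ * pairMean G π E z < η / 2 := by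
    rw [← div_eq_inv_mul, div_lt_iff₀ (by positivity)]
    linarith
  rw [Real.dist_eq, sub_zero, abs_of_nonneg (pairMean_nonneg π (fun q q' => abs_nonneg _) z)]
  linarith

theorem Regime.tendsto_pairMean (R : Regime D G)
    (hπ : ∀ᶠ N in atTop, (G N).IsStationary D.d D.lam D.u (π N)) {C : ℝ}
    (hocc : ∀ᶠ N in atTop, ∀ m (L : ℕ),
      ∫ x, (G N).occ x (m, L + 1) ∂(π N : Measure (Fin N → ℕ)) ≤ C / (L + 1)) (l : ℕ) :
    ∀ m, Tendsto (pairMean G π (fun q q' => |q (m, l) - q' (m, l)|)) (atTop ×ˢ atTop) (𝓝 0) := by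
  have h : ∀ l, (∀ m, Tendsto (pairMean G π (fun q q' => |q (m, l) - q' (m, l)|))
      (atTop ×ˢ atTop) (𝓝 0)) ∧ ∀ m, Tendsto
      (pairMean G π (fun q q' => |q (m, l + 1) - q' (m, l + 1)|)) (atTop ×ˢ atTop) (𝓝 0) := by
    intro l
    induction l with
    | zero =>
      refine ⟨fun m => ?_, R.tendsto_pairMean_one hπ hocc⟩
      refine tendsto_const_nhds.congr fun z => ?_
      rw [pairMean]
      simp [((G z.1).isOcc_occ _).zero, ((G z.2).isOcc_occ _).zero]
    | succ l ih => exact ⟨ih.2, R.tendsto_pairMean_succ hπ l ih.1 ih.2⟩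
  exact (h l).1

end coupling

/-! ### Convergence of the stationary occupancies -/

/-- Laws that concentrate around a point converge weakly to the point mass. -/
theorem tendsto_diracProba_of_integral_dist {E ι : Type*} [PseudoMetricSpace E] [MeasurableSpace E]
    [OpensMeasurableSpace E] {l : Filter ι} {ν : ι → ProbabilityMeasure E} {a : E}
    (hi : ∀ᶠ i in l, Integrable (fun y => dist y a) (ν i : Measure E))
    (h : Tendsto (fun i => ∫ y, dist y a ∂(ν i : Measure E)) l (𝓝 0)) :
    Tendsto ν l (𝓝 (diracProba a)) := by
  rw [ProbabilityMeasure.tendsto_iff_forall_integral_tendsto]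
  intro f
  have hdirac : ∫ y, f y ∂(diracProba a : Measure E) = f a := by
    change ∫ y, f y ∂(Measure.dirac a) = f a
    exact integral_dirac' _ _ f.continuous.stronglyMeasurable
  rw [hdirac, Metric.tendsto_nhds]
  intro η hη
  obtain ⟨δ, hδ, hfδ⟩ := Metric.continuousAt_iff.1 f.continuous.continuousAt (η / 2) (half_pos hη)
  have hpt : ∀ y, |f y - f a| ≤ η / 2 + 2 * ‖f‖ / δ * dist y a := by
    intro y
    rcases lt_or_ge (dist y a) δ with hy | hy
    · have := hfδ hy
      rw [Real.dist_eq] at this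
      have h2 : 0 ≤ 2 * ‖f‖ / δ * dist y a := by positivity
      linarith
    · have h1 : |f y - f a| ≤ 2 * ‖f‖ := by
        rw [← Real.dist_eq]; exact f.dist_le_two_norm y a
      have h2 : 2 * ‖f‖ ≤ 2 * ‖f‖ / δ * dist y a := by
        rw [div_mul_eq_mul_div, le_div_iff₀ hδ]
        exact mul_le_mul_of_nonneg_left hy (by positivity)
      linarith
  have hlim : Tendsto (fun i => 2 * ‖f‖ / δ * ∫ y, dist y a ∂(ν i : Measure E)) l (𝓝 0) := by
    simpa using h.const_mul (2 * ‖f‖ / δ)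
  filter_upwards [hi, hlim.eventually (gt_mem_nhds (half_pos hη))] with i hi hlt
  have hfi : Integrable f (ν i : Measure E) := f.integrable _
  have h1 : ∫ y, f y ∂(ν i : Measure E) - f a = ∫ y, (f y - f a) ∂(ν i : Measure E) := by
    rw [integral_sub hfi (integrable_const _)]; simp
  rw [Real.dist_eq, h1]
  refine (abs_integral_le_integral_abs).trans_lt ?_
  have h2 := integral_mono (hfi.sub (integrable_const (f a))).abs
    ((integrable_const (η / 2)).add (hi.const_mul (2 * ‖f‖ / δ))) hpt
  have h3 : ∫ y, (η / 2 + 2 * ‖f‖ / δ * dist y a) ∂(ν i : Measure E) =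
      η / 2 + 2 * ‖f‖ / δ * ∫ y, dist y a ∂(ν i : Measure E) := by
    rw [integral_add (integrable_const _) (hi.const_mul _), integral_const_mul]; simp
  refine lt_of_le_of_lt (h2.trans_eq h3) ?_
  linarith

/-- A nonnegative array is bounded in `ℓ¹` by its first levels and a bound for the tails. -/
theorem sum_le_levels {M : ℕ} {f : Fin M × ℕ → ℝ} (hf : ∀ e, 0 ≤ f e) (L : ℕ) {T : Fin M → ℝ}
    (hT : ∀ m n, ∑ i ∈ Finset.range n, f (m, L + 1 + i) ≤ T m) (s : Finset (Fin M × ℕ)) :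
    ∑ e ∈ s, f e ≤ ∑ m, ∑ l ∈ Finset.range (L + 1), f (m, l) + ∑ m, T m := by
  obtain ⟨n, hn⟩ : ∃ n : ℕ, s ⊆ Finset.univ ×ˢ Finset.range (L + 1 + n) := by
    refine ⟨s.sup Prod.snd, fun e he => ?_⟩
    have h := Finset.le_sup (f := Prod.snd) he
    simp only [Finset.mem_product, Finset.mem_univ, true_and, Finset.mem_range]
    omega
  refine (Finset.sum_le_sum_of_subset_of_nonneg hn fun e _ _ => hf e).trans ?_
  rw [Finset.sum_product, ← Finset.sum_add_distrib]
  refine Finset.sum_le_sum fun m _ => ?_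
  rw [Finset.sum_range_add]
  exact add_le_add_right (hT m n) _

section limit
variable {K M : ℕ} {D : LimitData K M} {G : ∀ N : ℕ, System K M N}
  {π : ∀ N : ℕ, ProbabilityMeasure (Fin N → ℕ)}

theorem integrable_occ {N : ℕ} (G : System K M N) (π : ProbabilityMeasure (Fin N → ℕ))
    (e : Fin M × ℕ) : Integrable (fun x => G.occ x e) (π : Measure (Fin N → ℕ)) :=
  JumpChain.integrable_of_abs_le (B := 1) fun x => by
    rw [abs_of_nonneg ((G.isOcc_occ x).nonneg e.1 e.2)]
    exact (G.isOcc_occ x).le_one e.1 e.2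

theorem integrable_abs_occ_sub {N : ℕ} (G : System K M N) (π : ProbabilityMeasure (Fin N → ℕ))
    (e : Fin M × ℕ) (c : ℝ) : Integrable (fun x => |G.occ x e - c|) (π : Measure (Fin N → ℕ)) :=
  ((integrable_occ G π e).sub (integrable_const c)).abs

/-- If two independent copies agree asymptotically, they concentrate around a constant. -/
theorem exists_limit_of_pairMean {m : Fin M} {l : ℕ}
    (h : Tendsto (pairMean G π (fun q q' => |q (m, l) - q' (m, l)|)) (atTop ×ˢ atTop) (𝓝 0)) :
    ∃ c : ℝ, Tendsto (fun N => ∫ x, |(G N).occ x (m, l) - c| ∂(π N : Measure (Fin N → ℕ))) atTop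
      (𝓝 0) := by
  set a : ℕ → ℝ := fun N => ∫ x, (G N).occ x (m, l) ∂(π N : Measure (Fin N → ℕ)) with ha
  have hjensen : ∀ N N', ∫ x, |(G N).occ x (m, l) - a N'| ∂(π N : Measure (Fin N → ℕ)) ≤
      pairMean G π (fun q q' => |q (m, l) - q' (m, l)|) (N, N') := by
    intro N N'
    have hi := (OccBdd.abs_sub (m, l)).integrable (G := G) π (N, N')
    rw [pairMean, integral_prod _ hi]
    refine integral_mono (integrable_abs_occ_sub _ _ _ _) hi.integral_prod_left fun x => ?_
    have h1 : (G N).occ x (m, l) - a N' =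
        ∫ y, ((G N).occ x (m, l) - (G N').occ y (m, l)) ∂(π N' : Measure (Fin N' → ℕ)) := by
      rw [integral_sub (integrable_const _) (integrable_occ _ _ _)]
      simp [ha]
    dsimp only
    rw [h1]
    exact abs_integral_le_integral_abs
  have hmean : ∀ N (c : ℝ), |a N - c| ≤
      ∫ x, |(G N).occ x (m, l) - c| ∂(π N : Measure (Fin N → ℕ)) := by
    intro N c
    have h1 : a N - c = ∫ x, ((G N).occ x (m, l) - c) ∂(π N : Measure (Fin N → ℕ)) := by
      rw [integral_sub (integrable_occ _ _ _) (integrable_const _)]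
      simp [ha]
    rw [h1]
    exact abs_integral_le_integral_abs
  have hcauchy : CauchySeq a := by
    rw [cauchySeq_iff_tendsto_dist_atTop_0, ← prod_atTop_atTop_eq]
    exact squeeze_zero (fun z => dist_nonneg)
      (fun z => ((hmean z.1 (a z.2)).trans (hjensen z.1 z.2))) h
  obtain ⟨c, hc⟩ := cauchySeq_tendsto_of_complete hcauchy
  refine ⟨c, ?_⟩
  rw [Metric.tendsto_nhds]
  intro η hη
  filter_upwards [(h.eventually (gt_mem_nhds (half_pos hη))).curry] with N hN
  obtain ⟨N', h1, h2⟩ := (hN.and (Metric.tendsto_nhds.1 hc (η / 2) (half_pos hη))).exists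
  rw [Real.dist_eq] at h2
  have h3 : ∫ x, |(G N).occ x (m, l) - c| ∂(π N : Measure (Fin N → ℕ)) ≤
      ∫ x, (|(G N).occ x (m, l) - a N'| + |a N' - c|) ∂(π N : Measure (Fin N → ℕ)) :=
    integral_mono (integrable_abs_occ_sub _ _ _ _)
      ((integrable_abs_occ_sub _ _ _ _).add (integrable_const _)) fun x => abs_sub_le _ _ _
  rw [integral_add (integrable_abs_occ_sub _ _ _ _) (integrable_const _)] at h3
  simp only [integral_const, probReal_univ, smul_eq_mul, one_mul] at h3
  have h4 := hjensen N N'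
  rw [Real.dist_eq, sub_zero, abs_of_nonneg (integral_nonneg fun _ => abs_nonneg _)]
  linarith

/-- Stationarity passes to the limit: it is tested on a single coordinate of the occupancy. -/
theorem Regime.drift_eq_zero (R : Regime D G)
    (hπ : ∀ᶠ N in atTop, (G N).IsStationary D.d D.lam D.u (π N)) {c : Fin M × ℕ → ℝ} (hc : IsOcc c)
    (h : ∀ m l, Tendsto (fun N => ∫ x, |(G N).occ x (m, l) - c (m, l)|
      ∂(π N : Measure (Fin N → ℕ))) atTop (𝓝 0)) (m : Fin M) (l : ℕ) : D.drift c m l = 0 := by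
  obtain ⟨C1, hC1, hC1'⟩ := D.exists_abs_arrDrift_sub_le
  obtain ⟨C2, hC2, hC2'⟩ := D.exists_abs_drift_le
  have hum := D.u_pos m
  set e : ∀ N, ℕ → Fin M → (Fin N → ℕ) → ℝ := fun N l m x => |(G N).occ x (m, l) - c (m, l)| with he
  have hei : ∀ N l m, Integrable (e N l m) (π N : Measure (Fin N → ℕ)) := fun N l m =>
    integrable_abs_occ_sub _ _ _ _
  have hpt : ∀ N x, |D.drift ((G N).occ x) m l - D.drift c m l| ≤
      (D.u m * e N (l + 1) m x + D.u m * e N (l + 2) m x) +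
        (C1 * ∑ m', e N l m' x + C1 * ∑ m', e N (l + 1) m' x) := by
    intro N x
    have h1 := hC1' _ _ ((G N).isOcc_occ x) hc m l
    have h2 : D.drift ((G N).occ x) m l - D.drift c m l =
        -(D.u m * ((G N).occ x (m, l + 1) - c (m, l + 1))) +
        D.u m * ((G N).occ x (m, l + 2) - c (m, l + 2)) +
        (D.arrDrift ((G N).occ x) m l - D.arrDrift c m l) := by
      rw [LimitData.drift, LimitData.drift]; ring
    rw [h2]
    refine (abs_add_le _ _).trans (add_le_add ((abs_add_le _ _).trans (add_le_add ?_ ?_)) ?_)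
    · rw [abs_neg, abs_mul, abs_of_pos hum]
    · rw [abs_mul, abs_of_pos hum]
    · rw [← mul_add]; exact h1
  have hlim : Tendsto (fun N => ∫ x, ((D.u m * e N (l + 1) m x + D.u m * e N (l + 2) m x) +
        (C1 * ∑ m', e N l m' x + C1 * ∑ m', e N (l + 1) m' x))
        ∂(π N : Measure (Fin N → ℕ))) atTop (𝓝 0) := by
    have h1 := (((h m (l + 1)).const_mul (D.u m)).add ((h m (l + 2)).const_mul (D.u m))).add
      (((tendsto_finsetSum Finset.univ fun m' _ => h m' l).const_mul C1).add
        ((tendsto_finsetSum Finset.univ fun m' _ => h m' (l + 1)).const_mul C1))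
    simp only [Finset.sum_const_zero, mul_zero, add_zero] at h1
    refine h1.congr fun N => ?_
    have hs : ∀ l, Integrable (fun x => ∑ m', e N l m' x) (π N : Measure (Fin N → ℕ)) := fun l =>
      integrable_finsetSum _ fun m' _ => hei N l m'
    have i1 : Integrable (fun x => D.u m * e N (l + 1) m x + D.u m * e N (l + 2) m x)
        (π N : Measure (Fin N → ℕ)) := ((hei N _ m).const_mul _).add ((hei N _ m).const_mul _)
    have i2 : Integrable (fun x => C1 * ∑ m', e N l m' x + C1 * ∑ m', e N (l + 1) m' x)
        (π N : Measure (Fin N → ℕ)) := ((hs _).const_mul _).add ((hs _).const_mul _)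
    rw [integral_add i1 i2, integral_add ((hei N _ m).const_mul _) ((hei N _ m).const_mul _),
      integral_add ((hs _).const_mul _) ((hs _).const_mul _)]
    simp only [integral_const_mul]
    rw [integral_finsetSum _ fun m' _ => hei N _ m', integral_finsetSum _ fun m' _ => hei N _ m']
  by_contra hne
  set η := |D.drift c m l| with hη
  have hη0 : 0 < η := abs_pos.2 hne
  obtain ⟨N, h1, h2, h3⟩ := ((R.eventually_integral (l + 1) 1 0 (show 0 < η / 3 by positivity)).and
    (hπ.and (hlim.eventually (gt_mem_nhds (show 0 < η / 3 by positivity))))).exists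
  have h4 := h1 (π N) h2 (fun q => q (m, l + 1)) (fun m' l' _ => if m' = m ∧ l' = l then 1 else 0)
    (fun q m' l' h => by
      rw [zero_mul, abs_nonpos_iff]
      by_cases hml : m' = m ∧ l' = l
      · obtain ⟨rfl, rfl⟩ := hml
        simp
      · rw [if_neg hml, Function.update_of_ne]
        · ring
        · intro h'
          obtain ⟨a1, a2⟩ := Prod.mk.inj h'
          exact hml ⟨a1.symm, by omega⟩)
    (fun m' l' _ hl => if_neg (by omega))
    (fun m' l' q _ => by split_ifs <;> simp)
    ⟨1, fun q hq => by rw [abs_of_nonneg (hq.nonneg _ _)]; exact hq.le_one _ _⟩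
  have h5 : ∀ x, ∑ m', ∑ l' ∈ Finset.range (l + 1), D.drift ((G N).occ x) m' l' *
      (if m' = m ∧ l' = l then 1 else 0) = D.drift ((G N).occ x) m l := by
    intro x
    rw [Finset.sum_eq_single m (fun m' _ hm => Finset.sum_eq_zero fun l' _ => by
        rw [if_neg (fun h => hm h.1), mul_zero]) (by simp),
      Finset.sum_eq_single l (fun l' _ hl => by rw [if_neg (fun h => hl h.2), mul_zero])
        (by simp)]
    simp
  simp only [h5] at h4
  have hdi : Integrable (fun x => D.drift ((G N).occ x) m l) (π N : Measure (Fin N → ℕ)) :=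
    JumpChain.integrable_of_abs_le fun x => hC2' _ ((G N).isOcc_occ x) m l
  have hs : ∀ l, Integrable (fun x => ∑ m', e N l m' x) (π N : Measure (Fin N → ℕ)) := fun l =>
    integrable_finsetSum _ fun m' _ => hei N l m'
  have h6 := integral_mono (hdi.sub (integrable_const (D.drift c m l))).abs
    ((((hei N _ m).const_mul _).add ((hei N _ m).const_mul _)).add
      (((hs _).const_mul _).add ((hs _).const_mul _))) (hpt N)
  have h7 : |∫ x, (D.drift ((G N).occ x) m l - D.drift c m l) ∂(π N : Measure (Fin N → ℕ))| ≤
      η / 3 := abs_integral_le_integral_abs.trans (h6.trans h3.le)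
  rw [integral_sub hdi (integrable_const _)] at h7
  simp only [integral_const, probReal_univ, smul_eq_mul, one_mul] at h7
  have h8 : η ≤ η / 3 + η / 3 := by
    rw [hη]
    calc |D.drift c m l| = |(∫ x, D.drift ((G N).occ x) m l ∂(π N : Measure (Fin N → ℕ))) -
          (∫ x, D.drift ((G N).occ x) m l ∂(π N : Measure (Fin N → ℕ)) - D.drift c m l)| := by
            rw [sub_sub_cancel]
      _ ≤ _ := (_root_.abs_sub _ _).trans (add_le_add h4 h7)
  linarith

/-- Under any stationary laws, the occupancies converge to a fixed point of the limiting system. -/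
theorem Regime.exists_tendsto_occupancyLaw (R : Regime D G) {ρ : ℝ} (hρ : ρ < 1)
    (hsub : Tendsto (fun N : ℕ => (G N).load D.d D.lam D.u) atTop (𝓝 ρ))
    (hπ : ∀ᶠ N in atTop, (G N).IsStationary D.d D.lam D.u (π N)) :
    ∃ q : OccSpace M, (∀ m l, D.drift (fun e => q.1 e) m l = 0) ∧
      Tendsto (fun N : ℕ => (G N).occupancyLaw (π N)) atTop (𝓝 (diracProba q)) := by
  obtain ⟨C, hC, hCev⟩ := R.exists_integral_meanSq_le hρ hsub
  have hsq : ∀ᶠ N in atTop, ∀ m, Integrable ((G N).meanSq m) (π N : Measure (Fin N → ℕ)) ∧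
      ∫ x, (G N).meanSq m x ∂(π N : Measure (Fin N → ℕ)) ≤ C := by
    filter_upwards [hCev, hπ] with N h1 h2 using h1 (π N) h2
  have hocc : ∀ᶠ N in atTop, ∀ m (L : ℕ),
      ∫ x, (G N).occ x (m, L + 1) ∂(π N : Measure (Fin N → ℕ)) ≤ C / (L + 1) := by
    filter_upwards [hsq] with N hN m L
    simpa using integral_occ_le (hN m).1 (hN m).2 L 1
  have hlim : ∀ e : Fin M × ℕ, ∃ c : ℝ, Tendsto (fun N => ∫ x, |(G N).occ x e - c|
      ∂(π N : Measure (Fin N → ℕ))) atTop (𝓝 0) := fun e =>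
    exists_limit_of_pairMean (R.tendsto_pairMean hπ hocc e.2 e.1)
  choose c hc using hlim
  have hmean : ∀ e, Tendsto (fun N => ∫ x, (G N).occ x e ∂(π N : Measure (Fin N → ℕ))) atTop
      (𝓝 (c e)) := by
    intro e
    rw [tendsto_iff_dist_tendsto_zero]
    refine squeeze_zero (fun _ => dist_nonneg) (fun N => ?_) (hc e)
    have h1 : ∫ x, (G N).occ x e ∂(π N : Measure (Fin N → ℕ)) - c e =
        ∫ x, ((G N).occ x e - c e) ∂(π N : Measure (Fin N → ℕ)) := by
      rw [integral_sub (integrable_occ _ _ _) (integrable_const _)]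
      simp
    rw [Real.dist_eq, h1]
    exact abs_integral_le_integral_abs
  have hcO : IsOcc c := by
    refine ⟨fun m => ?_, fun m l => ?_, fun m l => ?_⟩
    · refine tendsto_nhds_unique (hmean (m, 0)) (tendsto_const_nhds.congr fun N => ?_)
      simp [((G N).isOcc_occ _).zero]
    · exact ge_of_tendsto' (hmean (m, l)) fun N =>
        integral_nonneg fun x => ((G N).isOcc_occ x).nonneg m l
    · exact le_of_tendsto_of_tendsto' (hmean (m, l + 1)) (hmean (m, l)) fun N =>
        integral_mono (integrable_occ _ _ _) (integrable_occ _ _ _)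
          fun x => ((G N).isOcc_occ x).anti m l
  have htail : ∀ m (L n : ℕ), ∑ i ∈ Finset.range n, c (m, L + 1 + i) ≤ C / (L + 1) := by
    intro m L n
    refine le_of_tendsto (tendsto_finsetSum _ fun i _ => hmean (m, L + 1 + i)) ?_
    filter_upwards [hsq] with N hN using integral_occ_le (hN m).1 (hN m).2 L n
  have hsum : Summable c :=
    summable_of_sum_le (fun e => hcO.nonneg e.1 e.2)
      (sum_le_levels (fun e => hcO.nonneg e.1 e.2) 0 fun m n => htail m 0 n)
  have hmem : Memℓp c 1 := by
    refine memℓp_gen (hsum.congr fun e => ?_)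
    rw [Real.norm_eq_abs, abs_of_nonneg (hcO.nonneg e.1 e.2)]
    simp
  set q : OccSpace M := ⟨⟨c, hmem⟩, fun m => ⟨hcO.zero m, fun l => ⟨hcO.nonneg m l, hcO.anti m l⟩⟩⟩
    with hq
  refine ⟨q, R.drift_eq_zero hπ hcO fun m l => hc (m, l), ?_⟩
  have hdist : ∀ N x (L : ℕ), dist ((G N).occupancy x) q ≤
      ∑ m, ∑ l ∈ Finset.range (L + 1), |(G N).occ x (m, l) - c (m, l)| +
        ∑ m, ((G N).meanSq m x / (L + 1) + C / (L + 1)) := by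
    intro N x L
    have hm0 := fun m => (G N).meanSq_nonneg m x
    rw [Subtype.dist_eq, dist_eq_norm]
    refine lp.norm_le_of_forall_sum_le (by simp) (add_nonneg
      (Finset.sum_nonneg fun m _ => Finset.sum_nonneg fun l _ => abs_nonneg _)
      (Finset.sum_nonneg fun m _ => add_nonneg (div_nonneg (hm0 m) (by positivity))
        (by positivity))) fun s => ?_
    simp only [ENNReal.toReal_one, Real.rpow_one]
    refine sum_le_levels (f := fun e => |(G N).occ x e - c e|) (fun e => abs_nonneg _) L
      (fun m n => ?_) s
    refine le_trans (Finset.sum_le_sum fun i _ => ?_) ((Finset.sum_add_distrib).trans_le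
      (add_le_add ((G N).sum_occ_tail_le x m L n) (htail m L n)))
    have h1 := ((G N).isOcc_occ x).nonneg m (L + 1 + i)
    have h2 := hcO.nonneg m (L + 1 + i)
    rw [abs_le]
    constructor <;> linarith
  have hbi : ∀ N (L : ℕ), (∀ m, Integrable ((G N).meanSq m) (π N : Measure (Fin N → ℕ)) ∧
      ∫ x, (G N).meanSq m x ∂(π N : Measure (Fin N → ℕ)) ≤ C) →
      Integrable (fun x => dist ((G N).occupancy x) q) (π N : Measure (Fin N → ℕ)) ∧
      ∫ x, dist ((G N).occupancy x) q ∂(π N : Measure (Fin N → ℕ)) ≤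
        ∑ m, ∑ l ∈ Finset.range (L + 1), ∫ x, |(G N).occ x (m, l) - c (m, l)|
          ∂(π N : Measure (Fin N → ℕ)) + M * (2 * C / (L + 1)) := by
    intro N L hN
    have i1 : Integrable (fun x => ∑ m, ∑ l ∈ Finset.range (L + 1),
        |(G N).occ x (m, l) - c (m, l)|) (π N : Measure (Fin N → ℕ)) :=
      integrable_finsetSum _ fun m _ => integrable_finsetSum _ fun l _ =>
        integrable_abs_occ_sub _ _ _ _
    have i2 : ∀ m, Integrable (fun x => (G N).meanSq m x / (L + 1) + C / (L + 1))
        (π N : Measure (Fin N → ℕ)) := fun m =>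
      ((hN m).1.div_const _).add (integrable_const _)
    have i3 : Integrable (fun x => ∑ m, ((G N).meanSq m x / (L + 1) + C / (L + 1)))
        (π N : Measure (Fin N → ℕ)) := integrable_finsetSum _ fun m _ => i2 m
    have i4 : Integrable (fun x => dist ((G N).occupancy x) q) (π N : Measure (Fin N → ℕ)) :=
      (i1.add i3).mono' (measurable_of_countable _).aestronglyMeasurable
        (Eventually.of_forall fun x => by
          rw [Real.norm_eq_abs, abs_of_nonneg dist_nonneg]; exact hdist N x L)
    refine ⟨i4, (integral_mono i4 (i1.add i3) fun x => hdist N x L).trans ?_⟩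
    have h0 : ∫ x, (∑ m, ∑ l ∈ Finset.range (L + 1), |(G N).occ x (m, l) - c (m, l)| +
        ∑ m, ((G N).meanSq m x / (L + 1) + C / (L + 1))) ∂(π N : Measure (Fin N → ℕ)) =
        ∑ m, ∑ l ∈ Finset.range (L + 1), ∫ x, |(G N).occ x (m, l) - c (m, l)|
          ∂(π N : Measure (Fin N → ℕ)) + ∑ m, ∫ x, ((G N).meanSq m x / (L + 1) + C / (L + 1))
          ∂(π N : Measure (Fin N → ℕ)) := by
      rw [integral_add i1 i3, integral_finsetSum _ fun m _ => i2 m,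
        integral_finsetSum _ fun m _ => integrable_finsetSum _ fun l _ =>
          integrable_abs_occ_sub _ _ _ _]
      congr 1
      exact Finset.sum_congr rfl fun m _ => integral_finsetSum _ fun l _ =>
        integrable_abs_occ_sub _ _ _ _
    refine h0.trans_le (add_le_add_right ?_ _)
    have h2 : ∀ m, ∫ x, ((G N).meanSq m x / (L + 1) + C / (L + 1)) ∂(π N : Measure (Fin N → ℕ)) ≤
        2 * C / (L + 1) := by
      intro m
      rw [integral_add ((hN m).1.div_const _) (integrable_const _), integral_div]
      simp only [integral_const, probReal_univ, smul_eq_mul, one_mul]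
      rw [← add_div]
      have := (hN m).2
      gcongr
      linarith
    refine (Finset.sum_le_sum fun m _ => h2 m).trans_eq ?_
    simp
  have hmeas : ∀ N, AEMeasurable (G N).occupancy (π N : Measure (Fin N → ℕ)) := fun N =>
    (measurable_of_countable _).aemeasurable
  have hdm : ∀ ν : Measure (OccSpace M), AEStronglyMeasurable (fun y => dist y q) ν := fun ν =>
    (continuous_id.dist continuous_const).aestronglyMeasurable
  refine tendsto_diracProba_of_integral_dist ?_ ?_
  · filter_upwards [hsq] with N hN
    exact (integrable_map_measure (hdm _) (hmeas N)).2 (hbi N 0 hN).1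
  · have hmap : ∀ N, ∫ y, dist y q ∂((G N).occupancyLaw (π N) : Measure (OccSpace M)) =
        ∫ x, dist ((G N).occupancy x) q ∂(π N : Measure (Fin N → ℕ)) := fun N =>
      integral_map (hmeas N) (hdm _)
    simp only [hmap]
    rw [Metric.tendsto_nhds]
    intro η hη
    obtain ⟨L, hL⟩ : ∃ L : ℕ, M * (2 * C / (L + 1)) < η / 2 := by
      have h := (tendsto_one_div_add_atTop_nhds_zero_nat (𝕜 := ℝ)).const_mul (M * (2 * C))
      rw [mul_zero] at h
      obtain ⟨L, hL⟩ := (h.eventually (gt_mem_nhds (half_pos hη))).exists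
      exact ⟨L, by simpa only [mul_one_div, mul_div_assoc] using hL⟩
    have hfin : Tendsto (fun N => ∑ m, ∑ l ∈ Finset.range (L + 1),
        ∫ x, |(G N).occ x (m, l) - c (m, l)| ∂(π N : Measure (Fin N → ℕ))) atTop (𝓝 0) := by
      have h := tendsto_finsetSum (Finset.univ : Finset (Fin M)) fun m _ =>
        tendsto_finsetSum (Finset.range (L + 1)) fun l _ => hc (m, l)
      simpa only [Finset.sum_const_zero] using h
    filter_upwards [hsq, hfin.eventually (gt_mem_nhds (half_pos hη))] with N hN hlt
    rw [Real.dist_eq, sub_zero, abs_of_nonneg (integral_nonneg fun _ => dist_nonneg)]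
    linarith [(hbi N L hN).2]

end limit
end JSQ

theorem mainTheorem1 {K M : ℕ} (d : ℕ) (hd : 2 ≤ d)
    (lam ξ : ℝ) (hlam : 0 < lam) (hξ : 0 < ξ)
    (w : Fin K → ℝ) (hw : ∀ k, 0 < w k) (hw1 : ∑ k, w k = 1)
    (v : Fin M → ℝ) (hv : ∀ m, 0 < v m) (hv1 : ∑ m, v m = 1)
    (u : Fin M → ℝ) (hu : ∀ m, 0 < u m)
    (hcap : lam * ξ < ∑ m, u m * v m)
    (G : ∀ N : ℕ, JSQ.System K M N)
    (hW : Tendsto (fun N : ℕ => ((G N).numDisp : ℝ) / (N : ℝ)) atTop (𝓝 ξ))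
    (hWk : ∀ k, Tendsto (fun N : ℕ => (((G N).dispOf k).card : ℝ) / ((G N).numDisp : ℝ))
      atTop (𝓝 (w k)))
    (hVm : ∀ m, Tendsto (fun N : ℕ => (((G N).servOf m).card : ℝ) / (N : ℝ)) atTop (𝓝 (v m)))
    (p : Fin K → Fin M → ℝ) (hp : JSQ.CompatibilityCondition G p)
    (hδ : ∀ k, 0 < JSQ.limDeg p v k)
    (hsparse : JSQ.ClusteredProportionallySparse G)
    (ρ : ℝ) (hρ : ρ < 1)
    (hsub : Tendsto (fun N : ℕ => (G N).load d lam u) atTop (𝓝 ρ)) :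
    (∀ᶠ N : ℕ in atTop,
      (∃! π : ProbabilityMeasure (Fin N → ℕ), (G N).IsStationary d lam u π) ∧
      ∀ π : ProbabilityMeasure (Fin N → ℕ), (G N).IsStationary d lam u π →
        ∀ μ : ℝ → ProbabilityMeasure (Fin N → ℕ), (G N).IsQueueLaw d lam u μ →
          Tendsto (fun t => (G N).occupancyLaw (μ t)) atTop (𝓝 ((G N).occupancyLaw π))) ∧
    ∃ qstar : JSQ.OccSpace M,
      (JSQ.IsFixedPoint d lam ξ w v u p qstar ∧
        ∀ q : JSQ.OccSpace M, JSQ.IsFixedPoint d lam ξ w v u p q → q = qstar) ∧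
      ∀ π : ∀ N : ℕ, ProbabilityMeasure (Fin N → ℕ),
        (∀ᶠ N : ℕ in atTop, (G N).IsStationary d lam u (π N)) →
          Tendsto (fun N : ℕ => (G N).occupancyLaw (π N)) atTop (𝓝 (diracProba qstar)) := by
  have hp0 : ∀ k m, 0 ≤ p k m := fun k m =>
    ge_of_tendsto' (hp.density k m) fun N => by positivity
  set D : JSQ.LimitData K M := ⟨d, lam, ξ, w, v, u, p, by omega, hlam, hξ, hw, hv, hu, hp0, hδ⟩
    with hD
  have R : JSQ.Regime D G := ⟨hW, hWk, hVm, hp, hsparse⟩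
  have herg := (R.eventually_d_le_deg.and (hsub.eventually (gt_mem_nhds hρ))).mono fun N hN =>
    (G N).ergodic (by omega : 1 ≤ d) hlam.le hu hN.1 hN.2
  refine ⟨herg, ?_⟩
  -- a sequence of stationary laws; where there is none the choice is immaterial
  have hex : ∀ N, ∃ π : ProbabilityMeasure (Fin N → ℕ),
      (∃ π', (G N).IsStationary d lam u π') → (G N).IsStationary d lam u π := fun N => by
    by_cases h : ∃ π', (G N).IsStationary d lam u π'
    · exact ⟨h.choose, fun _ => h.choose_spec⟩
    · exact ⟨diracProba 0, fun h' => absurd h' h⟩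
  choose π₀ hπ₀ using hex
  have hstat : ∀ᶠ N in atTop, (G N).IsStationary d lam u (π₀ N) :=
    herg.mono fun N hN => hπ₀ N hN.1.exists
  obtain ⟨qstar, hfix, -⟩ := R.exists_tendsto_occupancyLaw hρ hsub hstat
  refine ⟨qstar, ⟨(D.isFixedPoint_iff qstar).2 hfix, fun q hq =>
    D.fixedPoint_unique ((D.isFixedPoint_iff q).1 hq) hfix⟩, fun π hπ => ?_⟩
  obtain ⟨q, hq, hlim⟩ := R.exists_tendsto_occupancyLaw hρ hsub hπ
  rwa [D.fixedPoint_unique hq hfix] at hlim
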